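/- **Model.** A configuration $(G,w)$ is a finite connected simple graph $G=(V,E)$ with $n=|V|\ge 1$ nodes, together with an input $w(v)\in\{0,1\}^*$ for every node $v$; $|w|=\sum_{v}|w(v)|$ denotes the length of the whole input. Fix a polynomial $q$ with natural coefficients and $q(n)\ge n$ for all $n$. An identifier assignment for $(G,w)$ is an injective map $\mathrm{Id}:V\to\{1,\dots,q(n)\}$. A distributed language is a decidable set of configurations. A local algorithm is a (computable) distributed algorithm in the synchronous LOCAL model (messages of unbounded size) that runs for a constant number of rounds, after which every node accepts or rejects; initially a node knows its identifier and its input. It decides a language $L$ if, for every configuration $(G,w)$ and every identifier assignment, all nodes accept if and only if $(G,w)\in L$. A local verifier is a local algorithm in which every node $v$ additionally gets a certificate $c(v)\in\{0,1\}^*$. It verifies $L$ if (a) for every $(G,w)\in L$ there is a certificate $c$ such that all nodes accept under every identifier assignment, and (b) for every $(G,w)\notin L$, every certificate and every identifier assignment, some node rejects. The size of $c$ is $\max_v|c(v)|$. $\mathrm{LD}$ is the class of distributed languages decided by a local algorithm, and $\mathrm{NLD}$ the class of distributed languages verified by a local verifier. For $f:\mathbb N^2\to\mathbb N$, a verifier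 of $L$ is $f$-bounded if for every $(G,w)\in L$ there is a certificate as in (a) of size at most $f(n,|w|)$. $\mathrm{NLD}(\mathcal O(g))$ is the class of distributed languages that have an $f$-bounded local verifier for some $f\in\mathcal O(g)$ that is monotone (non-decreasing) in both arguments. "Every local verifier for $L$ needs certificates of size $\Omega(g)$" means: whenever a local verifier of $L$ is $f$-bounded with $f$ monotone, then $f\in\Omega(g)$. **Theorem.** For every such $q$, $$\mathrm{LD}\subsetneq \mathrm{NLD}(\mathcal O(1))\subsetneq \mathrm{NLD}(\mathcal O(\log n))\subsetneq \mathrm{NLD}(\mathcal O(n))\subsetneq \mathrm{NLD}(\mathcal O(n^2))\subseteq \mathrm{NLD}(\mathcal O(n^2+|w|))=\mathrm{NLD}.$$ Moreover: * Let $\mathrm{Tree}$ be the set of all configurations in which $G$ is a tree and all inputs are empty. Then $\mathrm{Tree}\in\mathrm{NLD}(\mathcal O(\log n))$, and every local verifier for $\mathrm{Tree}$ needs certificates of size $\Omega(\log n)$. * Let $\mathrm{FPFSymmetryOnTrees}$ be the set of all configurations in which $G$ is a tree with a graph automorphism without fixed nodes and all inputs are empty. Then $\mathrm{FPFSymmetryOnTrees}\in\mathrm{NLD}(\mathcal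 O(n))$, and every local verifier for it needs certificates of size $\Omega(n)$. * Let $\mathrm{EqSizePartition}$ be the set of all configurations in which every input is the one-letter string $0$ or $1$, and equally many nodes have input $0$ and input $1$. Then $\mathrm{EqSizePartition}\in\mathrm{NLD}(\mathcal O(n^2))$. -/

import Mathlib

open Filter Asymptotics

/-- A configuration `(G, w)`: a connected network on finitely many nodes, with a binary string as the
local input of every node. Connectedness includes that there is at least one node. -/
structure Config where
  n : ℕ
  graph : SimpleGraph (Fin n)
  connected : graph.Connected
  input : Fin n → List Bool

namespace Config

/-- The length `|w|` of the input, that is, the total length of the inputs of all nodes. -/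
def inputLength (C : Config) : ℕ := ∑ v, (C.input v).length

open Classical in
/-- The rows of the adjacency matrix of `G`, and the list of the inputs. -/
noncomputable def code (C : Config) : List (List Bool) × List (List Bool) :=
  (List.ofFn fun i => List.ofFn fun j => decide (C.graph.Adj i j), List.ofFn C.input)

/-- The identifier assignments with identifiers in `{1, …, q(n)}`. -/
def IsIdAssignment (q : Polynomial ℕ) (C : Config) (ident : Fin C.n → ℕ) : Prop :=
  Function.Injective ident ∧ ∀ v, 1 ≤ ident v ∧ ident v ≤ q.eval C.n

open Classical in
/-- The neighbours of `v`, in the order of their identifiers. (The numbering of the nodes by `Fin n`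
is thus invisible to an algorithm.) -/
noncomputable def neighbors (C : Config) (ident : Fin C.n → ℕ) (v : Fin C.n) : List (Fin C.n) :=
  ((List.finRange C.n).filter fun u => decide (C.graph.Adj v u)).mergeSort
    fun a b => decide (ident a ≤ ident b)

end Config

/-- A set of configurations is decidable if a computable function on codes decides it. -/
def IsDecidableLanguage (L : Set Config) : Prop :=
  ∃ p : List (List Bool) × List (List Bool) → Bool, Computable p ∧ ∀ C : Config, p C.code = true ↔ C ∈ L

/-- A local distributed algorithm (in the LOCAL model) with a constant number of rounds, in which a
node initially knows its identifier and a local datum of type `α`. In each round every node sends its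
whole state to all neighbours (message size is unbounded, so that this loses no generality), and
computes its new state from the old one and from the received messages. After the last round, every
node accepts or rejects. -/
structure LocalAlgorithm (α : Type) [Primcodable α] where
  State : Type
  [primcodable : Primcodable State]
  rounds : ℕ
  init : ℕ × α → State
  step : State × List State → State
  out : State → Bool
  computable_init : Computable init
  computable_step : Computable step
  computable_out : Computable out

namespace LocalAlgorithm

variable {α : Type} [Primcodable α]

/-- The state of every node after `r` rounds. -/
noncomputable def stateAfter (A : LocalAlgorithm α) (C : Config) (ident : Fin C.n → ℕ)
    (x : Fin C.n → α) : ℕ → Fin C.n → A.State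
  | 0, v => A.init (ident v, x v)
  | r + 1, v =>
      A.step (A.stateAfter C ident x r v, (C.neighbors ident v).map (A.stateAfter C ident x r))

/-- All nodes accept. -/
def AllAccept (A : LocalAlgorithm α) (C : Config) (ident : Fin C.n → ℕ) (x : Fin C.n → α) : Prop :=
  ∀ v, A.out (A.stateAfter C ident x A.rounds v) = true

end LocalAlgorithm

/-- The algorithm decides `L`: under every identifier assignment, all nodes accept a configuration
if and only if it belongs to `L`. -/
def Decides (q : Polynomial ℕ) (A : LocalAlgorithm (List Bool)) (L : Set Config) : Prop :=
  ∀ (C : Config) (ident : Fin C.n → ℕ), C.IsIdAssignment q ident →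
    (A.AllAccept C ident C.input ↔ C ∈ L)

/-- A local verifier: every node knows its input and its certificate, in this order. -/
abbrev LocalVerifier : Type 1 := LocalAlgorithm (List Bool × List Bool)

/-- A certificate leads to acceptance at all nodes under every identifier assignment. -/
def LocalVerifier.AcceptsCert (q : Polynomial ℕ) (A : LocalVerifier) (C : Config)
    (c : Fin C.n → List Bool) : Prop :=
  ∀ ident : Fin C.n → ℕ, C.IsIdAssignment q ident →
    LocalAlgorithm.AllAccept A C ident fun v => (C.input v, c v)

/-- The verifier verifies `L`. Certificates do not depend on the identifiers. -/
def Verifies (q : Polynomial ℕ) (A : LocalVerifier) (L : Set Config) : Prop :=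
  (∀ C ∈ L, ∃ c : Fin C.n → List Bool, LocalVerifier.AcceptsCert q A C c) ∧
  ∀ C ∉ L, ∀ (c : Fin C.n → List Bool) (ident : Fin C.n → ℕ), C.IsIdAssignment q ident →
    ¬ LocalAlgorithm.AllAccept A C ident fun v => (C.input v, c v)

/-- The size of a certificate: the maximum of the lengths at the nodes. -/
def certSize {n : ℕ} (c : Fin n → List Bool) : ℕ := Finset.univ.sup fun v => (c v).length

/-- For every configuration of `L`, the minimum size of an accepted certificate is at most
`f (n, |w|)`. -/
def IsCertBounded (q : Polynomial ℕ) (A : LocalVerifier) (L : Set Config) (f : ℕ × ℕ → ℕ) : Prop :=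
  ∀ C ∈ L, ∃ c : Fin C.n → List Bool,
    certSize c ≤ f (C.n, C.inputLength) ∧ LocalVerifier.AcceptsCert q A C c

/-- The class `LD`. -/
def LD (q : Polynomial ℕ) : Set (Set Config) :=
  {L | IsDecidableLanguage L ∧ ∃ A : LocalAlgorithm (List Bool), Decides q A L}

/-- The class `NLD`. -/
def NLD (q : Polynomial ℕ) : Set (Set Config) :=
  {L | IsDecidableLanguage L ∧ ∃ A : LocalVerifier, Verifies q A L}

/-- The class `NLD(F)` for a set `F` of functions of `n` and `|w|`. -/
def NLDOf (q : Polynomial ℕ) (F : Set (ℕ × ℕ → ℕ)) : Set (Set Config) :=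
  {L | IsDecidableLanguage L ∧
    ∃ A : LocalVerifier, Verifies q A L ∧ ∃ f ∈ F, IsCertBounded q A L f}

/-- `O(g)` for functions of `n` and `|w|`; complexity functions are monotone in both arguments. -/
def bigO (g : ℕ × ℕ → ℝ) : Set (ℕ × ℕ → ℕ) :=
  {f | Monotone f ∧ (fun x => (f x : ℝ)) =O[atTop] g}

/-- Every local verifier for `L` needs certificates of size `Ω(g)`: every monotone function that bounds
the certificate size of a local verifier for `L` is in `Ω(g)`. -/
def NeedsCertSize (q : Polynomial ℕ) (L : Set Config) (g : ℕ × ℕ → ℝ) : Prop :=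
  ∀ A : LocalVerifier, Verifies q A L → ∀ f : ℕ × ℕ → ℕ, Monotone f → IsCertBounded q A L f →
    g =O[atTop] fun x => (f x : ℝ)

/-- Trees without inputs, with a node from which all nodes have distance at most `t`. -/
def TreeOfRadius (t : ℕ) : Set Config :=
  {C | C.graph.IsTree ∧ (∃ v, ∀ v', C.graph.dist v v' ≤ t) ∧ ∀ v, C.input v = []}

/-- The language `Tree`. -/
def TreeLanguage : Set Config := ⋃ t : ℕ, TreeOfRadius t

/-- The language `FPFSymmetryOnTrees`. -/
def FPFSymmetryOnTrees : Set Config :=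
  {C | C.graph.IsTree ∧ (∃ φ : C.graph ≃g C.graph, ∀ v, φ v ≠ v) ∧ ∀ v, C.input v = []}

/-- The language `EqSizePartition`. -/
def EqSizePartition : Set Config :=
  {C | (∀ v, C.input v = [false] ∨ C.input v = [true]) ∧
    {v | C.input v = [false]}.ncard = {v | C.input v = [true]}.ncard}

/-!
The upper bounds come from explicit verifiers, the lower bounds from the locality of algorithms
(`LocalAlgorithm.stateAfter_eq_of_ball`): after `r` rounds the state of a node depends on its ball of
radius `r` only.

*Certificates of size `O(n² + |w|)` suffice for all of `NLD`* (`NLD_subset`). The certificate of a node is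
a description of the whole configuration together with the number of the node. If the nodes check that
their neighbourhoods are as described, then an accepted certificate makes the actual network a cover of
the described one. If in addition the nodes check that numbers and identifiers match in their balls, then
the cover is injective on all views of a given verifier `A` of `L` (`IsLocalCover`). Thus, if the
description belongs to `L`, then so does the actual configuration, since certificates for `A` can be lifted
(`Verifies.mem_of_isLocalCover`). The same construction applies to every decidable language that is closed
under such covers. `EqSizePartition` is closed under all covers, because all fibres of a cover of a
connected network have the same size; its inputs have total length `n`.

*Trees* are certified by the distance from a root, in binary (`treeLanguage_mem`). If the certificates of a
long path are too short, then they repeat on two windows of the size of a view, and the segment between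
the windows can be closed to a cycle that is accepted (`le_of_verifies_treeLanguage`).

*Symmetric trees.* An automorphism of a tree without fixed vertices swaps the ends of an edge, since there
are fewer edges than vertices (`SimpleGraph.IsTree.exists_swapped_edge`). The canonical parenthesis codes
of the subtrees away from this edge have linear length, and they can be checked locally. Conversely, such
labels define an automorphism, which is built from the roots downwards
(`SimpleGraph.IsSymmetryLabeling.exists_iso`). For the lower bound, a word is written into a caterpillar
from both ends. With an even number of blocks, the first and the last of which have the bit `true`, it is
symmetric if and only if it is palindromic. If there are fewer certificates on the middle part than words,
then two different words have the same certificates there, and their caterpillars can be combined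
(`le_of_verifies_FPFSymmetryOnTrees`).

*Strictness.* The languages above separate `O(1)`, `O(log n)` and `O(n)`. The remaining separations use
`AgreementLanguage h`: all nonempty inputs are equal, and their length is at most `h` of the degree. The
common input is a certificate. In a dumbbell, that is, two cliques with `m` nodes that are joined by a path
of constant length, the certificates on the path must determine the inputs of length `h m` at the two ends
(`le_of_verifies_agreement`). For `h = 1` this language is not in `LD`, and for `h d = d ^ 2` it needs more
than `O(n)`. In all lower bounds, the length of the overlap (of order the number of rounds) is constant.
-/

/-! ### Distances in graphs -/

namespace SimpleGraph

variable {V : Type*} {G : SimpleGraph V}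

/-- A cycle would have a vertex of maximal level, and both of its neighbours on the cycle would have at
most this level. -/
theorem isAcyclic_of_level {β : Type*} [LinearOrder β] (f : V → β)
    (h : ∀ v u u', G.Adj v u → G.Adj v u' → f u ≤ f v → f u' ≤ f v → u = u') : G.IsAcyclic := by
  classical
  intro a w hw
  obtain ⟨v, hv, hmax⟩ := w.support.toFinset.exists_max_image f ⟨a, by simp⟩
  rw [List.mem_toFinset] at hv
  have hc := hw.rotate hv
  have hle : ∀ u ∈ (w.rotate v hv).support, f u ≤ f v := fun u hu =>
    hmax u (by
      rw [List.mem_toFinset]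
      rcases eq_or_ne u v with rfl | hne
      · exact hv
      · exact (Walk.mem_support_rotate_iff _ _ hv).1 hu)
  have hnil : ¬ (w.rotate v hv).Nil := hc.not_nil
  refine hc.snd_ne_penultimate (h v _ _ ((w.rotate v hv).adj_snd hnil)
    ((w.rotate v hv).adj_penultimate hnil).symm (hle _ ?_) (hle _ ?_))
  · exact Walk.getVert_mem_support _ _
  · exact Walk.getVert_mem_support _ _

/-- In a tree, every vertex has at most one neighbour that is closer to a given vertex. -/
theorem IsTree.eq_of_adj_of_dist_add_one (hG : G.IsTree) {r v u u' : V} (hu : G.Adj v u)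
    (hu' : G.Adj v u') (h : G.dist r u + 1 = G.dist r v) (h' : G.dist r u' + 1 = G.dist r v) :
    u = u' := by
  obtain ⟨p, hp⟩ := hG.connected.exists_walk_length_eq_dist r u
  obtain ⟨p', hp'⟩ := hG.connected.exists_walk_length_eq_dist r u'
  have h1 : (p.concat hu.symm).IsPath := Walk.isPath_of_length_eq_dist _ (by simp [hp, h])
  have h2 : (p'.concat hu'.symm).IsPath := Walk.isPath_of_length_eq_dist _ (by simp [hp', h'])
  have := congrArg Subtype.val ((hG.isAcyclic.subsingleton_path r v).elim ⟨_, h1⟩ ⟨_, h2⟩)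
  obtain ⟨e, -⟩ := Walk.concat_inj this
  exact e

/-- Every vertex other than `r` has a neighbour that is closer to `r`. -/
theorem Connected.exists_adj_dist_add_one (hG : G.Connected) {r v : V} (h : v ≠ r) :
    ∃ u, G.Adj v u ∧ G.dist r u + 1 = G.dist r v := by
  obtain ⟨p, hp⟩ := hG.exists_walk_length_eq_dist v r
  cases p with
  | nil => exact absurd rfl h
  | @cons _ u _ huv p =>
    refine ⟨u, huv, ?_⟩
    rw [dist_comm, dist_comm (u := r)]
    have h1 := dist_le p
    have h2 := hG.dist_triangle (u := v) (v := u) (w := r)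
    rw [dist_eq_one_iff_adj.2 huv] at h2
    simp only [Walk.length_cons] at hp
    omega

/-- A potential that changes by at most one along every edge changes by at most the distance. -/
theorem Connected.le_add_dist (hG : G.Connected) (f : V → ℕ)
    (h : ∀ u v, G.Adj u v → f v ≤ f u + 1) (u v : V) : f v ≤ f u + G.dist u v := by
  obtain ⟨p, hp⟩ := hG.exists_walk_length_eq_dist u v
  rw [← hp]
  clear hp
  induction p with
  | nil => simp
  | cons hadj p ih =>
    have := h _ _ hadj
    simp only [Walk.length_cons]
    omega

/-- A vertex set of a connected graph that is closed under adjacency contains everything. -/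
theorem Connected.forall_of_adj (hG : G.Connected) {P : V → Prop} {a : V} (ha : P a)
    (h : ∀ u v, G.Adj u v → P u → P v) (v : V) : P v := by
  obtain ⟨p⟩ := hG.preconnected a v
  induction p with
  | nil => exact ha
  | cons hadj p ih => exact ih (h _ _ hadj ha)

end SimpleGraph

/-! ### Locality of algorithms -/

namespace Config

theorem mem_neighbors {C : Config} {ident : Fin C.n → ℕ} {u v : Fin C.n} :
    u ∈ C.neighbors ident v ↔ C.graph.Adj v u := by
  simp [neighbors, List.mem_mergeSort]

theorem nodup_neighbors (C : Config) (ident : Fin C.n → ℕ) (v : Fin C.n) :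
    (C.neighbors ident v).Nodup :=
  (List.mergeSort_perm _ _).nodup_iff.2 ((List.nodup_finRange _).filter _)

theorem pairwise_neighbors (C : Config) (ident : Fin C.n → ℕ) (v : Fin C.n) :
    (C.neighbors ident v).Pairwise fun a b => ident a ≤ ident b := by
  have := List.pairwise_mergeSort (le := fun a b => decide (ident a ≤ ident b))
    (by intro a b c; simp only [decide_eq_true_eq]; omega)
    (by intro a b; simp only [Bool.or_eq_true, decide_eq_true_eq]; omega)
    ((List.finRange C.n).filter fun u => @decide (C.graph.Adj v u) (Classical.propDecidable _))
  simpa [neighbors] using this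

/-- A map that is a bijection between the neighbourhoods of `v` and `f v` and preserves the
identifiers preserves the order in which the neighbours are listed. -/
theorem map_neighbors {C C' : Config} {ident : Fin C.n → ℕ} {ident' : Fin C'.n → ℕ}
    (hinj : Function.Injective ident') {f : Fin C.n → Fin C'.n} {v : Fin C.n}
    (hf : Set.BijOn f (C.graph.neighborSet v) (C'.graph.neighborSet (f v)))
    (hid : ∀ u, C.graph.Adj v u → ident u = ident' (f u)) :
    (C.neighbors ident v).map f = C'.neighbors ident' (f v) := by
  have hnd : ((C.neighbors ident v).map f).Nodup := by
    refine List.Nodup.map_on ?_ (C.nodup_neighbors ident v)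
    intro a ha b hb hab
    exact hf.injOn (mem_neighbors.1 ha) (mem_neighbors.1 hb) hab
  have hperm : ((C.neighbors ident v).map f).Perm (C'.neighbors ident' (f v)) := by
    rw [List.perm_ext_iff_of_nodup hnd (C'.nodup_neighbors ident' _)]
    intro b
    rw [mem_neighbors, List.mem_map]
    constructor
    · rintro ⟨a, ha, rfl⟩
      exact hf.mapsTo (mem_neighbors.1 ha)
    · intro hb
      obtain ⟨a, ha, rfl⟩ := hf.surjOn hb
      exact ⟨a, mem_neighbors.2 ha, rfl⟩
  refine hperm.eq_of_pairwise (le := fun a b => ident' a ≤ ident' b) ?_ ?_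
    (C'.pairwise_neighbors ident' _)
  · intro a b _ _ h1 h2
    exact hinj (le_antisymm h1 h2)
  · rw [List.pairwise_map]
    refine (C.pairwise_neighbors ident v).imp_of_mem ?_
    intro a b ha hb hab
    rwa [← hid a (mem_neighbors.1 ha), ← hid b (mem_neighbors.1 hb)]

/-- Identifiers that are prescribed on some nodes extend to an identifier assignment. -/
theorem exists_isIdAssignment {q : Polynomial ℕ} (hq : ∀ n : ℕ, n ≤ q.eval n) (C : Config)
    (S : Finset (Fin C.n)) (g : Fin C.n → ℕ) (hg : Set.InjOn g S)
    (hS : ∀ v ∈ S, 1 ≤ g v ∧ g v ≤ q.eval C.n) :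
    ∃ ident, C.IsIdAssignment q ident ∧ ∀ v ∈ S, ident v = g v := by
  classical
  have hsub : S.image g ⊆ Finset.Icc 1 (q.eval C.n) := by
    intro y hy
    obtain ⟨v, hv, rfl⟩ := Finset.mem_image.1 hy
    exact Finset.mem_Icc.2 (hS v hv)
  obtain ⟨t, ht1, ht2, ht3⟩ := Finset.exists_subsuperset_card_eq hsub (n := C.n)
    (by rw [Finset.card_image_of_injOn hg]; simpa using S.card_le_univ)
    (by simpa using hq C.n)
  obtain ⟨e, he⟩ := Finset.exists_equiv_extend_of_card_eq (α := Fin C.n) (t := t)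
    (by simp [ht3]) ht1 hg
  refine ⟨fun v => e v, ⟨fun a b hab => e.injective (Subtype.ext hab), fun v => ?_⟩, he⟩
  exact Finset.mem_Icc.1 (ht2 (e v).2)

/-- The identifier assignment that is given by the numbering of the nodes. -/
theorem isIdAssignment_succ {q : Polynomial ℕ} (hq : ∀ n : ℕ, n ≤ q.eval n) (C : Config) :
    C.IsIdAssignment q fun v => v + 1 :=
  ⟨fun a b h => Fin.ext (by simpa using h), fun v => ⟨by simp, le_trans v.2 (hq _)⟩⟩

theorem n_pos (C : Config) : 0 < C.n := by
  obtain ⟨v⟩ := C.connected.nonempty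
  exact v.pos

end Config

namespace LocalAlgorithm

variable {α : Type} [Primcodable α]

/-- Locality: the state of a node after `r` rounds only depends on its ball of radius `r`. The ball may
be mapped by any map that is locally bijective in its interior. -/
theorem stateAfter_eq_of_ball (A : LocalAlgorithm α) {C C' : Config} {ident : Fin C.n → ℕ}
    {ident' : Fin C'.n → ℕ} (hinj : Function.Injective ident') {x : Fin C.n → α}
    {x' : Fin C'.n → α} (f : Fin C.n → Fin C'.n) (r : ℕ) (v : Fin C.n)
    (hx : ∀ u, C.graph.dist v u ≤ r → ident u = ident' (f u) ∧ x u = x' (f u))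
    (hf : ∀ u, C.graph.dist v u < r →
      Set.BijOn f (C.graph.neighborSet u) (C'.graph.neighborSet (f u))) :
    A.stateAfter C ident x r v = A.stateAfter C' ident' x' r (f v) := by
  induction r generalizing v with
  | zero =>
    have := hx v (by simp)
    simp [stateAfter, this.1, this.2]
  | succ r ih =>
    have hadj : ∀ u w, C.graph.Adj v u → C.graph.dist v w ≤ C.graph.dist u w + 1 := by
      intro u w hu
      have h1 := C.connected.dist_triangle (u := v) (v := u) (w := w)
      rw [SimpleGraph.dist_eq_one_iff_adj.2 hu] at h1
      omega
    have hv := ih v (fun u hu => hx u (by omega)) (fun u hu => hf u (by omega))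
    have hn : (C.neighbors ident v).map f = C'.neighbors ident' (f v) :=
      Config.map_neighbors hinj (hf v (by simp)) fun u hu =>
        (hx u (by rw [SimpleGraph.dist_eq_one_iff_adj.2 hu]; omega)).1
    rw [stateAfter, stateAfter, hv, ← hn, List.map_map]
    congr 2
    refine List.map_congr_left fun u hu => ?_
    have hu := Config.mem_neighbors.1 hu
    exact ih u (fun w hw => hx w (by have := hadj u w hu; omega))
      (fun w hw => hf w (by have := hadj u w hu; omega))

/-- The algorithm with a single round whose nodes decide on their own datum and the data of their
neighbours. -/
def oneRound (P : α × List α → Bool) (hP : Computable P) : LocalAlgorithm α where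
  State := α × List α
  rounds := 1
  init := fun y => (y.2, [])
  step := fun y => (y.1.1, y.2.map Prod.fst)
  out := P
  computable_init := (Primrec.pair .snd (.const _)).to_comp
  computable_step := (Primrec.pair (Primrec.fst.comp .fst)
    (Primrec.list_map .snd (Primrec.fst.comp .snd).to₂)).to_comp
  computable_out := hP

theorem allAccept_oneRound {P : α × List α → Bool} {hP : Computable P} {C : Config}
    {ident : Fin C.n → ℕ} {x : Fin C.n → α} :
    (oneRound P hP).AllAccept C ident x ↔
      ∀ v, P (x v, (C.neighbors ident v).map x) = true := by
  simp [AllAccept, oneRound, stateAfter, Function.comp_def]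

/-- The algorithm with `t + 1` rounds in which every node collects the identifiers and the data of its
ball of radius `t + 1`. It decides on its own identifier and datum, those of its neighbours, and those
of its ball, in this order. -/
def gather (t : ℕ) (P : (ℕ × α) × List (ℕ × α) × List (ℕ × α) → Bool) (hP : Computable P) :
    LocalAlgorithm α where
  State := (ℕ × α) × List (ℕ × α) × List (ℕ × α)
  rounds := t + 1
  init := fun y => (y, [], [y])
  step := fun y => (y.1.1, y.2.map Prod.fst, y.1.2.2 ++ y.2.flatMap fun s => s.2.2)
  out := P
  computable_init := (Primrec.pair .id (.pair (.const _)
    (Primrec.list_cons.comp .id (.const _)))).to_comp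
  computable_step := (Primrec.pair (Primrec.fst.comp .fst)
    (.pair (Primrec.list_map .snd (Primrec.fst.comp .snd).to₂)
      (Primrec.list_append.comp (Primrec.snd.comp (Primrec.snd.comp .fst))
        (Primrec.list_flatMap .snd (Primrec.snd.comp (Primrec.snd.comp .snd)).to₂)))).to_comp
  computable_out := hP

/-- The state of a node after `r` rounds of `gather`: for `r > 0`, the second component is the list of the
neighbours, and the third one is a list of nodes that contains the ball of radius `r`. -/
theorem exists_ball_of_gather (t : ℕ) (P : (ℕ × α) × List (ℕ × α) × List (ℕ × α) → Bool)
    (hP : Computable P) (C : Config) (ident : Fin C.n → ℕ) (x : Fin C.n → α) (r : ℕ)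
    (v : Fin C.n) :
    ∃ l m : List (ℕ × α), (gather t P hP).stateAfter C ident x r v = ((ident v, x v), l, m) ∧
      (0 < r → l = (C.neighbors ident v).map fun u => (ident u, x u)) ∧
      (∀ u, C.graph.dist v u ≤ r → (ident u, x u) ∈ m) ∧ ∀ y ∈ m, ∃ u, y = (ident u, x u) := by
  induction r generalizing v with
  | zero =>
    refine ⟨[], [(ident v, x v)], rfl, by simp, fun u hu => ?_, fun y hy => ⟨v, by simpa using hy⟩⟩
    have := C.connected.dist_eq_zero_iff.1 (Nat.le_zero.1 hu)
    simp [this]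
  | succ r ih =>
    choose l m h1 _ h3 h4 using ih
    refine ⟨(C.neighbors ident v).map fun u => (ident u, x u),
      m v ++ (C.neighbors ident v).flatMap m, ?_, fun _ => rfl, ?_, ?_⟩
    · have : (gather t P hP).stateAfter C ident x r = fun v => ((ident v, x v), l v, m v) :=
        funext h1
      rw [stateAfter, this]
      simp [gather, Function.comp_def, List.flatMap_map]
    · intro u hu
      rcases eq_or_ne v u with rfl | hne
      · exact List.mem_append_left _ (h3 v v (by simp))
      · obtain ⟨w, hw, hd⟩ := C.connected.exists_adj_dist_add_one hne
        refine List.mem_append_right _ (List.mem_flatMap.2 ⟨w, Config.mem_neighbors.2 hw, h3 w u ?_⟩)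
        rw [SimpleGraph.dist_comm] at hu ⊢
        omega
    · intro y hy
      rcases List.mem_append.1 hy with hy | hy
      · exact h4 _ _ hy
      · obtain ⟨w, -, hw⟩ := List.mem_flatMap.1 hy
        exact h4 _ _ hw

/-- What the nodes see in the last round of `gather`: the list of all neighbours, and a list of nodes
that contains at least the ball of radius `t + 1`. -/
theorem allAccept_gather (t : ℕ) (P : (ℕ × α) × List (ℕ × α) × List (ℕ × α) → Bool)
    (hP : Computable P) (C : Config) (ident : Fin C.n → ℕ) (x : Fin C.n → α) :
    ∃ m : Fin C.n → List (ℕ × α),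
      ((gather t P hP).AllAccept C ident x ↔ ∀ v, P ((ident v, x v),
        (C.neighbors ident v).map (fun u => (ident u, x u)), m v) = true) ∧
      ∀ v, (∀ u, C.graph.dist v u ≤ t + 1 → (ident u, x u) ∈ m v) ∧
        ∀ y ∈ m v, ∃ u, y = (ident u, x u) := by
  choose l m h1 h2 h3 h4 using exists_ball_of_gather t P hP C ident x (t + 1)
  refine ⟨m, ?_, fun v => ⟨h3 v, h4 v⟩⟩
  refine forall_congr' fun v => ?_
  change (P ((gather t P hP).stateAfter C ident x (t + 1) v) = true) ↔ _
  rw [h1, h2 v t.succ_pos]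

end LocalAlgorithm

/-- A filtered list of neighbours has at most one element if and only if at most one neighbour
satisfies the condition. -/
theorem Config.length_filter_neighbors_le_one {α : Type} {C : Config} {ident : Fin C.n → ℕ}
    {v : Fin C.n} {x : Fin C.n → α} {p : α → Bool} :
    (((C.neighbors ident v).map x).filter p).length ≤ 1 ↔
      ∀ u u', C.graph.Adj v u → C.graph.Adj v u' → p (x u) = true → p (x u') = true → u = u' := by
  rw [List.filter_map, List.length_map]
  have hnd : ((C.neighbors ident v).filter (p ∘ x)).Nodup := (C.nodup_neighbors ident v).filter _
  have hmem : ∀ u, u ∈ (C.neighbors ident v).filter (p ∘ x) ↔ C.graph.Adj v u ∧ p (x u) = true := by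
    intro u
    rw [List.mem_filter, Config.mem_neighbors]
    rfl
  rw [← List.toFinset_card_of_nodup hnd, Finset.card_le_one]
  simp only [List.mem_toFinset, hmem]
  exact ⟨fun h u u' h1 h2 h3 h4 => h u ⟨h1, h3⟩ u' ⟨h2, h4⟩,
    fun h u hu u' hu' => h u u' hu.1 hu'.1 hu.2 hu'.2⟩

/-! ### Primitive recursive predicates -/

section Primrec

variable {α β : Type*} [Primcodable α] [Primcodable β]

theorem PrimrecPred.forall_mem_of {f : α → List β} {p : α → β → Prop} (hf : Primrec f)
    (hp : PrimrecPred fun x : α × β => p x.1 x.2) : PrimrecPred fun a => ∀ i ∈ f a, p a i :=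
  have : PrimrecRel fun (i : β) (a : α) => p a i := hp.comp (Primrec.pair .snd .fst)
  PrimrecRel.comp (R := fun (l : List β) (a : α) => ∀ i ∈ l, p a i) (PrimrecRel.forall_mem_list this) hf .id

theorem PrimrecPred.exists_mem_of {f : α → List β} {p : α → β → Prop} (hf : Primrec f)
    (hp : PrimrecPred fun x : α × β => p x.1 x.2) : PrimrecPred fun a => ∃ i ∈ f a, p a i :=
  have : PrimrecRel fun (i : β) (a : α) => p a i := hp.comp (Primrec.pair .snd .fst)
  PrimrecRel.comp (R := fun (l : List β) (a : α) => ∃ i ∈ l, p a i) (PrimrecRel.exists_mem_list this) hf .id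

theorem PrimrecPred.forall_lt_of {f : α → ℕ} {p : α → ℕ → Prop} (hf : Primrec f)
    (hp : PrimrecPred fun x : α × ℕ => p x.1 x.2) : PrimrecPred fun a => ∀ i < f a, p a i :=
  (PrimrecPred.forall_mem_of (Primrec.list_range.comp hf) hp).of_eq fun a => by simp

theorem PrimrecPred.exists_lt_of {f : α → ℕ} {p : α → ℕ → Prop} (hf : Primrec f)
    (hp : PrimrecPred fun x : α × ℕ => p x.1 x.2) : PrimrecPred fun a => ∃ i < f a, p a i :=
  (PrimrecPred.exists_mem_of (Primrec.list_range.comp hf) hp).of_eq fun a => by simp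

theorem PrimrecPred.imp {p q : α → Prop} (hp : PrimrecPred p) (hq : PrimrecPred q) :
    PrimrecPred fun a => p a → q a :=
  (hp.not.or hq).of_eq fun a => by tauto

theorem PrimrecPred.eq_of [DecidableEq β] {f g : α → β} (hf : Primrec f) (hg : Primrec g) :
    PrimrecPred fun a => f a = g a :=
  Primrec.eq.comp hf hg

theorem PrimrecPred.le_of {f g : α → ℕ} (hf : Primrec f) (hg : Primrec g) :
    PrimrecPred fun a => f a ≤ g a :=
  Primrec.nat_le.comp hf hg

theorem PrimrecPred.lt_of {f g : α → ℕ} (hf : Primrec f) (hg : Primrec g) :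
    PrimrecPred fun a => f a < g a :=
  Primrec.nat_lt.comp hf hg

theorem Primrec.list_filter_of {f : α → List β} {p : α → β → Bool} (hf : Primrec f)
    (hp : Primrec fun x : α × β => p x.1 x.2) : Primrec fun a => (f a).filter (p a) := by
  refine (Primrec.of_eq (Primrec.list_flatMap hf (g := fun a b => (bif p a b then [b] else []))
    ?_) fun a => ?_)
  · exact Primrec.cond hp (Primrec.list_cons.comp .snd (.const [])) (.const [])
  · induction f a with
    | nil => rfl
    | cons b l ih =>
      rw [List.flatMap_cons, ih]
      cases h : p a b <;> simp [h]

theorem Primrec.list_count_of [DecidableEq β] [BEq β] [LawfulBEq β] {f : α → List β}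
    {g : α → β} (hf : Primrec f) (hg : Primrec g) : Primrec fun a => (f a).count (g a) := by
  refine (Primrec.list_length.comp (Primrec.list_filter_of (p := fun a b => decide (b = g a)) hf
    (primrecPred_iff_primrec_decide.1 (PrimrecPred.eq_of .snd (hg.comp .fst))))).of_eq fun a => ?_
  rw [List.count_eq_length_filter]
  congr 2
  ext b
  exact Bool.eq_iff_iff.2 (by simp)

/-- Lists are permutations of each other if all their entries have the same multiplicities. -/
theorem PrimrecPred.perm_of [DecidableEq β] {f g : α → List β} (hf : Primrec f) (hg : Primrec g) :
    PrimrecPred fun a => (f a).Perm (g a) := by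
  have h : PrimrecPred fun x : α × β => (f x.1).count x.2 = (g x.1).count x.2 :=
    .eq_of (Primrec.list_count_of (hf.comp .fst) .snd) (Primrec.list_count_of (hg.comp .fst) .snd)
  let p : α → β → Prop := fun a b => (f a).count b = (g a).count b
  refine ((PrimrecPred.forall_mem_of (p := p) hf h).and (.forall_mem_of (p := p) hg h)).of_eq fun a => ?_
  rw [List.perm_iff_count]
  refine ⟨fun h b => ?_, fun h => ⟨fun b _ => h b, fun b _ => h b⟩⟩
  by_cases h1 : b ∈ f a
  · exact h.1 b h1
  by_cases h2 : b ∈ g a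
  · exact h.2 b h2
  rw [List.count_eq_zero_of_not_mem h1, List.count_eq_zero_of_not_mem h2]

theorem Primrec.polynomial_eval (q : Polynomial ℕ) : Primrec fun n : ℕ => q.eval n := by
  have hpow : ∀ k : ℕ, Primrec fun n : ℕ => n ^ k := by
    intro k
    induction k with
    | zero => simpa using Primrec.const 1
    | succ k ih => simpa [pow_succ] using Primrec.nat_mul.comp ih .id
  induction q using Polynomial.induction_on' with
  | add p q hp hq => simpa using Primrec.nat_add.comp hp hq
  | monomial k a => simpa using Primrec.nat_mul.comp (.const a) (hpow k)

/-- All lists of length `k` with entries below `n`. -/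
def allLists (n : ℕ) : ℕ → List (List ℕ)
  | 0 => [[]]
  | k + 1 => (allLists n k).flatMap fun l => (List.range n).map fun a => a :: l

theorem mem_allLists {n k : ℕ} {l : List ℕ} :
    l ∈ allLists n k ↔ l.length = k ∧ ∀ a ∈ l, a < n := by
  induction k generalizing l with
  | zero =>
    simp only [allLists, List.mem_singleton, List.length_eq_zero_iff]
    exact ⟨by rintro rfl; simp, fun h => h.1⟩
  | succ k ih =>
    simp only [allLists, List.mem_flatMap, List.mem_map, List.mem_range, ih]
    constructor
    · rintro ⟨l, ⟨rfl, h⟩, a, ha, rfl⟩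
      simpa using ⟨ha, h⟩
    · rintro ⟨h1, h2⟩
      cases l with
      | nil => simp at h1
      | cons a l => exact ⟨l, ⟨by simpa using h1, fun b hb => h2 b (by simp [hb])⟩, a,
          h2 a (by simp), rfl⟩

theorem primrec_allLists : Primrec fun n : ℕ => allLists n n := by
  have : Primrec₂ allLists := by
    refine (Primrec.nat_rec (f := fun _ : ℕ => [[]]) (g := fun (n : ℕ) (y : ℕ × List (List ℕ)) =>
      y.2.flatMap fun l => (List.range n).map fun a => a :: l) (.const _) ?_).of_eq fun n k => ?_
    · refine Primrec.list_flatMap (Primrec.snd.comp .snd) ?_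
      refine Primrec.list_map (Primrec.list_range.comp (Primrec.fst.comp .fst)) ?_
      exact Primrec.list_cons.comp .snd (Primrec.snd.comp .fst)
    · induction k with
      | zero => rfl
      | succ k ih => simp only [allLists, ih]
  exact this.comp .id .id

end Primrec

/-! ### Decidability of sets of configurations -/

/-- The entry of the adjacency matrix in a code. -/
def codeAdj (X : List (List Bool) × List (List Bool)) (i j : ℕ) : Bool :=
  (X.1.getD i []).getD j false

/-- The input of the `i`-th node in a code. -/
def codeInput (X : List (List Bool) × List (List Bool)) (i : ℕ) : List Bool :=
  X.2.getD i []

theorem Config.codeAdj_code (C : Config) (i j : Fin C.n) :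
    codeAdj C.code i j = true ↔ C.graph.Adj i j := by
  simp [codeAdj, code]

theorem Config.codeInput_code (C : Config) (i : Fin C.n) : codeInput C.code i = C.input i := by
  simp [codeInput, code]

theorem Config.length_code (C : Config) : C.code.1.length = C.n := by
  simp [code]

section

variable {α : Type*} [Primcodable α]

theorem Primrec.codeAdj_of {X : α → List (List Bool) × List (List Bool)} {i j : α → ℕ}
    (hX : Primrec X) (hi : Primrec i) (hj : Primrec j) :
    PrimrecPred fun a => codeAdj (X a) (i a) (j a) = true :=
  .eq_of ((Primrec.list_getD false).comp ((Primrec.list_getD []).comp (Primrec.fst.comp hX) hi) hj)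
    (.const true)

theorem Primrec.codeInput_of {X : α → List (List Bool) × List (List Bool)} {i : α → ℕ}
    (hX : Primrec X) (hi : Primrec i) : Primrec fun a => codeInput (X a) (i a) :=
  (Primrec.list_getD []).comp (Primrec.snd.comp hX) hi

theorem Primrec.length_code_of {X : α → List (List Bool) × List (List Bool)}
    (hX : Primrec X) : Primrec fun a => (X a).1.length :=
  Primrec.list_length.comp (Primrec.fst.comp hX)

end

theorem isDecidableLanguage_of_primrecPred {L : Set Config}
    {p : List (List Bool) × List (List Bool) → Prop} (hp : PrimrecPred p)
    (h : ∀ C : Config, p C.code ↔ C ∈ L) : IsDecidableLanguage L := by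
  obtain ⟨_, hp⟩ := hp
  exact ⟨fun X => decide (p X), hp.to_comp, fun C => by simpa using h C⟩

/-! ### Lists of binary strings as binary strings -/

/-- The binary string for a list of binary strings: every bit `b` becomes `1b`, and every string is
ended by `00`. -/
def encodeRows (l : List (List Bool)) : List Bool :=
  l.flatMap fun r => (r.flatMap fun b => [true, b]) ++ [false, false]

/-- One step of `decodeRows`. The first component of the state holds the second bit of a pair of which
the first bit has not been read yet. -/
def decodeRowsStep (b : Bool) (s : Option Bool × List (List Bool)) :
    Option Bool × List (List Bool) :=
  s.1.elim (some b, s.2) fun b' =>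
    (none, bif b then (b' :: s.2.headI) :: s.2.tail else [] :: s.2)

/-- The inverse of `encodeRows`; it reads the binary string from right to left. -/
def decodeRows (c : List Bool) : List (List Bool) :=
  (c.foldr decodeRowsStep (none, [])).2

theorem decodeRows_encodeRows (l : List (List Bool)) : decodeRows (encodeRows l) = l := by
  suffices (encodeRows l).foldr decodeRowsStep (none, []) = (none, l) by simp [decodeRows, this]
  induction l with
  | nil => rfl
  | cons r l ih =>
    have : encodeRows (r :: l) =
        (r.flatMap fun b => [true, b]) ++ ([false, false] ++ encodeRows l) := by
      simp [encodeRows]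
    rw [this, List.foldr_append, List.foldr_append, ih]
    have h0 : [false, false].foldr decodeRowsStep (none, l) = (none, [] :: l) := rfl
    rw [h0]
    induction r with
    | nil => rfl
    | cons b r ihr =>
      have := ihr (by simp [encodeRows])
      rw [List.flatMap_cons, List.foldr_append, this]
      rfl

theorem length_encodeRows (l : List (List Bool)) :
    (encodeRows l).length = (l.map fun r => 2 * r.length + 2).sum := by
  induction l with
  | nil => rfl
  | cons r l ih =>
    have hr : (r.flatMap fun b => [true, b]).length = 2 * r.length := by
      induction r with
      | nil => rfl
      | cons b r ih => simp [ih]; ring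
    have : encodeRows (r :: l) =
        (r.flatMap fun b => [true, b]) ++ ([false, false] ++ encodeRows l) := by
      simp [encodeRows]
    rw [this]
    simp only [List.length_append, hr, ih, List.map_cons, List.sum_cons, List.length_cons,
      List.length_nil]
    ring

theorem primrec_decodeRows : Primrec decodeRows := by
  refine Primrec.snd.comp (Primrec.list_foldr (f := fun c : List Bool => c)
    (h := fun _ (y : Bool × Option Bool × List (List Bool)) => decodeRowsStep y.1 y.2)
    .id (.const (none, [])) ?_)
  have : Primrec fun y : Bool × Option Bool × List (List Bool) => decodeRowsStep y.1 y.2 := by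
    refine (Primrec.option_casesOn (o := fun y : Bool × Option Bool × List (List Bool) => y.2.1)
      (f := fun y => (some y.1, y.2.2))
      (g := fun (y : Bool × Option Bool × List (List Bool)) (b' : Bool) =>
        ((none : Option Bool), bif y.1 then (b' :: y.2.2.headI) :: y.2.2.tail else [] :: y.2.2))
      (Primrec.fst.comp .snd)
      (.pair (Primrec.option_some.comp .fst) (Primrec.snd.comp .snd))
      (Primrec.pair (.const none) (.cond (Primrec.fst.comp .fst)
        (Primrec.list_cons.comp (Primrec.list_cons.comp .snd
            (Primrec.list_headI.comp (Primrec.snd.comp (Primrec.snd.comp .fst))))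
          (Primrec.list_tail.comp (Primrec.snd.comp (Primrec.snd.comp .fst))))
        (Primrec.list_cons.comp (.const []) (Primrec.snd.comp (Primrec.snd.comp .fst)))))).of_eq ?_
    rintro ⟨b, o, l⟩
    cases o <;> rfl
  exact this.comp .snd

/-! ### Certificates that describe the whole configuration -/

/-- The number of nodes described by a table. A table for a configuration with `n` nodes has `3 * n`
rows: the rows of the adjacency matrix, the inputs, and the distances from node `0` in unary. -/
def tableSize (T : List (List Bool)) : ℕ := T.length / 3

/-- The adjacency matrix described by a table. -/
def tableAdj (T : List (List Bool)) (i j : ℕ) : Bool := (T.getD i []).getD j false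

/-- The inputs described by a table. -/
def tableInput (T : List (List Bool)) (i : ℕ) : List Bool := T.getD (tableSize T + i) []

/-- The distances from node `0` described by a table. -/
def tableDepth (T : List (List Bool)) (i : ℕ) : ℕ := (T.getD (2 * tableSize T + i) []).length

/-- The code of the configuration described by a table. -/
def tableCode (T : List (List Bool)) : List (List Bool) × List (List Bool) :=
  ((List.range (tableSize T)).map fun i => (List.range (tableSize T)).map fun j => tableAdj T i j,
    (List.range (tableSize T)).map fun i => tableInput T i)

/-- The table describes a configuration. Its connectedness is witnessed by the distances, since every
node other than `0` has a neighbour of smaller distance. -/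
def TableValid (T : List (List Bool)) : Prop :=
  (∀ i < tableSize T, ¬ tableAdj T i i = true) ∧
  (∀ i < tableSize T, ∀ j < tableSize T, tableAdj T i j = true → tableAdj T j i = true) ∧
  ∀ i < tableSize T, i = 0 ∨ ∃ j < tableSize T, tableAdj T i j = true ∧ tableDepth T j < tableDepth T i

/-- The configuration described by a table. -/
def tableConfig (T : List (List Bool)) (hT : TableValid T) (h0 : 0 < tableSize T) : Config where
  n := tableSize T
  graph :=
    { Adj := fun i j => tableAdj T i j = true
      symm := ⟨fun i j => hT.2.1 i i.2 j j.2⟩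
      loopless := ⟨fun i => hT.1 i i.2⟩ }
  connected := by
    have key : ∀ k, ∀ i : Fin (tableSize T), tableDepth T i ≤ k → SimpleGraph.Reachable
        { Adj := fun i j : Fin (tableSize T) => tableAdj T i j = true
          symm := ⟨fun i j => hT.2.1 i i.2 j j.2⟩
          loopless := ⟨fun i => hT.1 i i.2⟩ } i ⟨0, h0⟩ := by
      intro k
      induction k with
      | zero =>
        intro i hi
        rcases hT.2.2 i i.2 with h | ⟨j, hj, hadj, hlt⟩
        · rw [show i = ⟨0, h0⟩ from Fin.ext h]
        · omega
      | succ k ih =>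
        intro i hi
        rcases hT.2.2 i i.2 with h | ⟨j, hj, hadj, hlt⟩
        · rw [show i = ⟨0, h0⟩ from Fin.ext h]
        · refine SimpleGraph.Reachable.trans (SimpleGraph.Adj.reachable ?_)
            (ih ⟨j, hj⟩ (by simp only; omega))
          exact hadj
    have : Nonempty (Fin (tableSize T)) := ⟨⟨0, h0⟩⟩
    exact ⟨fun i j => (key _ i le_rfl).trans (key _ j le_rfl).symm⟩
  input := fun i => tableInput T i

theorem code_tableConfig (T : List (List Bool)) (hT : TableValid T) (h0 : 0 < tableSize T) :
    (tableConfig T hT h0).code = tableCode T := by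
  simp only [Config.code, tableCode, tableConfig]
  congr 1
  · apply List.ext_getElem <;> simp
    intro i hi
    apply List.ext_getElem <;> simp
    intro j hj
    exact Bool.eq_iff_iff.2 (@decide_eq_true_iff _ (_))
  · apply List.ext_getElem <;> simp

/-- The table of a configuration. -/
noncomputable def Config.table (C : Config) : List (List Bool) :=
  C.code.1 ++ (C.code.2 ++ List.ofFn fun v => List.replicate (C.graph.dist ⟨0, C.n_pos⟩ v) true)

namespace Config

variable (C : Config)

theorem tableSize_table : tableSize C.table = C.n := by
  simp only [tableSize, table, List.length_append, code, List.length_ofFn]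
  omega

theorem tableAdj_table (i j : Fin C.n) : tableAdj C.table i j = true ↔ C.graph.Adj i j := by
  rw [← C.codeAdj_code, tableAdj, codeAdj, table,
    List.getD_append _ _ _ _ (by simp [code])]

theorem tableInput_table (i : Fin C.n) : tableInput C.table i = C.input i := by
  rw [← C.codeInput_code, tableInput, codeInput, tableSize_table, table,
    List.getD_append_right _ _ _ _ (by simp [code]), List.getD_append _ _ _ _ (by simp [code])]
  simp [code]

theorem tableDepth_table (i : Fin C.n) :
    tableDepth C.table i = C.graph.dist ⟨0, C.n_pos⟩ i := by
  rw [tableDepth, tableSize_table, table,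
    List.getD_append_right _ _ _ _ (by simp only [code, List.length_ofFn]; omega),
    List.getD_append_right _ _ _ _ (by simp only [code, List.length_ofFn]; omega)]
  have : 2 * C.n + (i : ℕ) - C.code.1.length - C.code.2.length = i := by
    simp only [code, List.length_ofFn]; omega
  rw [this]
  simp

theorem tableValid_table : TableValid C.table := by
  rw [TableValid, tableSize_table]
  refine ⟨fun i hi => ?_, fun i hi j hj => ?_, fun i hi => ?_⟩
  · rw [C.tableAdj_table ⟨i, hi⟩ ⟨i, hi⟩]
    exact C.graph.irrefl
  · rw [C.tableAdj_table ⟨i, hi⟩ ⟨j, hj⟩, C.tableAdj_table ⟨j, hj⟩ ⟨i, hi⟩]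
    exact fun h => h.symm
  · rcases eq_or_ne (⟨i, hi⟩ : Fin C.n) ⟨0, C.n_pos⟩ with h | h
    · exact Or.inl (congrArg Fin.val h)
    · obtain ⟨u, hu, hd⟩ := C.connected.exists_adj_dist_add_one h
      refine Or.inr ⟨u, u.2, (C.tableAdj_table ⟨i, hi⟩ u).2 hu, ?_⟩
      rw [C.tableDepth_table u, C.tableDepth_table ⟨i, hi⟩]
      omega

theorem tableCode_table : tableCode C.table = C.code := by
  rw [tableCode, C.tableSize_table]
  refine Prod.ext ?_ ?_
  · refine List.ext_getElem (by simp [code]) fun i h1 h2 => ?_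
    have hi : i < C.n := by simpa using h1
    refine List.ext_getElem (by simp [code]) fun j h3 h4 => ?_
    have hj : j < C.n := by simpa using h3
    have := C.tableAdj_table ⟨i, hi⟩ ⟨j, hj⟩
    simp only [List.getElem_map, List.getElem_range, code, List.getElem_ofFn]
    exact Bool.eq_iff_iff.2 (this.trans (@decide_eq_true_iff _ (_)).symm)
  · refine List.ext_getElem (by simp [code]) fun i h1 h2 => ?_
    have hi : i < C.n := by simpa using h1
    simpa [code] using C.tableInput_table ⟨i, hi⟩

end Config

/-- The certificate of a node: the number of the node in unary, followed by the table. -/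
noncomputable def Config.universalCert (C : Config) (v : Fin C.n) : List Bool :=
  encodeRows (List.replicate v true :: C.table)

theorem Config.certSize_universalCert_le (C : Config) :
    certSize C.universalCert ≤ 4 * C.n ^ 2 + 8 * C.n + 2 * C.inputLength + 2 := by
  refine Finset.sup_le fun v _ => ?_
  have hsum : ∀ (f : Fin C.n → List Bool) (b : ℕ), (∀ i, (f i).length ≤ b) →
      ((List.ofFn f).map fun r => 2 * r.length + 2).sum ≤ C.n * (2 * b + 2) := by
    intro f b hb
    rw [List.map_ofFn, List.sum_ofFn]
    refine (Finset.sum_le_card_nsmul _ _ (2 * b + 2) fun i _ => ?_).trans (by simp)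
    have := hb i
    simp only [Function.comp_apply]
    omega
  have h1 := hsum (fun i => List.ofFn fun j => @decide (C.graph.Adj i j) (Classical.propDecidable _))
    C.n (by simp)
  have h2 : ((List.ofFn C.input).map fun r => 2 * r.length + 2).sum = 2 * C.inputLength + 2 * C.n := by
    rw [List.map_ofFn, List.sum_ofFn, inputLength]
    simp only [Function.comp_apply, Finset.sum_add_distrib, Finset.mul_sum]
    simp [mul_comm]
  have h3 := hsum (fun v => List.replicate (C.graph.dist ⟨0, C.n_pos⟩ v) true) C.n fun i => by
    rw [List.length_replicate]
    obtain ⟨p, hp, hd⟩ := C.connected.exists_path_of_dist ⟨0, C.n_pos⟩ i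
    have := hp.length_lt
    simp only [Fintype.card_fin] at this
    omega
  have hv := v.2
  rw [universalCert, length_encodeRows, List.map_cons, List.sum_cons, table, List.map_append,
    List.sum_append, List.map_append, List.sum_append]
  simp only [code, List.length_replicate]
  rw [h2]
  nlinarith

/-- The number of the node that is described by a certificate. -/
def certIndex (c : List Bool) : ℕ := (decodeRows c).headI.length

/-- The table that is contained in a certificate. -/
def certTable (c : List Bool) : List (List Bool) := (decodeRows c).tail

theorem Config.certIndex_universalCert (C : Config) (v : Fin C.n) :
    certIndex (C.universalCert v) = v := by
  simp [certIndex, universalCert, decodeRows_encodeRows]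

theorem Config.certTable_universalCert (C : Config) (v : Fin C.n) :
    certTable (C.universalCert v) = C.table := by
  simp [certTable, universalCert, decodeRows_encodeRows]

/-- The part of the check of the universal verifier that does not depend on the language: the table
is valid, it is the same at all neighbours, the numbers of the neighbours are those that the table
prescribes, the input is as in the table, the identifier is in the range that is admissible for the
table, and nodes of the ball with different identifiers have different numbers. -/
def UniversalCheck (q : Polynomial ℕ) (y : (ℕ × List Bool × List Bool) ×
    List (ℕ × List Bool × List Bool) × List (ℕ × List Bool × List Bool)) : Prop :=
  TableValid (certTable y.1.2.2) ∧
  certIndex y.1.2.2 < tableSize (certTable y.1.2.2) ∧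
  y.1.1 ≤ q.eval (tableSize (certTable y.1.2.2)) ∧
  y.1.2.1 = tableInput (certTable y.1.2.2) (certIndex y.1.2.2) ∧
  (∀ z ∈ y.2.1, certTable z.2.2 = certTable y.1.2.2 ∧
    tableAdj (certTable y.1.2.2) (certIndex y.1.2.2) (certIndex z.2.2) = true) ∧
  (∀ j < tableSize (certTable y.1.2.2),
    tableAdj (certTable y.1.2.2) (certIndex y.1.2.2) j = true →
      ∃ z ∈ y.2.1, certIndex z.2.2 = j) ∧
  ∀ z ∈ y.2.2, ∀ z' ∈ y.2.2, certIndex z.2.2 = certIndex z'.2.2 → z.1 = z'.1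

section

variable {α : Type*} [Primcodable α]

theorem primrec_tableSize : Primrec tableSize :=
  Primrec.nat_div.comp .list_length (.const 3)

theorem Primrec.tableAdj_of {T : α → List (List Bool)} {i j : α → ℕ} (hT : Primrec T)
    (hi : Primrec i) (hj : Primrec j) : Primrec fun a => tableAdj (T a) (i a) (j a) :=
  (Primrec.list_getD false).comp ((Primrec.list_getD []).comp hT hi) hj

theorem Primrec.tableInput_of {T : α → List (List Bool)} {i : α → ℕ} (hT : Primrec T)
    (hi : Primrec i) : Primrec fun a => tableInput (T a) (i a) :=
  (Primrec.list_getD []).comp hT (Primrec.nat_add.comp (primrec_tableSize.comp hT) hi)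

theorem Primrec.tableDepth_of {T : α → List (List Bool)} {i : α → ℕ} (hT : Primrec T)
    (hi : Primrec i) : Primrec fun a => tableDepth (T a) (i a) :=
  Primrec.list_length.comp ((Primrec.list_getD []).comp hT
    (Primrec.nat_add.comp (Primrec.nat_mul.comp (.const 2) (primrec_tableSize.comp hT)) hi))

theorem primrec_tableCode : Primrec tableCode := by
  have hr : Primrec fun T => List.range (tableSize T) := Primrec.list_range.comp primrec_tableSize
  refine .pair (Primrec.list_map hr ?_) (Primrec.list_map hr (Primrec.tableInput_of .fst .snd))
  exact Primrec.list_map (hr.comp .fst)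
    (Primrec.tableAdj_of (Primrec.fst.comp .fst) (Primrec.snd.comp .fst) .snd)

theorem primrecPred_tableValid : PrimrecPred TableValid := by
  have hn := primrec_tableSize
  refine .and (.forall_lt_of hn (.not (.eq_of (Primrec.tableAdj_of .fst .snd .snd) (.const true))))
    (.and (.forall_lt_of hn (.forall_lt_of (hn.comp .fst) (.imp
      (.eq_of (Primrec.tableAdj_of (Primrec.fst.comp .fst) (Primrec.snd.comp .fst) .snd) (.const true))
      (.eq_of (Primrec.tableAdj_of (Primrec.fst.comp .fst) .snd (Primrec.snd.comp .fst))
        (.const true)))))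
    (.forall_lt_of hn (.or (.eq_of .snd (.const 0)) (.exists_lt_of (hn.comp .fst) (.and
      (.eq_of (Primrec.tableAdj_of (Primrec.fst.comp .fst) (Primrec.snd.comp .fst) .snd) (.const true))
      (.lt_of (Primrec.tableDepth_of (Primrec.fst.comp .fst) .snd)
        (Primrec.tableDepth_of (Primrec.fst.comp .fst) (Primrec.snd.comp .fst))))))))

theorem primrec_certIndex : Primrec certIndex :=
  Primrec.list_length.comp (Primrec.list_headI.comp primrec_decodeRows)

theorem primrec_certTable : Primrec certTable := Primrec.list_tail.comp primrec_decodeRows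

theorem primrecPred_universalCheck (q : Polynomial ℕ) : PrimrecPred (UniversalCheck q) := by
  have hc : Primrec fun z : ℕ × List Bool × List Bool => z.2.2 := Primrec.snd.comp .snd
  have hiz := primrec_certIndex.comp hc
  have htz := primrec_certTable.comp hc
  have hT := htz.comp (Primrec.fst (α := ℕ × List Bool × List Bool)
    (β := List (ℕ × List Bool × List Bool) × List (ℕ × List Bool × List Bool)))
  have hi := hiz.comp (Primrec.fst (α := ℕ × List Bool × List Bool)
    (β := List (ℕ × List Bool × List Bool) × List (ℕ × List Bool × List Bool)))
  have hn := primrec_tableSize.comp hT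
  have hnb := (Primrec.fst.comp (Primrec.snd (α := ℕ × List Bool × List Bool)
    (β := List (ℕ × List Bool × List Bool) × List (ℕ × List Bool × List Bool))))
  have hball := (Primrec.snd.comp (Primrec.snd (α := ℕ × List Bool × List Bool)
    (β := List (ℕ × List Bool × List Bool) × List (ℕ × List Bool × List Bool))))
  refine .and (primrecPred_tableValid.comp hT) (.and (.lt_of hi hn) (.and
    (.le_of (Primrec.fst.comp .fst) ((Primrec.polynomial_eval q).comp hn)) (.and
    (.eq_of (Primrec.fst.comp (Primrec.snd.comp .fst)) (Primrec.tableInput_of hT hi)) (.and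
    (.forall_mem_of hnb ?_) (.and (.forall_lt_of hn (.imp ?_ ?_)) ?_)))))
  · exact .and (.eq_of (htz.comp .snd) (hT.comp .fst))
      (.eq_of (Primrec.tableAdj_of (hT.comp .fst) (hi.comp .fst) (hiz.comp .snd)) (.const true))
  · exact .eq_of (Primrec.tableAdj_of (hT.comp .fst) (hi.comp .fst) .snd) (.const true)
  · exact .exists_mem_of (hnb.comp .fst) (.eq_of (hiz.comp .snd) (Primrec.snd.comp .fst))
  · exact .forall_mem_of hball (.forall_mem_of (hball.comp .fst) (.imp
      (.eq_of (hiz.comp (Primrec.snd.comp .fst)) (hiz.comp .snd))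
      (.eq_of (Primrec.fst.comp (Primrec.snd.comp .fst)) (Primrec.fst.comp .snd))))

end

/-! ### Languages that are closed under covering maps -/

/-- A covering map `φ : C' → C` that is injective on all balls of radius `t`, where in addition the
identifiers of `C'` are in the range that is admissible for the (possibly smaller) configuration `C`. -/
structure IsLocalCover (q : Polynomial ℕ) (t : ℕ) (C C' : Config) (ident : Fin C'.n → ℕ)
    (φ : Fin C'.n → Fin C.n) : Prop where
  bijOn : ∀ v, Set.BijOn φ (C'.graph.neighborSet v) (C.graph.neighborSet (φ v))
  input_eq : ∀ v, C'.input v = C.input (φ v)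
  ident_le : ∀ v, ident v ≤ q.eval C.n
  eq_of_dist_le : ∀ v u u', C'.graph.dist v u ≤ t → C'.graph.dist v u' ≤ t → φ u = φ u' → u = u'

/-- A decidable language that is closed under covering maps in the above sense has a verifier with the
certificates `Config.universalCert`. -/
theorem exists_universalVerifier (q : Polynomial ℕ) (t : ℕ) {L : Set Config}
    (hL : IsDecidableLanguage L)
    (hcl : ∀ C ∈ L, ∀ (C' : Config) (ident : Fin C'.n → ℕ) (φ : Fin C'.n → Fin C.n),
      C'.IsIdAssignment q ident → IsLocalCover q t C C' ident φ → C' ∈ L) :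
    ∃ A : LocalVerifier, Verifies q A L ∧
      ∀ C ∈ L, LocalVerifier.AcceptsCert q A C C.universalCert := by
  obtain ⟨p, hp, hpL⟩ := hL
  obtain ⟨_, hcheck⟩ := primrecPred_universalCheck q
  let P : (ℕ × List Bool × List Bool) × List (ℕ × List Bool × List Bool) ×
      List (ℕ × List Bool × List Bool) → Bool := fun y =>
    decide (UniversalCheck q y) && p (tableCode (certTable y.1.2.2))
  have hP : Computable P := by
    have h1 : Primrec fun y : (ℕ × List Bool × List Bool) × List (ℕ × List Bool × List Bool) ×
        List (ℕ × List Bool × List Bool) => tableCode (certTable y.1.2.2) :=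
      primrec_tableCode.comp (primrec_certTable.comp (Primrec.snd.comp (Primrec.snd.comp .fst)))
    exact Primrec.and.to_comp.comp hcheck.to_comp (hp.comp h1.to_comp)
  have hPiff : ∀ y, P y = true ↔
      UniversalCheck q y ∧ p (tableCode (certTable y.1.2.2)) = true := fun y => by simp [P]
  have hacc : ∀ C ∈ L, LocalVerifier.AcceptsCert q (LocalAlgorithm.gather t P hP) C
      C.universalCert := by
    intro C hC ident hident
    obtain ⟨m, hm, hball⟩ := LocalAlgorithm.allAccept_gather t P hP C ident
      fun v => (C.input v, C.universalCert v)
    rw [hm]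
    intro v
    simp only [hPiff, UniversalCheck, C.certIndex_universalCert,
      C.certTable_universalCert, C.tableSize_table, C.tableCode_table, hpL]
    refine ⟨⟨C.tableValid_table, v.2, (hident.2 v).2, (C.tableInput_table v).symm, ?_, ?_, ?_⟩, hC⟩
    · intro z hz
      obtain ⟨u, hu, rfl⟩ := List.mem_map.1 hz
      simp only [C.certIndex_universalCert, C.certTable_universalCert, true_and]
      exact (C.tableAdj_table v u).2 (Config.mem_neighbors.1 hu)
    · intro j hj hadj
      refine ⟨_, List.mem_map.2 ⟨⟨j, hj⟩, Config.mem_neighbors.2 ((C.tableAdj_table v ⟨j, hj⟩).1 hadj),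
        rfl⟩, ?_⟩
      simp only [C.certIndex_universalCert]
    · intro z hz z' hz' h
      obtain ⟨u, rfl⟩ := (hball v).2 z hz
      obtain ⟨u', rfl⟩ := (hball v).2 z' hz'
      simp only [C.certIndex_universalCert] at h
      rw [Fin.ext h]
  refine ⟨LocalAlgorithm.gather t P hP, ⟨fun C hC => ⟨_, hacc C hC⟩, ?_⟩, hacc⟩
  intro C' hC' c ident hident hall
  obtain ⟨m, hm, hball⟩ := LocalAlgorithm.allAccept_gather t P hP C' ident
    fun v => (C'.input v, c v)
  rw [hm] at hall
  simp only [hPiff, UniversalCheck] at hall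
  let v₀ : Fin C'.n := ⟨0, C'.n_pos⟩
  -- All nodes have the same table.
  have hT : ∀ v, certTable (c v) = certTable (c v₀) := by
    refine C'.connected.forall_of_adj rfl fun u v huv hu => ?_
    rw [← hu]
    exact ((hall u).1.2.2.2.2.1 _ (List.mem_map.2 ⟨v, Config.mem_neighbors.2 huv, rfl⟩)).1
  generalize certTable (c v₀) = T at hT
  simp only [hT] at hall
  have hn : 0 < tableSize T := lt_of_le_of_lt (Nat.zero_le _) (hall v₀).1.2.1
  let C : Config := tableConfig T (hall v₀).1.1 hn
  have hC : C ∈ L := by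
    rw [← hpL, code_tableConfig]
    exact (hall v₀).2
  let φ : Fin C'.n → Fin C.n := fun v => ⟨certIndex (c v), (hall v).1.2.1⟩
  have hinj : ∀ v u u', C'.graph.dist v u ≤ t + 1 → C'.graph.dist v u' ≤ t + 1 → φ u = φ u' →
      u = u' := by
    intro v u u' hu hu' h
    exact hident.1 ((hall v).1.2.2.2.2.2.2 _ ((hball v).1 u hu) _ ((hball v).1 u' hu')
      (congrArg Fin.val h))
  refine hC' (hcl C hC C' ident φ hident ⟨fun v => ⟨?_, ?_, ?_⟩, fun v => (hall v).1.2.2.2.1,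
    fun v => (hall v).1.2.2.1, fun v u u' hu hu' => hinj v u u' (by omega) (by omega)⟩)
  · intro u hu
    exact ((hall v).1.2.2.2.2.1 _ (List.mem_map.2 ⟨u, Config.mem_neighbors.2 hu, rfl⟩)).2
  · intro u hu u' hu' h
    refine hinj v u u' ?_ ?_ h
    · rw [SimpleGraph.dist_eq_one_iff_adj.2 hu]; omega
    · rw [SimpleGraph.dist_eq_one_iff_adj.2 hu']; omega
  · intro j hj
    obtain ⟨z, hz, hzj⟩ := (hall v).1.2.2.2.2.2.1 j j.2 hj
    obtain ⟨u, hu, rfl⟩ := List.mem_map.1 hz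
    exact ⟨u, Config.mem_neighbors.1 hu, Fin.ext hzj⟩

/-- A language with a verifier is closed under covering maps that are injective on the balls that the
verifier sees, provided that the identifiers fit: a view in the cover is also a view in the base. -/
theorem Verifies.mem_of_isLocalCover {q : Polynomial ℕ} (hq : ∀ n : ℕ, n ≤ q.eval n)
    {A : LocalVerifier} {L : Set Config} (hA : Verifies q A L) {C C' : Config} (hC : C ∈ L)
    {ident : Fin C'.n → ℕ} {φ : Fin C'.n → Fin C.n} (hident : C'.IsIdAssignment q ident)
    (hφ : IsLocalCover q A.rounds C C' ident φ) : C' ∈ L := by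
  classical
  by_contra hC'
  obtain ⟨c, hc⟩ := hA.1 C hC
  refine hA.2 C' hC' (c ∘ φ) ident hident fun v => ?_
  let ball : Finset (Fin C'.n) := Finset.univ.filter fun u => C'.graph.dist v u ≤ A.rounds
  have hball : ∀ u, u ∈ ball ↔ C'.graph.dist v u ≤ A.rounds := by simp [ball]
  have hinj : Set.InjOn φ ball := fun u hu u' hu' h =>
    hφ.eq_of_dist_le v u u' ((hball u).1 hu) ((hball u').1 hu') h
  have : Nonempty (Fin C'.n) := ⟨v⟩
  have hinv : ∀ u ∈ ball, Function.invFunOn φ ball (φ u) = u := fun u hu =>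
    hinj.leftInvOn_invFunOn hu
  obtain ⟨ident', hident', heq⟩ := C.exists_isIdAssignment hq (ball.image φ)
    (fun w => ident (Function.invFunOn φ ball w))
    (by
      intro a ha b hb hab
      obtain ⟨u, hu, rfl⟩ := Finset.mem_image.1 (Finset.mem_coe.1 ha)
      obtain ⟨u', hu', rfl⟩ := Finset.mem_image.1 (Finset.mem_coe.1 hb)
      simp only [hinv u hu, hinv u' hu'] at hab
      rw [hident.1 hab])
    (by
      intro w hw
      obtain ⟨u, hu, rfl⟩ := Finset.mem_image.1 hw
      rw [hinv u hu]
      exact ⟨(hident.2 u).1, hφ.ident_le u⟩)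
  rw [A.stateAfter_eq_of_ball hident'.1 (x' := fun v => (C.input v, c v)) φ A.rounds v ?_
    fun u _ => hφ.bijOn u]
  · exact hc ident' hident' (φ v)
  · intro u hu
    have hu := (hball u).2 hu
    refine ⟨?_, by rw [hφ.input_eq]; rfl⟩
    rw [heq _ (Finset.mem_image_of_mem φ hu), hinv u hu]

theorem NLDOf_subset_NLD (q : Polynomial ℕ) (F : Set (ℕ × ℕ → ℕ)) : NLDOf q F ⊆ NLD q :=
  fun _ ⟨hL, A, hA, _⟩ => ⟨hL, A, hA⟩

theorem NLDOf_mono (q : Polynomial ℕ) {F F' : Set (ℕ × ℕ → ℕ)} (h : F ⊆ F') :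
    NLDOf q F ⊆ NLDOf q F' :=
  fun _ ⟨hL, A, hA, f, hf, hfA⟩ => ⟨hL, A, hA, f, h hf, hfA⟩

theorem bigO_mono {g g' : ℕ × ℕ → ℝ} (h : g =O[atTop] g') : bigO g ⊆ bigO g' :=
  fun _ hf => ⟨hf.1, hf.2.trans h⟩

theorem eventually_le_fst (k : ℕ) : ∀ᶠ x : ℕ × ℕ in atTop, k ≤ x.1 :=
  (eventually_ge_atTop (k, 0)).mono fun _ h => h.1

/-- The universal verifier, applied to a language with a verifier. -/
theorem NLD_subset (q : Polynomial ℕ) (hq : ∀ n : ℕ, n ≤ q.eval n) :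
    NLD q ⊆ NLDOf q (bigO fun x => (x.1 : ℝ) ^ 2 + x.2) := by
  rintro L ⟨hL, A, hA⟩
  obtain ⟨B, hB, hacc⟩ := exists_universalVerifier q A.rounds hL
    fun C hC C' ident φ hident hφ => hA.mem_of_isLocalCover hq hC hident hφ
  refine ⟨hL, B, hB, fun x => 4 * x.1 ^ 2 + 8 * x.1 + 2 * x.2 + 2, ⟨?_, ?_⟩,
    fun C hC => ⟨_, C.certSize_universalCert_le, hacc C hC⟩⟩
  · intro x y hxy
    have h1 : x.1 ≤ y.1 := hxy.1
    have h2 : x.2 ≤ y.2 := hxy.2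
    dsimp only
    gcongr
  · refine IsBigO.of_bound 14 ?_
    filter_upwards [eventually_le_fst 1] with x hx
    have hx : (1 : ℝ) ≤ x.1 := by exact_mod_cast hx
    have h2 : (0 : ℝ) ≤ x.2 := Nat.cast_nonneg _
    rw [Real.norm_of_nonneg (by positivity), Real.norm_of_nonneg (by positivity)]
    push_cast
    nlinarith

/-! ### Partitions into classes of equal size -/

/-- The fibres of a covering map of a connected graph have the same size. -/
theorem ncard_fiber_eq {C C' : Config} {φ : Fin C'.n → Fin C.n}
    (hφ : ∀ v, Set.BijOn φ (C'.graph.neighborSet v) (C.graph.neighborSet (φ v))) (i j : Fin C.n) :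
    {v | φ v = i}.ncard = {v | φ v = j}.ncard := by
  -- Moving along an edge is an injection between fibres.
  have key : ∀ i j, C.graph.Adj i j → {v | φ v = i}.ncard ≤ {v | φ v = j}.ncard := by
    intro i j hij
    have : ∀ v, ∃ u, φ v = i → C'.graph.Adj v u ∧ φ u = j := by
      intro v
      by_cases hv : φ v = i
      · subst hv
        obtain ⟨u, hu, h⟩ := (hφ v).surjOn hij
        exact ⟨u, fun _ => ⟨hu, h⟩⟩
      · exact ⟨v, fun h => absurd h hv⟩
    choose g hg using this
    refine Set.ncard_le_ncard_of_injOn g (fun v hv => (hg v hv).2) ?_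
    intro v hv v' hv' h
    refine (hφ (g v)).injOn (hg v hv).1.symm (h ▸ (hg v' hv').1.symm) ?_
    exact Eq.trans hv (Eq.symm hv')
  refine C.connected.forall_of_adj (P := fun j => {v | φ v = i}.ncard = {v | φ v = j}.ncard)
    rfl (fun u v huv hu => ?_) j
  exact hu.trans (le_antisymm (key u v huv) (key v u huv.symm))

/-- Along a covering map, the number of nodes in the preimage of a set of nodes is proportional to the
size of the set. -/
theorem ncard_preimage_eq {C C' : Config} {φ : Fin C'.n → Fin C.n}
    (hφ : ∀ v, Set.BijOn φ (C'.graph.neighborSet v) (C.graph.neighborSet (φ v))) (i : Fin C.n)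
    (S : Set (Fin C.n)) : (φ ⁻¹' S).ncard = S.ncard * {v | φ v = i}.ncard := by
  classical
  rw [Set.ncard_eq_toFinset_card' (φ ⁻¹' S), Set.ncard_eq_toFinset_card' S]
  refine (Finset.card_eq_sum_card_fiberwise (f := φ) (t := S.toFinset) ?_).trans ?_
  · intro v hv
    simpa using hv
  · refine Finset.sum_const_nat fun j hj => ?_
    rw [ncard_fiber_eq hφ i j, Set.ncard_eq_toFinset_card']
    congr 1
    ext v
    simp only [Finset.mem_filter, Set.mem_toFinset, Set.mem_preimage, Set.mem_ofPred_eq]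
    constructor
    · exact fun h => h.2
    · rintro rfl
      exact ⟨by simpa using hj, rfl⟩

theorem isDecidableLanguage_eqSizePartition : IsDecidableLanguage EqSizePartition := by
  have hcount : ∀ b : Bool, Primrec fun X : List (List Bool) × List (List Bool) =>
      X.2.count [b] := fun b => Primrec.list_count_of .snd (.const _)
  refine isDecidableLanguage_of_primrecPred (.and
    (.forall_mem_of (p := fun _ r => r = [false] ∨ r = [true]) .snd (.or
    (.eq_of .snd (.const [false])) (.eq_of .snd (.const [true]))))
    (.eq_of (hcount false) (hcount true))) fun C => ?_
  have h : ∀ b : Bool, C.code.2.count [b] = {v | C.input v = [b]}.ncard := by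
    intro b
    rw [Set.ncard_eq_toFinset_card']
    simp only [Config.code, List.count_eq_countP, List.countP_eq_length_filter]
    rw [List.ofFn_eq_map, List.filter_map, List.length_map,
      ← List.toFinset_card_of_nodup ((List.nodup_finRange _).filter _)]
    congr 1
    ext v
    simp
  rw [h, h]
  simp [Config.code, EqSizePartition]

/-- The universal verifier, applied to a language that is closed under all covering maps. -/
theorem eqSizePartition_mem (q : Polynomial ℕ) :
    EqSizePartition ∈ NLDOf q (bigO fun x => (x.1 : ℝ) ^ 2) := by
  obtain ⟨A, hA, hacc⟩ := exists_universalVerifier q 0 isDecidableLanguage_eqSizePartition (by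
    intro C hC C' ident φ _ hφ
    refine ⟨fun v => by rw [hφ.input_eq]; exact hC.1 _, ?_⟩
    have h : ∀ b : Bool, {v | C'.input v = [b]} = φ ⁻¹' {v | C.input v = [b]} := by
      intro b
      ext v
      simp [hφ.input_eq]
    have i : Fin C.n := ⟨0, C.n_pos⟩
    rw [h, h, ncard_preimage_eq hφ.bijOn i, ncard_preimage_eq hφ.bijOn i, hC.2])
  refine ⟨isDecidableLanguage_eqSizePartition, A, hA,
    fun x => 4 * x.1 ^ 2 + 10 * x.1 + 2, ⟨?_, ?_⟩, fun C hC => ⟨_, ?_, hacc C hC⟩⟩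
  · intro x y hxy
    have h1 : x.1 ≤ y.1 := hxy.1
    dsimp only
    gcongr
  · refine IsBigO.of_bound 16 ?_
    filter_upwards [eventually_le_fst 1] with x hx
    have hx : (1 : ℝ) ≤ x.1 := by exact_mod_cast hx
    rw [Real.norm_of_nonneg (by positivity), Real.norm_of_nonneg (by positivity)]
    push_cast
    nlinarith
  · have h : C.inputLength = C.n := by
      have : ∀ v, (C.input v).length = 1 := fun v => by rcases hC.1 v with h | h <;> simp [h]
      simp [Config.inputLength, this]
    have := C.certSize_universalCert_le
    dsimp only
    omega

/-! ### Tools for lower bounds -/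

/-- If a labelled graph looks like a first accepted one on one side and like a second accepted one on
the other side, and if the two sides overlap sufficiently, then it is accepted as well. The sides are
given by a position of the nodes, which changes by at most one along every edge. -/
theorem LocalAlgorithm.allAccept_of_hybrid {α : Type} [Primcodable α] (A : LocalAlgorithm α) {n : ℕ}
    {G G₁ G₂ : SimpleGraph (Fin n)} {hG : G.Connected} {hG₁ : G₁.Connected} {hG₂ : G₂.Connected}
    {w w₁ w₂ : Fin n → List Bool} {ident : Fin n → ℕ} (hident : Function.Injective ident)
    {x x₁ x₂ : Fin n → α} (pos : Fin n → ℕ) (hpos : ∀ u v, G.Adj u v → pos v ≤ pos u + 1) (a : ℕ)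
    (h₁ : ∀ u, pos u ≤ a + 2 * A.rounds → x u = x₁ u ∧ ∀ v, G.Adj u v ↔ G₁.Adj u v)
    (h₂ : ∀ u, a ≤ pos u → x u = x₂ u ∧ ∀ v, G.Adj u v ↔ G₂.Adj u v)
    (hA₁ : A.AllAccept ⟨n, G₁, hG₁, w₁⟩ ident x₁) (hA₂ : A.AllAccept ⟨n, G₂, hG₂, w₂⟩ ident x₂) :
    A.AllAccept ⟨n, G, hG, w⟩ ident x := by
  intro v
  have hdist : ∀ u, G.dist v u ≤ A.rounds → pos u ≤ pos v + A.rounds ∧ pos v ≤ pos u + A.rounds := by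
    intro u hu
    have h1 := hG.le_add_dist pos hpos v u
    have h2 := hG.le_add_dist pos hpos u v
    rw [SimpleGraph.dist_comm] at h2
    omega
  have hbij : ∀ (G' : SimpleGraph (Fin n)) (u : Fin n), (∀ v, G.Adj u v ↔ G'.Adj u v) →
      Set.BijOn id (G.neighborSet u) (G'.neighborSet (id u)) := by
    intro G' u h
    rw [show G'.neighborSet (id u) = G.neighborSet u from Set.ext fun v => (h v).symm]
    exact Set.bijOn_id _
  rcases le_total (pos v) (a + A.rounds) with hv | hv
  · rw [A.stateAfter_eq_of_ball (ident := ident) (ident' := ident) (C := ⟨n, G, hG, w⟩)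
      (C' := ⟨n, G₁, hG₁, w₁⟩) hident (x' := x₁) id A.rounds v
      (fun u hu => ⟨rfl, (h₁ u (by have := hdist u hu; omega)).1⟩)
      (fun u hu => hbij G₁ u (h₁ u (by have := hdist u hu.le; omega)).2)]
    exact hA₁ v
  · rw [A.stateAfter_eq_of_ball (ident := ident) (ident' := ident) (C := ⟨n, G, hG, w⟩)
      (C' := ⟨n, G₂, hG₂, w₂⟩) hident (x' := x₂) id A.rounds v
      (fun u hu => ⟨rfl, (h₂ u (by have := hdist u hu; omega)).1⟩)
      (fun u hu => hbij G₂ u (h₂ u (by have := hdist u hu.le; omega)).2)]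
    exact hA₂ v

/-- Binary strings as natural numbers, with a leading digit `1`. -/
def bitsToNat (l : List Bool) : ℕ := l.foldr (fun b k => 2 * k + b.toNat) 1

theorem bitsToNat_pos (l : List Bool) : 0 < bitsToNat l := by
  induction l with
  | nil => simp [bitsToNat]
  | cons b l ih => simp only [bitsToNat, List.foldr_cons] at ih ⊢; omega

theorem bitsToNat_injective : Function.Injective bitsToNat := by
  intro l
  induction l with
  | nil =>
    intro l' h
    cases l' with
    | nil => rfl
    | cons b l' =>
      have := bitsToNat_pos l'
      simp only [bitsToNat, List.foldr_cons, List.foldr_nil] at h this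
      omega
  | cons b l ih =>
    intro l' h
    cases l' with
    | nil =>
      have := bitsToNat_pos l
      simp only [bitsToNat, List.foldr_cons, List.foldr_nil] at h this
      omega
    | cons b' l' =>
      have h' : 2 * bitsToNat l + b.toNat = 2 * bitsToNat l' + b'.toNat := h
      have h1 := b.toNat_le
      have h2 := b'.toNat_le
      rw [ih (show bitsToNat l = bitsToNat l' by omega)]
      have : b.toNat = b'.toNat := by omega
      cases b <;> cases b' <;> simp_all

theorem bitsToNat_lt (l : List Bool) : bitsToNat l < 2 ^ (l.length + 1) := by
  induction l with
  | nil => simp [bitsToNat]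
  | cons b l ih =>
    have := b.toNat_le
    simp only [bitsToNat, List.foldr_cons, List.length_cons] at ih ⊢
    rw [pow_succ]
    omega

/-- The pigeonhole principle for certificates: more than `2 ^ ((s + 1) * k)` instances cannot have
different certificates of size `s` at `k` nodes. -/
theorem exists_ne_forall_eq_of_length_le {ι κ : Type*} [Fintype ι] [Fintype κ] (s : ℕ)
    (F : ι → κ → List Bool) (hF : ∀ i k, (F i k).length ≤ s)
    (hcard : 2 ^ ((s + 1) * Fintype.card κ) < Fintype.card ι) :
    ∃ i j, i ≠ j ∧ ∀ k, F i k = F j k := by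
  classical
  let F' : ι → κ → Fin (2 ^ (s + 1)) := fun i k =>
    ⟨bitsToNat (F i k), (bitsToNat_lt _).trans_le
      (Nat.pow_le_pow_right (by norm_num) (by have := hF i k; omega))⟩
  obtain ⟨i, j, hij, h⟩ := Fintype.exists_ne_map_eq_of_card_lt F' (by
    simpa [← pow_mul] using hcard)
  exact ⟨i, j, hij, fun k => bitsToNat_injective (congrArg Fin.val (congrFun h k))⟩

theorem length_le_of_certSize_le {n s : ℕ} {c : Fin n → List Bool} (h : certSize c ≤ s) (v : Fin n) :
    (c v).length ≤ s :=
  (Finset.le_sup (f := fun v => (c v).length) (Finset.mem_univ v)).trans h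

/-! ### Agreement of inputs -/

/-- All nonempty inputs are equal, and their length is bounded in terms of the degrees. -/
def AgreementLanguage (h : ℕ → ℕ) : Set Config :=
  {C | ∃ x : List Bool, ∀ v, C.input v = [] ∨
    C.input v = x ∧ x.length ≤ h (C.graph.neighborSet v).ncard}

theorem Config.ncard_neighborSet (C : Config) (ident : Fin C.n → ℕ) (v : Fin C.n) :
    (C.graph.neighborSet v).ncard = (C.neighbors ident v).length := by
  rw [← List.toFinset_card_of_nodup (C.nodup_neighbors ident v), ← Set.ncard_coe_finset]
  congr 1
  ext u
  simp [mem_neighbors]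

theorem Config.ncard_neighborSet_le (C : Config) (v : Fin C.n) :
    (C.graph.neighborSet v).ncard ≤ C.n := by
  simpa using Set.ncard_le_card (C.graph.neighborSet v)

theorem Config.length_filter_codeAdj (C : Config) (v : Fin C.n) :
    ((List.range C.n).filter fun j => codeAdj C.code v j).length =
      (C.graph.neighborSet v).ncard := by
  rw [← List.toFinset_card_of_nodup (List.nodup_range.filter _), ← Set.ncard_coe_finset]
  symm
  refine Set.ncard_congr (fun u _ => (u : ℕ)) (fun u hu => ?_) (fun u u' _ _ h => Fin.ext h)
    fun j hj => ?_
  · simpa [C.codeAdj_code] using hu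
  · simp only [List.coe_toFinset, List.mem_filter, List.mem_range, Set.mem_ofPred_eq] at hj
    exact ⟨⟨j, hj.1⟩, (C.codeAdj_code v ⟨j, hj.1⟩).1 hj.2, rfl⟩

theorem isDecidableLanguage_agreement {h : ℕ → ℕ} (hh : Primrec h) :
    IsDecidableLanguage (AgreementLanguage h) := by
  have hn : Primrec fun X : List (List Bool) × List (List Bool) => X.1.length :=
    Primrec.length_code_of .id
  have hi : Primrec fun y : (List (List Bool) × List (List Bool)) × ℕ => codeInput y.1 y.2 :=
    Primrec.codeInput_of .fst .snd
  have hdeg : Primrec fun y : (List (List Bool) × List (List Bool)) × ℕ =>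
      ((List.range y.1.1.length).filter fun j => codeAdj y.1 y.2 j).length := by
    refine Primrec.list_length.comp (Primrec.list_filter_of
      (Primrec.list_range.comp (hn.comp .fst)) ?_)
    exact (Primrec.list_getD false).comp ((Primrec.list_getD []).comp
      (Primrec.fst.comp (Primrec.fst.comp .fst)) (Primrec.snd.comp .fst)) .snd
  refine isDecidableLanguage_of_primrecPred
    (p := fun X => (∀ i < X.1.length, ∀ j < X.1.length, codeInput X i = [] ∨ codeInput X j = [] ∨
        codeInput X i = codeInput X j) ∧
      ∀ i < X.1.length, codeInput X i = [] ∨ (codeInput X i).length ≤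
        h ((List.range X.1.length).filter fun j => codeAdj X i j).length)
    (.and (.forall_lt_of hn (.forall_lt_of (hn.comp .fst) ?_)) (.forall_lt_of hn ?_)) fun C => ?_
  · have h1 := hi.comp (Primrec.fst (α := (List (List Bool) × List (List Bool)) × ℕ) (β := ℕ))
    have h2 := hi.comp (Primrec.pair (Primrec.fst.comp (Primrec.fst
      (α := (List (List Bool) × List (List Bool)) × ℕ) (β := ℕ))) .snd)
    exact .or (.eq_of h1 (.const [])) (.or (.eq_of h2 (.const [])) (.eq_of h1 h2))
  · exact .or (.eq_of hi (.const [])) (.le_of (Primrec.list_length.comp hi) (hh.comp hdeg))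
  · rw [C.length_code]
    constructor
    · rintro ⟨h1, h2⟩
      by_cases hw : ∃ v, C.input v ≠ []
      · obtain ⟨v, hv⟩ := hw
        refine ⟨C.input v, fun u => ?_⟩
        have h1 := h1 u u.2 v v.2
        have h2 := h2 u u.2
        simp only [C.codeInput_code, C.length_filter_codeAdj] at h1 h2
        rcases h1 with h1 | h1 | h1
        · exact Or.inl h1
        · exact absurd h1 hv
        · rw [h1] at h2 ⊢
          exact h2.imp id fun h2 => ⟨rfl, h2⟩
      · push Not at hw
        exact ⟨[], fun v => Or.inl (hw v)⟩
    · rintro ⟨x, hx⟩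
      refine ⟨fun i hi j hj => ?_, fun i hi => ?_⟩
      · have h1 := C.codeInput_code ⟨i, hi⟩
        have h2 := C.codeInput_code ⟨j, hj⟩
        simp only at h1 h2
        rw [h1, h2]
        rcases hx ⟨i, hi⟩ with h3 | h3
        · exact Or.inl h3
        rcases hx ⟨j, hj⟩ with h4 | h4
        · exact Or.inr (Or.inl h4)
        · exact Or.inr (Or.inr (h3.1.trans h4.1.symm))
      · have h1 := C.codeInput_code ⟨i, hi⟩
        have h2 := C.length_filter_codeAdj ⟨i, hi⟩
        simp only at h1 h2
        rw [h1, h2]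
        refine (hx ⟨i, hi⟩).imp id fun h3 => ?_
        rw [h3.1]
        exact h3.2

/-- The common input is a certificate for agreement. -/
theorem exists_agreementVerifier (q : Polynomial ℕ) {h : ℕ → ℕ} (hh : Primrec h) (hmono : Monotone h) :
    ∃ A : LocalVerifier, Verifies q A (AgreementLanguage h) ∧
      IsCertBounded q A (AgreementLanguage h) fun x => h x.1 := by
  have hP : PrimrecPred fun y : (List Bool × List Bool) × List (List Bool × List Bool) =>
      (∀ z ∈ y.2, z.2 = y.1.2) ∧ (y.1.1 = [] ∨ y.1.1 = y.1.2 ∧ y.1.2.length ≤ h y.2.length) := by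
    have hc : Primrec fun y : (List Bool × List Bool) × List (List Bool × List Bool) => y.1.2 :=
      Primrec.snd.comp .fst
    exact .and (.forall_mem_of .snd (.eq_of (Primrec.snd.comp .snd) (hc.comp .fst)))
      (.or (.eq_of (Primrec.fst.comp .fst) (.const [])) (.and (.eq_of (Primrec.fst.comp .fst) hc)
        (.le_of (Primrec.list_length.comp hc) (hh.comp (Primrec.list_length.comp .snd)))))
  obtain ⟨_, hP⟩ := hP
  have hacc : ∀ C ∈ AgreementLanguage h, ∃ c : Fin C.n → List Bool, certSize c ≤ h C.n ∧
      LocalVerifier.AcceptsCert q (LocalAlgorithm.oneRound _ hP.to_comp) C c := by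
    rintro C ⟨x, hx⟩
    obtain ⟨y, hy, hlen⟩ : ∃ y : List Bool, (∀ v, C.input v = [] ∨
        C.input v = y ∧ y.length ≤ h (C.graph.neighborSet v).ncard) ∧ y.length ≤ h C.n := by
      by_cases hw : ∃ v, C.input v ≠ []
      · obtain ⟨v, hv⟩ := hw
        exact ⟨x, hx, (((hx v).resolve_left hv).2).trans (hmono (C.ncard_neighborSet_le v))⟩
      · push Not at hw
        exact ⟨[], fun v => Or.inl (hw v), by simp⟩
    refine ⟨fun _ => y, Finset.sup_le fun v _ => hlen, fun ident _ => ?_⟩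
    rw [LocalAlgorithm.allAccept_oneRound]
    intro v
    rw [decide_eq_true_eq]
    refine ⟨fun z hz => ?_, ?_⟩
    · obtain ⟨u, -, rfl⟩ := List.mem_map.1 hz
      rfl
    · simpa [← C.ncard_neighborSet ident v] using hy v
  refine ⟨LocalAlgorithm.oneRound _ hP.to_comp, ⟨fun C hC => ?_, ?_⟩, hacc⟩
  · obtain ⟨c, -, hc⟩ := hacc C hC
    exact ⟨c, hc⟩
  · intro C hC c ident _ hall
    rw [LocalAlgorithm.allAccept_oneRound] at hall
    simp only [decide_eq_true_eq] at hall
    have hc : ∀ v, c v = c ⟨0, C.n_pos⟩ := C.connected.forall_of_adj rfl fun u v huv hu =>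
      ((hall u).1 _ (List.mem_map.2 ⟨v, Config.mem_neighbors.2 huv, rfl⟩)).trans hu
    refine hC ⟨c ⟨0, C.n_pos⟩, fun v => ?_⟩
    have := (hall v).2
    rw [List.length_map, ← C.ncard_neighborSet, hc v] at this
    exact this

/-- The position of a node in a dumbbell. -/
def dumbbellPos (m l v : ℕ) : ℕ := min (v + 1 - m) (l + 1)

/-- Two cliques with `m` nodes that are joined by a path with `l` nodes: nodes are adjacent if their
positions differ by at most one, where the nodes of the cliques have the positions `0` and `l + 1`. -/
def dumbbellGraph (m l : ℕ) : SimpleGraph (Fin (2 * m + l)) where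
  Adj i j := i ≠ j ∧ dumbbellPos m l i ≤ dumbbellPos m l j + 1 ∧
    dumbbellPos m l j ≤ dumbbellPos m l i + 1
  symm := ⟨fun _ _ h => ⟨h.1.symm, h.2.2, h.2.1⟩⟩
  loopless := ⟨fun _ h => h.1 rfl⟩

theorem connected_dumbbellGraph {m : ℕ} (hm : 1 ≤ m) (l : ℕ) : (dumbbellGraph m l).Connected := by
  have key : ∀ k (hk : k < 2 * m + l),
      (dumbbellGraph m l).Reachable ⟨0, by omega⟩ ⟨k, hk⟩ := by
    intro k
    induction k with
    | zero => exact fun _ => .refl _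
    | succ k ih =>
      intro hk
      refine (ih (by omega)).trans (SimpleGraph.Adj.reachable ⟨by simp, ?_⟩)
      simp only [dumbbellPos]
      omega
  have : Nonempty (Fin (2 * m + l)) := ⟨⟨0, by omega⟩⟩
  exact ⟨fun i j => (key i i.2).symm.trans (key j j.2)⟩

theorem le_ncard_neighborSet_dumbbellGraph {m l : ℕ} (hm : 1 ≤ m) (v : Fin (2 * m + l))
    (hv : v.1 = 0 ∨ v.1 = 2 * m + l - 1) : m ≤ ((dumbbellGraph m l).neighborSet v).ncard := by
  have h : ∀ g : Fin m → Fin (2 * m + l), Function.Injective g →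
      (∀ i, g i ∈ (dumbbellGraph m l).neighborSet v) → _ := fun g hg hgv => by
    have := Set.ncard_le_ncard (Set.range_subset_iff.2 hgv)
    rwa [Set.ncard_range_of_injective hg, Nat.card_fin] at this
  rcases hv with hv | hv
  · refine h (fun i => ⟨i + 1, by omega⟩) (fun i j hij => by simpa [Fin.ext_iff] using hij) fun i => ?_
    refine ⟨fun h => by rw [h] at hv; simp at hv, ?_⟩
    simp only [dumbbellPos, hv]
    omega
  · refine h (fun i => ⟨m + l - 1 + i, by omega⟩)
      (fun i j hij => by simpa [Fin.ext_iff] using hij) fun i => ?_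
    refine ⟨fun h => by rw [h] at hv; simp only at hv; omega, ?_⟩
    simp only [dumbbellPos, hv]
    omega

/-- The dumbbell with the inputs `x` and `y` at its two ends. -/
def dumbbell {m : ℕ} (hm : 1 ≤ m) (l : ℕ) (x y : List Bool) : Config where
  n := 2 * m + l
  graph := dumbbellGraph m l
  connected := connected_dumbbellGraph hm l
  input v := if v.1 = 0 then x else if v.1 = 2 * m + l - 1 then y else []

theorem dumbbell_mem_agreement {m l : ℕ} (hm : 1 ≤ m) {h : ℕ → ℕ} (hmono : Monotone h) {x : List Bool}
    (hx : x.length ≤ h m) : dumbbell hm l x x ∈ AgreementLanguage h := by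
  refine ⟨x, fun v => ?_⟩
  by_cases hv : v.1 = 0 ∨ v.1 = 2 * m + l - 1
  · refine Or.inr ⟨?_, hx.trans (hmono (le_ncard_neighborSet_dumbbellGraph hm v hv))⟩
    rcases hv with hv | hv <;> simp [dumbbell, hv]
  · push Not at hv
    exact Or.inl (by simp [dumbbell, hv])

theorem dumbbell_notMem_agreement {m l : ℕ} (hm : 1 ≤ m) {h : ℕ → ℕ} {x y : List Bool} (hx : x ≠ [])
    (hy : y ≠ []) (hxy : x ≠ y) : dumbbell hm l x y ∉ AgreementLanguage h := by
  rintro ⟨z, hz⟩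
  have h1 : (dumbbell hm l x y).input ⟨0, by simp only [dumbbell]; omega⟩ = x := by simp [dumbbell]
  have h2 : (dumbbell hm l x y).input ⟨2 * m + l - 1, by simp only [dumbbell]; omega⟩ = y := by
    have : 2 * m + l - 1 ≠ 0 := by omega
    simp [dumbbell, this]
  have h3 := hz ⟨0, by simp only [dumbbell]; omega⟩
  have h4 := hz ⟨2 * m + l - 1, by simp only [dumbbell]; omega⟩
  rw [h1] at h3
  rw [h2] at h4
  exact hxy ((h3.resolve_left hx).1.trans (h4.resolve_left hy).1.symm)

theorem inputLength_dumbbell {m l : ℕ} (hm : 1 ≤ m) (x y : List Bool) :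
    (dumbbell hm l x y).inputLength = x.length + y.length := by
  have h0 : 0 < 2 * m + l := by omega
  have h1 : 2 * m + l - 1 < 2 * m + l := by omega
  have : ∀ v : Fin (2 * m + l), ((dumbbell hm l x y).input v).length =
      (if v = ⟨0, h0⟩ then x.length else 0) +
        if v = ⟨2 * m + l - 1, h1⟩ then y.length else 0 := by
    intro v
    have hne : 2 * m + l - 1 ≠ 0 := by omega
    by_cases hv : v.1 = 0
    · simp [dumbbell, hv, Fin.ext_iff, hne.symm]
    · by_cases hv' : v.1 = 2 * m + l - 1 <;> simp [dumbbell, hv, hv', Fin.ext_iff, hne]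
  change ∑ v : Fin (2 * m + l), ((dumbbell hm l x y).input v).length = _
  simp [this, Finset.sum_add_distrib]

/-- Local algorithms with few rounds cannot compare the inputs at the two ends of a dumbbell. -/
theorem LocalAlgorithm.allAccept_dumbbell {α : Type} [Primcodable α] (A : LocalAlgorithm α) {m l : ℕ}
    (hm : 1 ≤ m) (hl : 2 * A.rounds + 1 ≤ l) {x y : List Bool} {d d₁ d₂ : Fin (2 * m + l) → α}
    (h₁ : ∀ u : Fin (2 * m + l), dumbbellPos m l u ≤ l → d u = d₁ u)
    (h₂ : ∀ u : Fin (2 * m + l), 1 ≤ dumbbellPos m l u → d u = d₂ u)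
    (hA₁ : A.AllAccept (dumbbell hm l x x) (fun v => v + 1) d₁)
    (hA₂ : A.AllAccept (dumbbell hm l y y) (fun v => v + 1) d₂) :
    A.AllAccept (dumbbell hm l x y) (fun v => v + 1) d :=
  A.allAccept_of_hybrid (fun a b h => Fin.ext (by simpa using h)) (fun u => dumbbellPos m l u)
    (fun _ _ h => h.2.2) 1 (fun u hu => ⟨h₁ u (by omega), fun _ => Iff.rfl⟩)
    (fun u hu => ⟨h₂ u hu, fun _ => Iff.rfl⟩) hA₁ hA₂

/-- Without certificates, two dumbbells with different one-letter inputs can be combined. -/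
theorem agreement_notMem_LD (q : Polynomial ℕ) (hq : ∀ n : ℕ, n ≤ q.eval n) :
    AgreementLanguage (fun _ => 1) ∉ LD q := by
  rintro ⟨-, A, hA⟩
  have hacc : ∀ b : Bool, A.AllAccept (dumbbell le_rfl (2 * A.rounds + 1) [b] [b]) (fun v => v + 1)
      (dumbbell le_rfl (2 * A.rounds + 1) [b] [b]).input := fun b =>
    (hA _ _ (Config.isIdAssignment_succ hq _)).2
      (dumbbell_mem_agreement le_rfl monotone_const (by simp))
  refine dumbbell_notMem_agreement (h := fun _ => 1) (x := [true]) (y := [false]) le_rfl (by simp)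
    (by simp) (by simp) ((hA _ _ (Config.isIdAssignment_succ hq _)).1
      (A.allAccept_dumbbell le_rfl le_rfl ?_ ?_ (hacc true) (hacc false)))
  · intro u hu
    have : u.1 ≠ 2 * 1 + (2 * A.rounds + 1) - 1 := by
      intro h
      rw [h, dumbbellPos] at hu
      omega
    simp only [dumbbell, this, if_false]
  · intro u hu
    have : u.1 ≠ 0 := by
      intro h
      rw [h, dumbbellPos] at hu
      omega
    simp [dumbbell, this]

/-- The certificates of a verifier for agreement are large: with certificates that coincide on the
path of the dumbbell, the two ends may have different inputs. -/
theorem le_of_verifies_agreement {q : Polynomial ℕ} (hq : ∀ n : ℕ, n ≤ q.eval n) {h : ℕ → ℕ}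
    (hmono : Monotone h) {A : LocalVerifier} (hA : Verifies q A (AgreementLanguage h))
    {f : ℕ × ℕ → ℕ} (hf : IsCertBounded q A (AgreementLanguage h) f) {m : ℕ} (hm : 1 ≤ m)
    (hhm : 1 ≤ h m) : h m ≤ (f (2 * m + (2 * A.rounds + 1), 2 * h m) + 1) * (2 * A.rounds + 1) := by
  by_contra hlt
  push Not at hlt
  set l := 2 * A.rounds + 1 with hl
  set s := f (2 * m + l, 2 * h m) with hs
  have hlen : ∀ x : Fin (h m) → Bool, (List.ofFn x).length = h m := fun x => List.length_ofFn
  have hcert : ∀ x : Fin (h m) → Bool, ∃ c : Fin (2 * m + l) → List Bool, certSize c ≤ s ∧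
      LocalVerifier.AcceptsCert q A (dumbbell hm l (List.ofFn x) (List.ofFn x)) c := by
    intro x
    have := hf _ (dumbbell_mem_agreement (l := l) hm hmono (hlen x).le)
    rw [inputLength_dumbbell, hlen, ← two_mul] at this
    exact this
  choose c hc hacc using hcert
  obtain ⟨x, y, hxy, heq⟩ := exists_ne_forall_eq_of_length_le s
    (fun (x : Fin (h m) → Bool) (k : Fin l) => c x ⟨m + k, by omega⟩)
    (fun x k => length_le_of_certSize_le (hc x) _)
    (by simpa using Nat.pow_lt_pow_right (by norm_num) hlt)
  have hne : ∀ x : Fin (h m) → Bool, List.ofFn x ≠ [] := fun x hx => by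
    have := hlen x
    rw [hx, List.length_nil] at this
    omega
  refine hA.2 _ (dumbbell_notMem_agreement (l := l) (h := h) hm (hne x) (hne y)
    fun h => hxy (List.ofFn_injective h))
    (fun u => if dumbbellPos m l u.1 ≤ l then c x u else c y u) _ (Config.isIdAssignment_succ hq _)
    (LocalAlgorithm.allAccept_dumbbell A hm hl.ge ?_ ?_
      (hacc x _ (Config.isIdAssignment_succ hq _)) (hacc y _ (Config.isIdAssignment_succ hq _)))
  · intro u hu
    have : u.1 ≠ 2 * m + l - 1 := by
      intro h
      rw [h, dumbbellPos] at hu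
      omega
    simp [dumbbell, hu, this]
  · intro u hu
    have h0 : u.1 ≠ 0 := by
      intro h
      rw [h, dumbbellPos] at hu
      omega
    have h1 : (if dumbbellPos m l u.1 ≤ l then c x u else c y u) = c y u := by
      split_ifs with hle
      · have hu1 : m ≤ u.1 := by rw [dumbbellPos] at hu; omega
        have hu2 : u.1 - m < l := by rw [dumbbellPos] at hle; omega
        have := heq ⟨u.1 - m, hu2⟩
        simpa [Nat.add_sub_cancel' hu1] using this
      · rfl
    simp [dumbbell, h0, h1]

/-! ### Trees -/

theorem mem_treeLanguage {C : Config} :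
    C ∈ TreeLanguage ↔ C.graph.IsTree ∧ ∀ v, C.input v = [] := by
  rw [TreeLanguage, Set.mem_iUnion]
  constructor
  · rintro ⟨t, h⟩
    exact ⟨h.1, h.2.2⟩
  · rintro ⟨h1, h2⟩
    exact ⟨Finset.univ.sup fun v => C.graph.dist ⟨0, C.n_pos⟩ v, h1,
      ⟨_, fun v => Finset.le_sup (f := fun v => C.graph.dist ⟨0, C.n_pos⟩ v) (Finset.mem_univ v)⟩, h2⟩

/-- A tree is recognized by its number of edges. -/
def CodeIsTree (X : List (List Bool) × List (List Bool)) : Prop :=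
  ((List.range X.1.length).flatMap fun i =>
    (List.range X.1.length).filter fun j => codeAdj X i j).length + 2 = 2 * X.1.length ∧
  ∀ r ∈ X.2, r = []

theorem primrecPred_codeIsTree : PrimrecPred CodeIsTree := by
  have hn : Primrec fun X : List (List Bool) × List (List Bool) => X.1.length :=
    Primrec.length_code_of .id
  refine .and (.eq_of (Primrec.nat_add.comp (Primrec.list_length.comp (Primrec.list_flatMap
    (Primrec.list_range.comp hn) (Primrec.list_filter_of (Primrec.list_range.comp (hn.comp .fst)) ?_)))
    (.const 2)) (Primrec.nat_mul.comp (.const 2) hn)) (.forall_mem_of .snd (.eq_of .snd (.const [])))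
  exact (Primrec.list_getD false).comp ((Primrec.list_getD []).comp
    (Primrec.fst.comp (Primrec.fst.comp .fst)) (Primrec.snd.comp .fst)) .snd

theorem codeIsTree_code (C : Config) :
    CodeIsTree C.code ↔ C.graph.IsTree ∧ ∀ v, C.input v = [] := by
  classical
  have h1 : ((List.range C.n).flatMap fun i =>
      (List.range C.n).filter fun j => codeAdj C.code i j).length =
        2 * Nat.card C.graph.edgeSet := by
    rw [List.length_flatMap, ← List.sum_toFinset _ List.nodup_range, List.toFinset_range,
      ← Fin.sum_univ_eq_sum_range
        (fun i => ((List.range C.n).filter fun j => codeAdj C.code i j).length),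
      Nat.card_eq_fintype_card, ← SimpleGraph.edgeFinset_card,
      ← SimpleGraph.sum_degrees_eq_twice_card_edges]
    refine Finset.sum_congr rfl fun v _ => ?_
    rw [C.length_filter_codeAdj, ← SimpleGraph.card_neighborSet_eq_degree,
      Set.ncard_eq_toFinset_card', Set.toFinset_card]
  have h2 : (∀ r ∈ C.code.2, r = []) ↔ ∀ v, C.input v = [] := by simp [Config.code]
  rw [CodeIsTree, C.length_code, h1, h2, SimpleGraph.isTree_iff_connected_and_card, Nat.card_fin]
  refine and_congr ⟨fun h => ⟨C.connected, by omega⟩, fun h => by omega⟩ Iff.rfl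

theorem isDecidableLanguage_treeLanguage : IsDecidableLanguage TreeLanguage :=
  isDecidableLanguage_of_primrecPred primrecPred_codeIsTree fun C =>
    (codeIsTree_code C).trans mem_treeLanguage.symm

theorem primrec_bitsToNat : Primrec bitsToNat :=
  Primrec.list_foldr (f := fun c : List Bool => c) (g := fun _ => 1)
    (h := fun _ (y : Bool × ℕ) => 2 * y.2 + y.1.toNat) .id (.const 1)
    (Primrec.nat_add.comp (Primrec.nat_mul.comp (.const 2) (Primrec.snd.comp .snd))
      ((Primrec.dom_bool Bool.toNat).comp (Primrec.fst.comp .snd)))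

theorem exists_bitsToNat_eq (k : ℕ) (hk : 0 < k) : ∃ l, bitsToNat l = k ∧ 2 ^ l.length ≤ k := by
  induction k using Nat.strong_induction_on with
  | _ k ih =>
    rcases Nat.lt_or_ge k 2 with h | h
    · exact ⟨[], by simp [bitsToNat]; omega, by rwa [List.length_nil, pow_zero]⟩
    · obtain ⟨l, hl, hlen⟩ := ih (k / 2) (by omega) (by omega)
      refine ⟨(k % 2 == 1) :: l, ?_, ?_⟩
      · have : bitsToNat ((k % 2 == 1) :: l) = 2 * bitsToNat l + (k % 2 == 1).toNat := rfl
        rw [this, hl]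
        rcases Nat.mod_two_eq_zero_or_one k with h | h <;> simp [h] <;> omega
      · rw [List.length_cons, pow_succ]
        omega

/-- The distance from a root in binary is a certificate for being a tree. A graph in which the levels of
adjacent nodes are different, and every node has at most one neighbour of smaller level, is acyclic. -/
theorem treeLanguage_mem (q : Polynomial ℕ) :
    TreeLanguage ∈ NLDOf q (bigO fun x => Real.log x.1) := by
  have hP : PrimrecPred fun y : (List Bool × List Bool) × List (List Bool × List Bool) =>
      y.1.1 = [] ∧ (∀ z ∈ y.2, bitsToNat z.2 ≠ bitsToNat y.1.2) ∧
        (y.2.filter fun z => decide (bitsToNat z.2 < bitsToNat y.1.2)).length ≤ 1 := by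
    have hc : Primrec fun y : (List Bool × List Bool) × List (List Bool × List Bool) =>
      bitsToNat y.1.2 := primrec_bitsToNat.comp (Primrec.snd.comp .fst)
    have hz : Primrec fun z : List Bool × List Bool => bitsToNat z.2 := primrec_bitsToNat.comp .snd
    exact .and (.eq_of (Primrec.fst.comp .fst) (.const []))
      (.and (.forall_mem_of .snd (.not (.eq_of (hz.comp .snd) (hc.comp .fst))))
        (.le_of (Primrec.list_length.comp (Primrec.list_filter_of .snd
          (primrecPred_iff_primrec_decide.1 (.lt_of (hz.comp .snd) (hc.comp .fst))))) (.const 1)))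
  obtain ⟨_, hP⟩ := hP
  have hiff : ∀ (C : Config) (c : Fin C.n → List Bool) (ident : Fin C.n → ℕ),
      ((LocalAlgorithm.oneRound _ hP.to_comp).AllAccept C ident fun v => (C.input v, c v)) ↔
        ∀ v, C.input v = [] ∧ (∀ u, C.graph.Adj v u → bitsToNat (c u) ≠ bitsToNat (c v)) ∧
          ∀ u u', C.graph.Adj v u → C.graph.Adj v u' → bitsToNat (c u) < bitsToNat (c v) →
            bitsToNat (c u') < bitsToNat (c v) → u = u' := by
    intro C c ident
    rw [LocalAlgorithm.allAccept_oneRound]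
    refine forall_congr' fun v => ?_
    rw [decide_eq_true_eq]
    dsimp only
    rw [Config.length_filter_neighbors_le_one]
    simp [Config.mem_neighbors]
  have hacc : ∀ C ∈ TreeLanguage, ∃ c : Fin C.n → List Bool, certSize c ≤ Nat.log 2 C.n ∧
      LocalVerifier.AcceptsCert q (LocalAlgorithm.oneRound _ hP.to_comp) C c := by
    intro C hC
    obtain ⟨hT, hw⟩ := mem_treeLanguage.1 hC
    let r : Fin C.n := ⟨0, C.n_pos⟩
    choose c hc hlen using fun v => exists_bitsToNat_eq (C.graph.dist r v + 1) (by omega)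
    refine ⟨c, Finset.sup_le fun v _ => ?_, fun ident _ => ?_⟩
    · obtain ⟨p, hp, hd⟩ := C.connected.exists_path_of_dist r v
      have := hp.length_lt
      rw [Fintype.card_fin] at this
      exact Nat.le_log_of_pow_le (by norm_num) ((hlen v).trans (by omega))
    · rw [hiff]
      refine fun v => ⟨hw v, fun u hu => ?_, fun u u' hu hu' h h' => ?_⟩
      · rw [hc, hc]
        have := hT.dist_ne_of_adj r hu
        omega
      · rw [hc, hc] at h h'
        have h1 := hT.dist_eq_dist_add_one_of_adj r hu
        have h2 := hT.dist_eq_dist_add_one_of_adj r hu'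
        exact hT.eq_of_adj_of_dist_add_one (r := r) hu hu' (by omega) (by omega)
  refine ⟨isDecidableLanguage_treeLanguage, LocalAlgorithm.oneRound _ hP.to_comp,
    ⟨fun C hC => ?_, ?_⟩, fun x => Nat.log 2 x.1, ⟨fun x y hxy => Nat.log_mono_right hxy.1, ?_⟩, hacc⟩
  · obtain ⟨c, -, hc⟩ := hacc C hC
    exact ⟨c, hc⟩
  · intro C hC c ident _ hall
    rw [hiff] at hall
    refine hC (mem_treeLanguage.2 ⟨⟨C.connected, ?_⟩, fun v => (hall v).1⟩)
    refine SimpleGraph.isAcyclic_of_level (fun v => bitsToNat (c v)) fun v u u' hu hu' h h' => ?_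
    exact (hall v).2.2 u u' hu hu' (lt_of_le_of_ne h ((hall v).2.1 u hu))
      (lt_of_le_of_ne h' ((hall v).2.1 u' hu'))
  · refine IsBigO.of_bound (1 / Real.log 2) ?_
    filter_upwards [eventually_le_fst 1] with x hx
    have hlog : 0 ≤ Real.log x.1 := Real.log_nonneg (by exact_mod_cast hx)
    rw [Real.norm_of_nonneg (by positivity), Real.norm_of_nonneg hlog, one_div_mul_eq_div]
    exact Real.natLog_le_logb _ _

/-- The graph in which every node other than `0` is joined to its parent. -/
def parentGraph (n : ℕ) (par : ℕ → ℕ) : SimpleGraph (Fin n) where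
  Adj i j := (par i = j ∧ j < i) ∨ (par j = i ∧ i < j)
  symm := ⟨fun _ _ h => h.symm⟩
  loopless := ⟨fun i h => by rcases h with h | h <;> exact lt_irrefl _ h.2⟩

theorem isTree_parentGraph {n : ℕ} (hn : 0 < n) {par : ℕ → ℕ} (hpar : ∀ i, 0 < i → par i < i) :
    (parentGraph n par).IsTree := by
  have key : ∀ k (hk : k < n), (parentGraph n par).Reachable ⟨k, hk⟩ ⟨0, hn⟩ := by
    intro k
    induction k using Nat.strong_induction_on with
    | _ k ih =>
      intro hk
      rcases Nat.eq_zero_or_pos k with rfl | h0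
      · exact .refl _
      · have := hpar k h0
        exact (SimpleGraph.Adj.reachable (Or.inl ⟨rfl, this⟩)).trans (ih (par k) this (by omega))
  have : Nonempty (Fin n) := ⟨⟨0, hn⟩⟩
  refine ⟨⟨fun i j => (key i i.2).trans (key j j.2).symm⟩, ?_⟩
  refine SimpleGraph.isAcyclic_of_level id fun v u u' hu hu' h h' => ?_
  rcases hu with hu | hu
  · rcases hu' with hu' | hu'
    · exact Fin.ext (hu.1.symm.trans hu'.1)
    · exact absurd hu'.2 (not_lt.2 h')
  · exact absurd hu.2 (not_lt.2 h)

/-- The path with `n` nodes. -/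
def pathConfig (n : ℕ) (hn : 0 < n) : Config where
  n := n
  graph := parentGraph n Nat.pred
  connected := (isTree_parentGraph hn fun _ hi => Nat.pred_lt_of_lt hi).connected
  input _ := []

theorem pathConfig_adj {n : ℕ} {hn : 0 < n} {i j : Fin n} :
    (pathConfig n hn).graph.Adj i j ↔ i.1 + 1 = j.1 ∨ j.1 + 1 = i.1 := by
  change (Nat.pred i = j ∧ j < i) ∨ (Nat.pred j = i ∧ i < j) ↔ _
  simp only [Nat.pred_eq_sub_one, Fin.lt_def]
  omega

/-- The cycle with `n` nodes. -/
def cycleConfig (n : ℕ) (hn : 3 ≤ n) : Config where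
  n := n
  graph :=
    { Adj := fun i j => i.1 + 1 = j.1 ∨ j.1 + 1 = i.1 ∨ (i.1 = 0 ∧ j.1 + 1 = n) ∨
        (j.1 = 0 ∧ i.1 + 1 = n)
      symm := ⟨fun i j h => by omega⟩
      loopless := ⟨fun i h => by omega⟩ }
  connected := by
    refine (pathConfig n (by omega)).connected.mono fun i j h => ?_
    have := pathConfig_adj.1 h
    change _ ∨ _
    omega
  input _ := []

theorem cycleConfig_notMem_treeLanguage (n : ℕ) (hn : 3 ≤ n) : cycleConfig n hn ∉ TreeLanguage := by
  classical
  intro h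
  have hT := (mem_treeLanguage.1 h).1
  -- A node of maximal distance from a root would have two neighbours that are closer to the root.
  let r : Fin (cycleConfig n hn).n := ⟨0, (cycleConfig n hn).n_pos⟩
  obtain ⟨v, -, hv⟩ := Finset.univ.exists_max_image ((cycleConfig n hn).graph.dist r) ⟨r, by simp⟩
  have hlt : v.1 < n := v.2
  let u : Fin (cycleConfig n hn).n := ⟨if v.1 + 1 = n then 0 else v.1 + 1, by
    change _ < n; split_ifs <;> omega⟩
  let u' : Fin (cycleConfig n hn).n := ⟨if v.1 = 0 then n - 1 else v.1 - 1, by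
    change _ < n; split_ifs <;> omega⟩
  have hu : (cycleConfig n hn).graph.Adj v u := by
    change _ ∨ _
    simp only [u]
    split_ifs <;> omega
  have hu' : (cycleConfig n hn).graph.Adj v u' := by
    change _ ∨ _
    simp only [u']
    split_ifs <;> omega
  have h1 := hT.dist_eq_dist_add_one_of_adj r hu
  have h2 := hT.dist_eq_dist_add_one_of_adj r hu'
  have h3 := hv u (Finset.mem_univ _)
  have h4 := hv u' (Finset.mem_univ _)
  have := congrArg Fin.val (hT.eq_of_adj_of_dist_add_one (r := r) hu hu' (by omega) (by omega))
  simp only [u, u'] at this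
  split_ifs at this <;> omega

/-- If the certificates of a long path repeat on two windows of the size of a view, then the segment
between them can be closed to a cycle that is accepted. -/
theorem le_of_verifies_treeLanguage {q : Polynomial ℕ} (hq : ∀ n : ℕ, n ≤ q.eval n)
    {A : LocalVerifier} (hA : Verifies q A TreeLanguage) {f : ℕ × ℕ → ℕ}
    (hf : IsCertBounded q A TreeLanguage f) {k : ℕ} (hk : 0 < k) :
    k ≤ 2 ^ ((f (k * (2 * A.rounds + 3), 0) + 1) * (2 * A.rounds + 1)) := by
  classical
  by_contra hlt
  push Not at hlt
  set t := A.rounds with ht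
  have hn : 0 < k * (2 * t + 3) := by positivity
  set n := k * (2 * t + 3) with hndef
  have hP : pathConfig n hn ∈ TreeLanguage :=
    mem_treeLanguage.2 ⟨isTree_parentGraph hn fun i hi => Nat.pred_lt_of_lt hi, fun _ => rfl⟩
  obtain ⟨c, hc, hacc⟩ := hf _ hP
  have h0 : (pathConfig n hn).inputLength = 0 := by simp [Config.inputLength, pathConfig]
  rw [h0] at hc
  have hwin : ∀ (a : Fin k) (e : Fin (2 * t + 1)), a * (2 * t + 3) + e < n := by
    intro a e
    have h1 : (a + 1) * (2 * t + 3) ≤ n := Nat.mul_le_mul_right _ a.2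
    have := e.2
    rw [add_mul] at h1
    omega
  obtain ⟨a, b, hab, heq⟩ : ∃ a b : Fin k, a < b ∧
      ∀ e : Fin (2 * t + 1), c ⟨a * (2 * t + 3) + e, hwin a e⟩ = c ⟨b * (2 * t + 3) + e, hwin b e⟩ := by
    obtain ⟨a, b, hne, h⟩ := exists_ne_forall_eq_of_length_le (f (n, 0))
      (fun (a : Fin k) (e : Fin (2 * t + 1)) => c ⟨a * (2 * t + 3) + e, hwin a e⟩)
      (fun a e => length_le_of_certSize_le hc _) (by simpa using hlt)
    rcases lt_or_gt_of_ne hne with h' | h'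
    · exact ⟨a, b, h', h⟩
    · exact ⟨b, a, h', fun e => (h e).symm⟩
  have hij : a * (2 * t + 3) + (2 * t + 3) ≤ b * (2 * t + 3) := by
    have : (a.1 + 1) * (2 * t + 3) ≤ b * (2 * t + 3) := Nat.mul_le_mul_right _ hab
    rwa [add_mul, one_mul] at this
  have hjn := hwin b ⟨2 * t, by omega⟩
  obtain ⟨i, m, hmt, hin, heq'⟩ : ∃ i m, 2 * t + 3 ≤ m ∧ ∃ hin : i + m + 2 * t < n,
      ∀ e (he : e < 2 * t + 1), c ⟨i + e, by change _ < n; omega⟩ =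
        c ⟨i + m + e, by change _ < n; omega⟩ := by
    refine ⟨a * (2 * t + 3), b * (2 * t + 3) - a * (2 * t + 3), by omega, by simp only at hjn; omega,
      fun e he => (heq ⟨e, he⟩).trans (congrArg c (Fin.ext ?_))⟩
    simp only
    omega
  have hm : 3 ≤ m := by omega
  -- The certificate on the cycle.
  let c' : Fin m → List Bool := fun u => c ⟨i + u, by change _ < n; omega⟩
  refine hA.2 (cycleConfig m hm) (cycleConfig_notMem_treeLanguage m hm) c' (fun v => v + 1)
    (Config.isIdAssignment_succ hq _) fun v => ?_
  have hvm : v.1 < m := v.2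
  -- The path is wrapped around the cycle such that the window that starts at node `i + s` of the path
  -- becomes the view of `v`.
  let F : Fin n → Fin m := fun p =>
    ⟨if p.1 - i < m then p.1 - i else if p.1 - i - m < m then p.1 - i - m else 0, by
      split_ifs <;> omega⟩
  obtain ⟨s, hs, hsv⟩ : ∃ s, s < m ∧ (s + t = v.1 ∨ s + t = v.1 + m) := by
    rcases le_or_gt t v.1 with h | h
    · exact ⟨v.1 - t, by omega, by omega⟩
    · exact ⟨v.1 + m - t, by omega, by omega⟩
  let p : Fin n := ⟨i + s + t, by omega⟩
  have hFp : F p = v := by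
    apply Fin.ext
    simp only [F, p]
    split_ifs <;> omega
  let S : Finset (Fin n) := Finset.univ.filter fun u => i + s ≤ u.1 ∧ u.1 ≤ i + s + 2 * t
  have hS : ∀ u, u ∈ S ↔ i + s ≤ u.1 ∧ u.1 ≤ i + s + 2 * t := by simp [S]
  obtain ⟨ident, hident, hidS⟩ := (pathConfig n hn).exists_isIdAssignment hq S
    (fun u => (F u).1 + 1) (by
      intro u hu u' hu' h
      have h1 := (hS u).1 hu
      have h2 := (hS u').1 hu'
      simp only [F] at h
      apply Fin.ext
      split_ifs at h <;> omega) (by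
      intro u hu
      refine ⟨by omega, le_trans (b := n) ?_ (hq _)⟩
      have := (F u).2
      omega)
  have hdist : ∀ u : Fin n, (pathConfig n hn).graph.dist p u ≤ t →
      i + s + t ≤ u.1 + (pathConfig n hn).graph.dist p u ∧
        u.1 ≤ i + s + t + (pathConfig n hn).graph.dist p u := by
    intro u hu
    have hadj : ∀ u v : Fin n, (pathConfig n hn).graph.Adj u v → v.1 ≤ u.1 + 1 := by
      intro u v h
      have := pathConfig_adj.1 h
      omega
    have h1 := (pathConfig n hn).connected.le_add_dist (fun u : Fin n => u.1) hadj p u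
    have h2 := (pathConfig n hn).connected.le_add_dist (fun u : Fin n => u.1) hadj u p
    have h3 : (pathConfig n hn).graph.dist u p = (pathConfig n hn).graph.dist p u :=
      SimpleGraph.dist_comm
    exact ⟨h2.trans_eq (congrArg (u.1 + ·) h3), h1⟩
  have hstate := LocalAlgorithm.stateAfter_eq_of_ball A (C := pathConfig n hn) (C' := cycleConfig m hm)
    (ident := ident) (ident' := fun v => v + 1) (fun a b h => Fin.ext (by simpa using h))
    (x := fun u => ((pathConfig n hn).input u, c u))
    (x' := fun u => ((cycleConfig m hm).input u, c' u)) F t p (by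
      intro u hu
      have hu' := hdist u hu
      refine ⟨hidS u ((hS u).2 (by omega)), Prod.ext rfl ?_⟩
      simp only [c', F]
      have hw : i ≤ u.1 := by omega
      by_cases h1 : u.1 - i < m
      · simp only [h1, if_true]
        congr 1
        exact Fin.ext (by simp only; omega)
      · have h2 : u.1 - i - m < m := by omega
        simp only [h1, h2, if_false, if_true]
        rw [heq' _ (by omega)]
        congr 1
        exact Fin.ext (by simp only; omega)) (by
      intro u hu
      have hu' := hdist u hu.le
      have hun : u.1 < n := u.2
      refine ⟨fun w hw => ?_, fun w hw w' hw' h => ?_, fun w hw => ?_⟩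
      · have := (pathConfig_adj (hn := hn)).1 hw
        change _ ∨ _
        simp only [F]
        split_ifs <;> omega
      · have h1 := (pathConfig_adj (hn := hn)).1 hw
        have h2 := (pathConfig_adj (hn := hn)).1 hw'
        have h3 := congrArg Fin.val h
        simp only [F] at h3
        apply Fin.ext
        split_ifs at h3 <;> omega
      · have hwm : w.1 < m := w.2
        have h1 : (F u).1 + 1 = w.1 ∨ w.1 + 1 = (F u).1 ∨ ((F u).1 = 0 ∧ w.1 + 1 = m) ∨
          (w.1 = 0 ∧ (F u).1 + 1 = m) := hw
        by_cases h2 : (F u).1 + 1 = w.1 ∨ (w.1 = 0 ∧ (F u).1 + 1 = m)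
        · refine ⟨⟨u.1 + 1, by change _ < n; omega⟩, (pathConfig_adj (hn := hn)).2 (Or.inl rfl), Fin.ext ?_⟩
          simp only [F] at h2 ⊢
          split_ifs at h2 ⊢ <;> omega
        · refine ⟨⟨u.1 - 1, by change _ < n; omega⟩, (pathConfig_adj (hn := hn)).2 (Or.inr (by simp only; omega)),
            Fin.ext ?_⟩
          simp only [F] at h1 h2 ⊢
          split_ifs at h1 h2 ⊢ <;> omega)
  rw [hFp] at hstate
  rw [← ht, ← hstate]
  exact hacc ident hident p

/-! ### Fixed-point-free automorphisms of trees -/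

namespace SimpleGraph

variable {V : Type*} {G : SimpleGraph V}

theorem Connected.dist_map_le {V' : Type*} {G' : SimpleGraph V'} (hG : G.Connected) (φ : G →g G')
    (u v : V) : G'.dist (φ u) (φ v) ≤ G.dist u v := by
  obtain ⟨p, hp⟩ := hG.exists_walk_length_eq_dist u v
  rw [← hp, ← Walk.length_map φ p]
  exact dist_le _

theorem Connected.dist_iso {V' : Type*} {G' : SimpleGraph V'} (hG : G.Connected) (φ : G ≃g G')
    (u v : V) : G'.dist (φ u) (φ v) = G.dist u v := by
  refine le_antisymm (hG.dist_map_le φ.toHom u v) ?_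
  simpa using (φ.connected_iff.1 hG).dist_map_le φ.symm.toHom (φ u) (φ v)

/-- In a tree, an edge `xy` that leads from the side of `u` to the side of `v` of an edge `uv` is equal
to it. -/
theorem IsTree.eq_of_dist_lt (hG : G.IsTree) {u v x y : V} (huv : G.Adj u v) (hxy : G.Adj x y)
    (hx : G.dist u x < G.dist v x) (hy : G.dist v y < G.dist u y) : x = u ∧ y = v := by
  have h1 := hG.dist_eq_dist_add_one_of_adj x huv
  have h2 := hG.dist_eq_dist_add_one_of_adj y huv
  have h3 := hG.dist_eq_dist_add_one_of_adj u hxy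
  have h4 := hG.dist_eq_dist_add_one_of_adj v hxy
  simp only [dist_comm (u := x), dist_comm (u := y)] at h1 h2
  have hxu : x = u := by
    by_contra hne
    obtain ⟨x', hx', hd⟩ := hG.connected.exists_adj_dist_add_one hne
    have h5 := hG.connected.dist_triangle (u := v) (v := u) (w := x')
    rw [dist_eq_one_iff_adj.2 huv.symm] at h5
    have h6 := hG.dist_eq_dist_add_one_of_adj v hx'
    have := hG.eq_of_adj_of_dist_add_one (r := v) hxy hx' (by omega) (by omega)
    subst this
    omega
  subst hxu
  refine ⟨rfl, ?_⟩
  have : G.dist v y = 0 := by rw [dist_self] at *; omega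
  exact (hG.connected.dist_eq_zero_iff.1 this).symm

/-- An automorphism of a tree without fixed vertices swaps the ends of an edge. For the first edge on
the way from `v` to `φ v`, for every vertex `v`, is the same edge for two different vertices, since
there are more vertices than edges. -/
theorem IsTree.exists_swapped_edge [Finite V] (hG : G.IsTree) (φ : G ≃g G) (hφ : ∀ v, φ v ≠ v) :
    ∃ a b, G.Adj a b ∧ φ a = b ∧ φ b = a := by
  classical
  have := Fintype.ofFinite V
  choose g hg hd using fun v => hG.connected.exists_adj_dist_add_one (hφ v).symm
  have hcard := hG.card_edgeFinset
  obtain ⟨v, -, u, -, hne, heq⟩ := Finset.exists_ne_map_eq_of_card_lt_of_maps_to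
    (s := Finset.univ) (t := G.edgeFinset) (by rw [Finset.card_univ]; omega)
    (f := fun v => s(v, g v)) (fun v _ => by simpa using hg v)
  rcases Sym2.eq_iff.1 heq with h | h
  · exact absurd h.1 hne
  · have hv := hd v
    have hu := hd u
    rw [h.2] at hv
    rw [← h.1] at hu
    rw [dist_comm, dist_comm (u := φ v)] at hv
    rw [dist_comm, dist_comm (u := φ u)] at hu
    have huv : G.Adj u v := by rw [h.1]; exact hg u
    obtain ⟨h1, h2⟩ := hG.eq_of_dist_lt huv (φ.map_adj_iff.2 huv.symm) (by omega) (by omega)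
    exact ⟨v, u, huv.symm, h1, h2⟩

/-- The distance from an edge `ab`. -/
noncomputable def edgeDist (G : SimpleGraph V) (a b v : V) : ℕ := min (G.dist a v) (G.dist b v)

theorem edgeDist_comm (a b v : V) : G.edgeDist a b v = G.edgeDist b a v := min_comm _ _

theorem IsTree.edgeDist_of_adj (hG : G.IsTree) {a b v w : V} (hab : G.Adj a b) (hvw : G.Adj v w) :
    (v = a ∧ w = b ∨ v = b ∧ w = a) ∨ G.edgeDist a b v = G.edgeDist a b w + 1 ∨
      G.edgeDist a b w = G.edgeDist a b v + 1 := by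
  have h1 := hG.dist_ne_of_adj v hab
  have h2 := hG.dist_ne_of_adj w hab
  have h3 := hG.dist_eq_dist_add_one_of_adj a hvw
  have h4 := hG.dist_eq_dist_add_one_of_adj b hvw
  simp only [dist_comm (u := v), dist_comm (u := w)] at h1 h2
  unfold edgeDist
  rcases lt_or_gt_of_ne h1 with h5 | h5 <;> rcases lt_or_gt_of_ne h2 with h6 | h6
  · omega
  · exact Or.inl (Or.inl (hG.eq_of_dist_lt hab hvw h5 h6))
  · exact Or.inl (Or.inr (hG.eq_of_dist_lt hab.symm hvw h5 h6))
  · omega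

theorem IsTree.eq_of_edgeDist_add_one (hG : G.IsTree) {a b v u u' : V} (hab : G.Adj a b)
    (hu : G.Adj v u) (hu' : G.Adj v u') (h : G.edgeDist a b u + 1 = G.edgeDist a b v)
    (h' : G.edgeDist a b u' + 1 = G.edgeDist a b v) : u = u' := by
  wlog hv : G.dist a v < G.dist b v generalizing a b
  · have hne := hG.dist_ne_of_adj v hab
    simp only [dist_comm (u := v)] at hne
    exact this (a := b) (b := a) hab.symm (by rwa [edgeDist_comm b, edgeDist_comm b])
      (by rwa [edgeDist_comm b, edgeDist_comm b]) (by omega)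
  have hne : ¬ v = a := by
    rintro rfl
    simp [edgeDist] at h
  have key : ∀ u, G.Adj v u → G.edgeDist a b u + 1 = G.edgeDist a b v →
      G.dist a u + 1 = G.dist a v := by
    intro u hu h
    have h1 := hG.dist_ne_of_adj u hab
    simp only [dist_comm (u := u)] at h1
    rcases lt_or_gt_of_ne h1 with h2 | h2
    · unfold edgeDist at h
      omega
    · exact absurd (hG.eq_of_dist_lt hab hu hv h2).1 hne
  exact hG.eq_of_adj_of_dist_add_one hu hu' (key u hu h) (key u' hu' h')

theorem IsTree.exists_adj_edgeDist_add_one (hG : G.IsTree) {a b v : V} (hab : G.Adj a b)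
    (h : 0 < G.edgeDist a b v) : ∃ u, G.Adj v u ∧ G.edgeDist a b u + 1 = G.edgeDist a b v := by
  wlog hv : G.dist a v ≤ G.dist b v generalizing a b
  · simp only [edgeDist_comm a] at h ⊢
    exact this hab.symm h (by omega)
  have hne : v ≠ a := by
    rintro rfl
    simp [edgeDist] at h
  obtain ⟨u, hu, hd⟩ := hG.connected.exists_adj_dist_add_one hne
  refine ⟨u, hu, ?_⟩
  rcases hG.edgeDist_of_adj hab hu with h1 | h1 | h1
  · exfalso
    rcases h1 with h1 | h1 <;> simp [edgeDist, h1.1] at h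
  · exact h1.symm
  · unfold edgeDist at h1 ⊢
    omega

end SimpleGraph

/-- Put a word into parentheses. -/
def paren (w : List Bool) : List Bool := true :: (w ++ [false])

theorem paren_injective : Function.Injective paren := by
  intro w w' h
  simpa [paren] using h

/-- One step of `parse`: the state is the current depth and the list of the maximal parenthesized
words that have been read so far. -/
def parseStep (b : Bool) (s : ℕ × List (List Bool)) : ℕ × List (List Bool) :=
  bif b then (s.1 - 1, (true :: s.2.headI) :: s.2.tail)
  else bif s.1 == 0 then (1, [false] :: s.2) else (s.1 + 1, (false :: s.2.headI) :: s.2.tail)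

/-- Split a concatenation of parenthesized words into these words, from right to left. -/
def parse (w : List Bool) : List (List Bool) := (w.foldr parseStep (0, [])).2

/-- Inside of an outer parenthesis, the parser copies `w`. -/
def IsParsable (w : List Bool) : Prop :=
  ∀ k r R, w.foldr parseStep (k + 1, r :: R) = (k + 1, (w ++ r) :: R)

theorem foldr_paren_zero {w : List Bool} (hw : IsParsable w) (R : List (List Bool)) :
    (paren w).foldr parseStep (0, R) = (0, paren w :: R) := by
  have h0 : [false].foldr parseStep (0, R) = (0 + 1, [false] :: R) := rfl
  rw [paren, List.foldr_cons, List.foldr_append, h0, hw]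
  rfl

theorem IsParsable.paren {w : List Bool} (hw : IsParsable w) : IsParsable (paren w) := by
  intro k r R
  have h0 : [false].foldr parseStep (k + 1, r :: R) = (k + 1 + 1, (false :: r) :: R) := rfl
  rw [_root_.paren, List.foldr_cons, List.foldr_append, h0, hw]
  simp [parseStep]

theorem isParsable_flatMap_paren {l : List (List Bool)} (hl : ∀ w ∈ l, IsParsable w) :
    IsParsable (l.flatMap paren) := by
  induction l with
  | nil => exact fun _ _ _ => rfl
  | cons w l ih =>
    intro k r R
    rw [List.flatMap_cons, List.foldr_append, ih (fun w' h => hl w' (List.mem_cons_of_mem _ h)),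
      (hl w List.mem_cons_self).paren, List.append_assoc]

theorem parse_flatMap_paren {l : List (List Bool)} (hl : ∀ w ∈ l, IsParsable w) :
    parse (l.flatMap paren) = l.map paren := by
  suffices (l.flatMap paren).foldr parseStep (0, []) = (0, l.map paren) by rw [parse, this]
  induction l with
  | nil => rfl
  | cons w l ih =>
    rw [List.flatMap_cons, List.foldr_append, ih (fun w' h => hl w' (List.mem_cons_of_mem _ h)),
      foldr_paren_zero (hl w List.mem_cons_self), List.map_cons]

theorem primrec_parse : Primrec parse := by
  refine Primrec.snd.comp (Primrec.list_foldr (f := fun c : List Bool => c)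
    (h := fun _ (y : Bool × ℕ × List (List Bool)) => parseStep y.1 y.2) .id (.const (0, [])) ?_)
  have hl : Primrec fun y : Bool × ℕ × List (List Bool) => y.2.2 := Primrec.snd.comp .snd
  have hk : Primrec fun y : Bool × ℕ × List (List Bool) => y.2.1 := Primrec.fst.comp .snd
  have hpush : ∀ b : Bool, Primrec fun y : Bool × ℕ × List (List Bool) =>
      (b :: y.2.2.headI) :: y.2.2.tail := fun b =>
    Primrec.list_cons.comp (Primrec.list_cons.comp (.const b) (Primrec.list_headI.comp hl))
      (Primrec.list_tail.comp hl)
  have : Primrec fun y : Bool × ℕ × List (List Bool) => parseStep y.1 y.2 :=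
    Primrec.cond .fst (.pair (Primrec.nat_sub.comp hk (.const 1)) (hpush true))
      (Primrec.cond (Primrec.beq.comp hk (.const 0))
        (.pair (.const 1) (Primrec.list_cons.comp (.const [false]) hl))
        (.pair (Primrec.nat_add.comp hk (.const 1)) (hpush false)))
  exact this.comp .snd

namespace SimpleGraph

variable {V : Type*} {G : SimpleGraph V}

/-- Labels of the vertices as in the certificates for symmetric trees: every vertex `v` has exactly one
neighbour (its parent) with a label that is not shorter. If the parent has a label of the same length,
then it has the same label. The other neighbours (the children) have shorter labels, which are
determined by the label of `v`, up to their order. -/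
structure IsSymmetryLabeling (G : SimpleGraph V) (s : V → List Bool) : Prop where
  existsUnique_parent : ∀ v, ∃! u, G.Adj v u ∧ (s v).length ≤ (s u).length
  eq_of_length_eq : ∀ v u, G.Adj v u → (s u).length = (s v).length → s u = s v
  exists_bij : ∀ v v', s v = s v' → ∃ σ : V → V,
    Set.BijOn σ {u | G.Adj v u ∧ (s u).length < (s v).length}
      {u | G.Adj v' u ∧ (s u).length < (s v').length} ∧
    ∀ u, G.Adj v u → (s u).length < (s v).length → s (σ u) = s u

theorem IsSymmetryLabeling.isAcyclic {s : V → List Bool} (hs : G.IsSymmetryLabeling s) :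
    G.IsAcyclic :=
  isAcyclic_of_level (β := ℕᵒᵈ) (fun v => OrderDual.toDual (s v).length)
    fun v _ _ hu hu' h h' => (hs.existsUnique_parent v).unique ⟨hu, h⟩ ⟨hu', h'⟩

/-- The automorphism is built from the roots, which are swapped with their parents, downwards: the
children of `v` are mapped to the children of the image of `v` such that the labels are preserved. -/
theorem IsSymmetryLabeling.exists_iso [Finite V] {s : V → List Bool} (hs : G.IsSymmetryLabeling s) :
    ∃ φ : G ≃g G, ∀ v, φ v ≠ v := by
  classical
  have := Fintype.ofFinite V
  choose p hp hp' using hs.existsUnique_parent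
  simp only [and_imp] at hp'
  have hσ : ∀ v v', ∃ σ : V → V, s v = s v' →
      Set.BijOn σ {u | G.Adj v u ∧ (s u).length < (s v).length}
        {u | G.Adj v' u ∧ (s u).length < (s v').length} ∧
      ∀ u, G.Adj v u → (s u).length < (s v).length → s (σ u) = s u := by
    intro v v'
    by_cases h : s v = s v'
    · obtain ⟨σ, h1⟩ := hs.exists_bij v v' h
      exact ⟨σ, fun _ => h1⟩
    · exact ⟨id, fun h' => absurd h' h⟩
  choose σ hσ using hσ
  have hwf : WellFounded fun u v : V => (s v).length < (s u).length :=
    have : IsTrans V fun u v : V => (s v).length < (s u).length := ⟨fun _ _ _ h h' => h'.trans h⟩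
    have : Std.Irrefl fun u v : V => (s v).length < (s u).length := ⟨fun _ h => lt_irrefl _ h⟩
    Finite.wellFounded_of_trans_of_irrefl _
  obtain ⟨φ, hφ⟩ : ∃ φ : V → V, ∀ v, φ v =
      if (s v).length < (s (p v)).length then σ (p v) (φ (p v)) v else p v := by
    refine ⟨hwf.fix fun v rec => if h : (s v).length < (s (p v)).length then
      σ (p v) (rec (p v) h) v else p v, fun v => ?_⟩
    rw [hwf.fix_eq]
    by_cases h : (s v).length < (s (p v)).length
    · rw [dif_pos h, if_pos h]
    · rw [dif_neg h, if_neg h]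
  -- Roots and their parents.
  have hroot : ∀ v, ¬ (s v).length < (s (p v)).length → φ v = p v ∧ s (p v) = s v ∧ p (p v) = v := by
    intro v h
    have hle := (hp v).2
    refine ⟨by rw [hφ, if_neg h], hs.eq_of_length_eq v _ (hp v).1 (by omega), ?_⟩
    exact (hp' (p v) v (hp v).1.symm (by omega)).symm
  have hlabel : ∀ v, s (φ v) = s v := by
    intro v
    induction v using hwf.induction with
    | _ v ih =>
      by_cases h : (s v).length < (s (p v)).length
      · rw [hφ, if_pos h]
        exact (hσ _ _ (ih (p v) h).symm).2 v (hp v).1.symm h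
      · rw [(hroot v h).1, (hroot v h).2.1]
  have hchild : ∀ v, (s v).length < (s (p v)).length →
      G.Adj (φ (p v)) (φ v) ∧ (s (φ v)).length < (s (φ (p v))).length := by
    intro v h
    have := (hσ (p v) (φ (p v)) (hlabel _).symm).1.mapsTo ⟨(hp v).1.symm, h⟩
    rw [hφ v, if_pos h]
    exact this
  have hpφ : ∀ v, p (φ v) = φ (p v) := by
    intro v
    by_cases h : (s v).length < (s (p v)).length
    · exact (hp' (φ v) _ (hchild v h).1.symm (hchild v h).2.le).symm
    · obtain ⟨h1, h2, h3⟩ := hroot v h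
      have h4 : ¬ (s (p v)).length < (s (p (p v))).length := by rw [h2, h3]; exact lt_irrefl _
      rw [h1, (hroot _ h4).1]
  have hadj : ∀ v u, G.Adj v u → u = p v ∨ v = p u := by
    intro v u h
    rcases le_total (s v).length (s u).length with h1 | h1
    · exact Or.inl (hp' v u h h1)
    · exact Or.inr (hp' u v h.symm h1)
  have hinj : Function.Injective φ := by
    intro v
    induction v using hwf.induction with
    | _ v ih =>
      intro v' h
      have hl : s v = s v' := by rw [← hlabel v, h, hlabel]
      have hpp : φ (p v) = φ (p v') := by rw [← hpφ, h, hpφ]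
      have hlp : s (p v) = s (p v') := by rw [← hlabel (p v), hpp, hlabel]
      by_cases h1 : (s v).length < (s (p v)).length
      · have h2 : (s v').length < (s (p v')).length := by rwa [← hl, ← hlp]
        have h3 := ih (p v) h1 hpp
        refine (hσ (p v) (φ (p v)) (hlabel _).symm).1.injOn ⟨(hp v).1.symm, h1⟩
          ⟨h3 ▸ (hp v').1.symm, h3 ▸ h2⟩ ?_
        have h4 := h
        rw [hφ v, hφ v', if_pos h1, if_pos h2, ← hpp, ← h3] at h4
        exact h4
      · have h2 : ¬ (s v').length < (s (p v')).length := by rwa [← hl, ← hlp]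
        rw [(hroot v h1).1, (hroot v' h2).1] at h
        rw [← (hroot v h1).2.2, h, (hroot v' h2).2.2]
  have hbij : Function.Bijective φ := hinj.bijective_of_finite
  refine ⟨⟨Equiv.ofBijective φ hbij, fun {u v} => ?_⟩, fun v => ?_⟩
  · simp only [Equiv.ofBijective_apply]
    constructor
    · intro h
      rcases hadj _ _ h with h1 | h1
      · rw [hpφ] at h1
        rw [hinj h1]
        exact (hp u).1
      · rw [hpφ] at h1
        rw [hinj h1]
        exact (hp v).1.symm
    · intro h
      rcases hadj _ _ h with rfl | rfl
      · rw [← hpφ]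
        exact (hp _).1
      · rw [← hpφ]
        exact (hp _).1.symm
  · change φ v ≠ v
    induction v using hwf.induction with
    | _ v ih =>
      intro h
      by_cases h1 : (s v).length < (s (p v)).length
      · exact ih (p v) h1 (by rw [← hpφ, h])
      · rw [(hroot v h1).1] at h
        exact (hp v).1.ne h.symm

/-- A tree with an automorphism without fixed vertices has short labels as above: every vertex gets the
canonical parenthesis code of its subtree, away from the edge that is swapped. -/
theorem IsTree.exists_labels [Fintype V] (hG : G.IsTree) (φ : G ≃g G) (hφ : ∀ v, φ v ≠ v) :
    ∃ s : V → List Bool, (∀ v, (s v).length ≤ 2 * Fintype.card V) ∧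
      (∀ v, ∃! u, G.Adj v u ∧ (s v).length ≤ (s u).length) ∧
      (∀ v u, G.Adj v u → (s u).length = (s v).length → s u = s v) ∧
      ∀ v (l : List V), l.Nodup → (∀ u, u ∈ l ↔ G.Adj v u ∧ (s u).length < (s v).length) →
        (parse (s v)).Perm (l.map fun u => paren (s u)) := by
  classical
  obtain ⟨a, b, hab, ha, hb⟩ := hG.exists_swapped_edge φ hφ
  set d := G.edgeDist a b with hd
  set N := Fintype.card V with hN
  have hdN : ∀ v, d v < N := by
    intro v
    obtain ⟨p, hp, h⟩ := hG.connected.exists_path_of_dist a v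
    exact (min_le_left _ _).trans_lt (h ▸ hp.length_lt)
  have hdφ : ∀ v, d (φ v) = d v := by
    intro v
    have h1 : G.dist a (φ v) = G.dist b v := by
      conv_lhs => rw [← hb]
      exact hG.connected.dist_iso φ b v
    have h2 : G.dist b (φ v) = G.dist a v := by
      conv_lhs => rw [← ha]
      exact hG.connected.dist_iso φ a v
    rw [hd, edgeDist, edgeDist, h1, h2, min_comm]
  let ch : V → Finset V := fun v => Finset.univ.filter fun u => G.Adj v u ∧ d u = d v + 1
  have hch : ∀ v u, u ∈ ch v ↔ G.Adj v u ∧ d u = d v + 1 := fun v u => by simp [ch]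
  -- The codes, computed for `N - d v` levels below `v`.
  let S : ℕ → V → List Bool := fun k => k.rec (fun _ => []) fun _ S v =>
    (((ch v).val.map S).toList).flatMap paren
  obtain ⟨s, hs⟩ : ∃ s : V → List Bool, ∀ v, s v = (((ch v).val.map s).toList).flatMap paren := by
    refine ⟨fun v => S (N - d v) v, fun v => ?_⟩
    obtain ⟨k, hk⟩ : ∃ k, N - d v = k + 1 := ⟨N - d v - 1, by have := hdN v; omega⟩
    have h : ((ch v).val.map fun u => S (N - d u) u) = (ch v).val.map (S k) := by
      refine Multiset.map_congr rfl fun u hu => ?_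
      have := (hch v u).1 hu
      rw [show N - d u = k by omega]
    change S (N - d v) v = _
    rw [h, hk]
  -- Induction from the leaves to the roots.
  have hind : ∀ P : V → Prop, (∀ v, (∀ u ∈ ch v, P u) → P v) → ∀ v, P v := by
    intro P h
    have : ∀ k v, N - d v ≤ k → P v := by
      intro k
      induction k with
      | zero => intro v hv; have := hdN v; omega
      | succ k ih =>
        exact fun v hv => h v fun u hu => ih u (by have := (hch v u).1 hu; omega)
    exact fun v => this _ v le_rfl
  have hlen : ∀ v, (s v).length = ∑ u ∈ ch v, ((s u).length + 2) := by
    intro v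
    rw [hs, List.length_flatMap, ← Multiset.sum_coe, ← Multiset.map_coe, Multiset.coe_toList,
      Multiset.map_map, Finset.sum]
    simp [paren]
  have hshort : ∀ v, ∀ u ∈ ch v, (s u).length < (s v).length := by
    intro v u hu
    rw [hlen v]
    have := Finset.single_le_sum (f := fun u => (s u).length + 2) (fun _ _ => Nat.zero_le _) hu
    omega
  have hparsable : ∀ v, IsParsable (s v) := hind _ fun v ih => by
    rw [hs]
    refine isParsable_flatMap_paren fun w hw => ?_
    obtain ⟨u, hu, rfl⟩ := Multiset.mem_map.1 (Multiset.mem_toList.1 hw)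
    exact ih u hu
  have hparse : ∀ v, parse (s v) = (((ch v).val.map s).toList).map paren := by
    intro v
    conv_lhs => rw [hs]
    refine parse_flatMap_paren fun w hw => ?_
    obtain ⟨u, hu, rfl⟩ := Multiset.mem_map.1 (Multiset.mem_toList.1 hw)
    exact hparsable u
  have hsφ : ∀ v, s (φ v) = s v := hind _ fun v ih => by
    have h1 : ch (φ v) = (ch v).map φ.toEquiv.toEmbedding := by
      ext u
      rw [Finset.mem_map_equiv, hch, hch, hdφ]
      obtain ⟨u, rfl⟩ := φ.surjective u
      have : φ.toEquiv.symm (φ u) = u := φ.symm_apply_apply u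
      rw [this, hdφ, φ.map_adj_iff]
    rw [hs, hs v, h1, Finset.map_val, Multiset.map_map]
    congr 2
    exact Multiset.map_congr rfl fun u hu => ih u hu
  have hab0 : ∀ v, d v = 0 ↔ v = a ∨ v = b := by
    intro v
    rw [hd, edgeDist, Nat.min_eq_zero_iff, hG.connected.dist_eq_zero_iff,
      hG.connected.dist_eq_zero_iff, eq_comm, eq_comm (a := b)]
  -- The neighbours are the children and the parent.
  have hparent : ∀ v, ∃ u, G.Adj v u ∧ (s v).length ≤ (s u).length ∧
      ((s u).length = (s v).length → s u = s v) ∧ ∀ u', G.Adj v u' → u' ≠ u → u' ∈ ch v := by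
    intro v
    rcases Nat.eq_zero_or_pos (d v) with h0 | h0
    · have hroot : ∀ u, G.Adj v u → φ v = u → (v = a ∧ u = b ∨ v = b ∧ u = a) →
          ∃ u, G.Adj v u ∧ (s v).length ≤ (s u).length ∧
            ((s u).length = (s v).length → s u = s v) ∧ ∀ u', G.Adj v u' → u' ≠ u → u' ∈ ch v := by
        intro u hvu hφu hvab
        refine ⟨u, hvu, by rw [← hφu, hsφ], fun _ => by rw [← hφu, hsφ], fun u' hu' hne => ?_⟩
        rw [hch]
        refine ⟨hu', ?_⟩
        rcases hG.edgeDist_of_adj hab hu' with h1 | h1 | h1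
        · exfalso
          rcases hvab with ⟨rfl, rfl⟩ | ⟨rfl, rfl⟩ <;> rcases h1 with ⟨h1, h2⟩ | ⟨h1, h2⟩ <;>
            first | exact hne h2 | exact hab.ne h1 | exact hab.ne h1.symm
        · have h1 : d v = d u' + 1 := h1
          omega
        · exact h1
      rcases (hab0 v).1 h0 with rfl | rfl
      · exact hroot b hab ha (Or.inl ⟨rfl, rfl⟩)
      · exact hroot a hab.symm hb (Or.inr ⟨rfl, rfl⟩)
    · obtain ⟨u, hu, hdu⟩ := hG.exists_adj_edgeDist_add_one hab h0
      have hlt := hshort u v ((hch u v).2 ⟨hu.symm, hdu.symm⟩)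
      refine ⟨u, hu, hlt.le, fun h => by omega, fun u' hu' hne => (hch v u').2 ⟨hu', ?_⟩⟩
      rcases hG.edgeDist_of_adj hab hu' with h1 | h1 | h1
      · exfalso
        have := (hab0 v).2 (h1.imp (·.1) (·.1))
        omega
      · exact absurd (hG.eq_of_edgeDist_add_one hab hu' hu h1.symm hdu) hne
      · exact h1
  have hmem : ∀ v u, u ∈ ch v ↔ G.Adj v u ∧ (s u).length < (s v).length := by
    intro v u
    refine ⟨fun h => ⟨((hch v u).1 h).1, hshort v u h⟩, fun h => ?_⟩
    obtain ⟨u', -, h2, -, h3⟩ := hparent v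
    exact h3 u h.1 (by rintro rfl; omega)
  refine ⟨s, fun v => ?_, fun v => ?_, fun v u hu hl => ?_, fun v l hl hlm => ?_⟩
  · -- The codes of the vertices of a level have in total at most two symbols for every deeper vertex.
    have key : ∀ k j, N ≤ j + k → ∑ v ∈ Finset.univ.filter (fun v => d v = j), (s v).length ≤
        2 * (Finset.univ.filter fun v => j < d v).card := by
      intro k
      induction k with
      | zero =>
        intro j hj
        rw [Finset.filter_false_of_mem fun v _ => by have := hdN v; omega]
        simp
      | succ k ih =>
        intro j hj
        have h1 := ih (j + 1) (by omega)
        have hdisj : Set.PairwiseDisjoint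
            ((Finset.univ.filter fun v => d v = j : Finset V) : Set V) ch := by
          intro v hv v' hv' hne
          rw [Function.onFun, Finset.disjoint_left]
          intro u hu hu'
          rw [hch] at hu hu'
          exact hne (hG.eq_of_edgeDist_add_one hab hu.1.symm hu'.1.symm hu.2.symm hu'.2.symm)
        have hsub : (Finset.univ.filter fun v => d v = j).biUnion ch ⊆
            Finset.univ.filter fun v => d v = j + 1 := by
          intro u hu
          obtain ⟨v, hv, hvu⟩ := Finset.mem_biUnion.1 hu
          have h2 := ((hch v u).1 hvu).2
          have h3 := (Finset.mem_filter.1 hv).2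
          exact Finset.mem_filter.2 ⟨Finset.mem_univ _, by omega⟩
        have hcard : (Finset.univ.filter fun v => j < d v).card =
            (Finset.univ.filter fun v => d v = j + 1).card +
              (Finset.univ.filter fun v => j + 1 < d v).card := by
          rw [← Finset.card_union_of_disjoint]
          · congr 1
            ext v
            simp only [Finset.mem_filter, Finset.mem_univ, true_and, Finset.mem_union]
            omega
          · rw [Finset.disjoint_left]
            intro v
            simp only [Finset.mem_filter, Finset.mem_univ, true_and]
            omega
        calc ∑ v ∈ Finset.univ.filter (fun v => d v = j), (s v).length
            = ∑ v ∈ Finset.univ.filter (fun v => d v = j), ∑ u ∈ ch v, ((s u).length + 2) :=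
              Finset.sum_congr rfl fun v _ => hlen v
          _ = ∑ u ∈ (Finset.univ.filter fun v => d v = j).biUnion ch, ((s u).length + 2) :=
              (Finset.sum_biUnion hdisj).symm
          _ ≤ ∑ u ∈ Finset.univ.filter (fun v => d v = j + 1), ((s u).length + 2) :=
              Finset.sum_le_sum_of_subset hsub
          _ ≤ 2 * (Finset.univ.filter fun v => j < d v).card := by
              rw [Finset.sum_add_distrib, hcard]
              simp only [Finset.sum_const, smul_eq_mul]
              omega
    calc (s v).length ≤ ∑ u ∈ Finset.univ.filter (fun u => d u = d v), (s u).length :=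
          Finset.single_le_sum (f := fun u => (s u).length) (fun _ _ => Nat.zero_le _)
            (Finset.mem_filter.2 ⟨Finset.mem_univ v, rfl⟩)
      _ ≤ 2 * (Finset.univ.filter fun u => d v < d u).card := key N _ (by omega)
      _ ≤ 2 * N := Nat.mul_le_mul_left _ (Finset.card_le_univ _)
  · obtain ⟨u, h1, h2, -, h3⟩ := hparent v
    refine ⟨u, ⟨h1, h2⟩, fun u' hu' => ?_⟩
    by_contra hne
    exact absurd (hshort v u' (h3 u' hu'.1 hne)) (not_lt.2 hu'.2)
  · obtain ⟨u', -, -, h2, h3⟩ := hparent v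
    by_cases hne : u = u'
    · subst hne
      exact h2 hl
    · exact absurd hl (hshort v u (h3 u hu hne)).ne
  · have h1 : (l : Multiset V) = (ch v).val :=
      (Multiset.Nodup.ext (Multiset.coe_nodup.2 hl) (ch v).nodup).2 fun u =>
        (hlm u).trans (hmem v u).symm
    rw [hparse, ← Multiset.coe_eq_coe, ← Multiset.map_coe, ← Multiset.map_coe, Multiset.coe_toList,
      Multiset.map_map, h1]
    rfl

end SimpleGraph

/-- A bijection between the entries of two lists with the same multiset of values. -/
theorem exists_bijOn_of_map_perm {V β : Type*} {s : V → β} {l l' : List V} (hl : l.Nodup)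
    (hl' : l'.Nodup) (h : (l.map s).Perm (l'.map s)) :
    ∃ σ : V → V, Set.BijOn σ {u | u ∈ l} {u | u ∈ l'} ∧ ∀ u ∈ l, s (σ u) = s u := by
  classical
  induction l generalizing l' with
  | nil =>
    have : l' = [] := by simpa using h.symm.eq_nil
    subst this
    exact ⟨id, by simp, by simp⟩
  | cons a l ih =>
    have ha : s a ∈ l'.map s := h.subset (by simp)
    obtain ⟨b, hb, hba⟩ := List.mem_map.1 ha
    have hp : l'.Perm (b :: l'.erase b) := List.perm_cons_erase hb
    have h2 : (l.map s).Perm ((l'.erase b).map s) := by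
      have h3 := h.trans (hp.map s)
      rw [List.map_cons, List.map_cons, hba] at h3
      exact h3.cons_inv
    obtain ⟨σ, hσ, hs⟩ := ih (List.nodup_cons.1 hl).2 (hl'.erase b) h2
    have hal := (List.nodup_cons.1 hl).1
    have hne : ∀ u ∈ l, u ≠ a := fun u hu h => hal (h ▸ hu)
    have hmem : ∀ u, u ∈ l'.erase b ↔ u ≠ b ∧ u ∈ l' := fun u => hl'.mem_erase_iff
    refine ⟨Function.update σ a b, ⟨?_, ?_, ?_⟩, ?_⟩
    · intro u hu
      rcases List.mem_cons.1 hu with rfl | hu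
      · simpa using hb
      · have := (hmem _).1 (hσ.mapsTo hu)
        simpa [Function.update_of_ne (hne u hu)] using this.2
    · intro u hu u' hu' huu'
      rcases List.mem_cons.1 hu with h3 | h3 <;> rcases List.mem_cons.1 hu' with h4 | h4
      · rw [h3, h4]
      · rw [h3, Function.update_self, Function.update_of_ne (hne u' h4)] at huu'
        exact absurd huu'.symm ((hmem _).1 (hσ.mapsTo h4)).1
      · rw [h4, Function.update_self, Function.update_of_ne (hne u h3)] at huu'
        exact absurd huu' ((hmem _).1 (hσ.mapsTo h3)).1
      · rw [Function.update_of_ne (hne u h3), Function.update_of_ne (hne u' h4)] at huu'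
        exact hσ.injOn h3 h4 huu'
    · intro w hw
      by_cases hwb : w = b
      · exact ⟨a, by simp, by simp [hwb]⟩
      · obtain ⟨u, hu, rfl⟩ := hσ.surjOn ((hmem w).2 ⟨hwb, hw⟩)
        exact ⟨u, List.mem_cons_of_mem _ hu, Function.update_of_ne (hne u hu) _ _⟩
    · intro u hu
      rcases List.mem_cons.1 hu with rfl | hu
      · simpa using hba
      · rw [Function.update_of_ne (hne u hu)]
        exact hs u hu

/-- A code of a tree with empty inputs and an automorphism without fixed nodes. The automorphism is
searched among all lists of nodes. -/
def CodeIsFPF (X : List (List Bool) × List (List Bool)) : Prop :=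
  CodeIsTree X ∧ ∃ l ∈ allLists X.1.length X.1.length, ∀ i < X.1.length, l.getD i 0 ≠ i ∧
    ∀ j < X.1.length, (l.getD i 0 = l.getD j 0 → i = j) ∧
      (codeAdj X i j = true → codeAdj X (l.getD i 0) (l.getD j 0) = true) ∧
      (codeAdj X (l.getD i 0) (l.getD j 0) = true → codeAdj X i j = true)

theorem primrecPred_codeIsFPF : PrimrecPred CodeIsFPF := by
  have hn : Primrec fun X : List (List Bool) × List (List Bool) => X.1.length :=
    Primrec.length_code_of .id
  refine .and primrecPred_codeIsTree (.exists_mem_of (primrec_allLists.comp hn)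
    (.forall_lt_of (hn.comp .fst) (.and (.not (.eq_of
      ((Primrec.list_getD 0).comp (Primrec.snd.comp .fst) .snd) .snd))
      (.forall_lt_of (hn.comp (Primrec.fst.comp .fst)) ?_))))
  have hX : Primrec fun y : (((List (List Bool) × List (List Bool)) × List ℕ) × ℕ) × ℕ =>
    y.1.1.1 := Primrec.fst.comp (Primrec.fst.comp .fst)
  have hl : Primrec fun y : (((List (List Bool) × List (List Bool)) × List ℕ) × ℕ) × ℕ =>
    y.1.1.2 := Primrec.snd.comp (Primrec.fst.comp .fst)
  have hi : Primrec fun y : (((List (List Bool) × List (List Bool)) × List ℕ) × ℕ) × ℕ =>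
    y.1.2 := Primrec.snd.comp .fst
  have hj : Primrec fun y : (((List (List Bool) × List (List Bool)) × List ℕ) × ℕ) × ℕ =>
    y.2 := Primrec.snd
  have hli := (Primrec.list_getD 0).comp hl hi
  have hlj := (Primrec.list_getD 0).comp hl hj
  exact .and (.imp (.eq_of hli hlj) (.eq_of hi hj))
    (.and (.imp (Primrec.codeAdj_of hX hi hj) (Primrec.codeAdj_of hX hli hlj))
      (.imp (Primrec.codeAdj_of hX hli hlj) (Primrec.codeAdj_of hX hi hj)))

theorem codeIsFPF_code (C : Config) : CodeIsFPF C.code ↔ C ∈ FPFSymmetryOnTrees := by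
  rw [CodeIsFPF, codeIsTree_code, C.length_code]
  constructor
  · rintro ⟨⟨hT, hw⟩, l, hl, h⟩
    rw [mem_allLists] at hl
    have hlt : ∀ i : Fin C.n, l.getD i 0 < C.n := by
      intro i
      have hi : i.1 < l.length := by rw [hl.1]; exact i.2
      rw [List.getD_eq_getElem _ _ hi]
      exact hl.2 _ (List.getElem_mem hi)
    let φ : Fin C.n → Fin C.n := fun i => ⟨l.getD i 0, hlt i⟩
    have hinj : Function.Injective φ := fun i j hij =>
      Fin.ext (((h i i.2).2 j j.2).1 (congrArg Fin.val hij))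
    refine ⟨hT, ⟨⟨Equiv.ofBijective φ hinj.bijective_of_finite, fun {i j} => ?_⟩, fun v hv => ?_⟩, hw⟩
    · rw [← C.codeAdj_code, ← C.codeAdj_code]
      exact ⟨((h i i.2).2 j j.2).2.2, ((h i i.2).2 j j.2).2.1⟩
    · exact (h v v.2).1 (congrArg Fin.val hv)
  · rintro ⟨hT, ⟨φ, hφ⟩, hw⟩
    refine ⟨⟨hT, hw⟩, List.ofFn fun i => (φ i : ℕ), mem_allLists.2 ⟨by simp, ?_⟩, fun i hi => ?_⟩
    · intro a ha
      obtain ⟨i, rfl⟩ := (List.mem_ofFn' _ _).1 ha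
      exact (φ i).2
    · have hget : ∀ i : Fin C.n, (List.ofFn fun i => (φ i : ℕ)).getD i 0 = φ i := by
        intro i
        rw [List.getD_eq_getElem _ _ (by simp)]
        simp
      rw [hget ⟨i, hi⟩]
      refine ⟨fun h => hφ _ (Fin.ext h), fun j hj => ?_⟩
      rw [hget ⟨j, hj⟩, C.codeAdj_code, C.codeAdj_code ⟨i, hi⟩ ⟨j, hj⟩]
      exact ⟨fun h => congrArg Fin.val (φ.injective (Fin.ext h)), φ.map_adj_iff.2, φ.map_adj_iff.1⟩

theorem isDecidableLanguage_FPFSymmetryOnTrees : IsDecidableLanguage FPFSymmetryOnTrees :=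
  isDecidableLanguage_of_primrecPred primrecPred_codeIsFPF codeIsFPF_code

/-- The parenthesis codes of the subtrees are certificates for symmetric trees. -/
theorem FPFSymmetryOnTrees_mem (q : Polynomial ℕ) :
    FPFSymmetryOnTrees ∈ NLDOf q (bigO fun x => (x.1 : ℝ)) := by
  have hP : PrimrecPred fun y : (List Bool × List Bool) × List (List Bool × List Bool) =>
      y.1.1 = [] ∧ (∃ z ∈ y.2, y.1.2.length ≤ z.2.length) ∧
        (y.2.filter fun z => decide (y.1.2.length ≤ z.2.length)).length ≤ 1 ∧
        (∀ z ∈ y.2, z.2.length = y.1.2.length → z.2 = y.1.2) ∧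
        (parse y.1.2).Perm ((y.2.filter fun z => decide (z.2.length < y.1.2.length)).map
          fun z => paren z.2) := by
    have hc : Primrec fun y : (List Bool × List Bool) × List (List Bool × List Bool) => y.1.2 :=
      Primrec.snd.comp .fst
    have hlc := Primrec.list_length.comp hc
    have hz : Primrec fun z : List Bool × List Bool => z.2 := .snd
    have hlz := Primrec.list_length.comp hz
    have hparen : Primrec paren := Primrec.list_cons.comp (.const true)
      (Primrec.list_append.comp .id (.const [false]))
    exact .and (.eq_of (Primrec.fst.comp .fst) (.const []))
      (.and (.exists_mem_of .snd (.le_of (hlc.comp .fst) (hlz.comp .snd)))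
      (.and (.le_of (Primrec.list_length.comp (Primrec.list_filter_of .snd
          (primrecPred_iff_primrec_decide.1 (.le_of (hlc.comp .fst) (hlz.comp .snd))))) (.const 1))
      (.and (.forall_mem_of .snd (.imp (.eq_of (hlz.comp .snd) (hlc.comp .fst))
        (.eq_of (hz.comp .snd) (hc.comp .fst))))
      (.perm_of (primrec_parse.comp hc) (Primrec.list_map (Primrec.list_filter_of .snd
          (primrecPred_iff_primrec_decide.1 (.lt_of (hlz.comp .snd) (hlc.comp .fst))))
        (hparen.comp (hz.comp .snd)).to₂)))))
  obtain ⟨_, hP⟩ := hP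
  have hiff : ∀ (C : Config) (c : Fin C.n → List Bool) (ident : Fin C.n → ℕ),
      ((LocalAlgorithm.oneRound _ hP.to_comp).AllAccept C ident fun v => (C.input v, c v)) ↔
        ∀ v, C.input v = [] ∧ (∃ u, C.graph.Adj v u ∧ (c v).length ≤ (c u).length) ∧
          (∀ u u', C.graph.Adj v u → C.graph.Adj v u' → (c v).length ≤ (c u).length →
            (c v).length ≤ (c u').length → u = u') ∧
          (∀ u, C.graph.Adj v u → (c u).length = (c v).length → c u = c v) ∧
          (parse (c v)).Perm (((C.neighbors ident v).filter
            fun u => decide ((c u).length < (c v).length)).map fun u => paren (c u)) := by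
    intro C c ident
    rw [LocalAlgorithm.allAccept_oneRound]
    refine forall_congr' fun v => ?_
    rw [decide_eq_true_eq]
    dsimp only
    rw [Config.length_filter_neighbors_le_one, List.filter_map, List.map_map]
    simp [Config.mem_neighbors, Function.comp_def]
  have hlist : ∀ (C : Config) (c : Fin C.n → List Bool) (ident : Fin C.n → ℕ) (v u : Fin C.n),
      u ∈ (C.neighbors ident v).filter (fun u => decide ((c u).length < (c v).length)) ↔
        C.graph.Adj v u ∧ (c u).length < (c v).length := by
    intro C c ident v u
    rw [List.mem_filter, Config.mem_neighbors, decide_eq_true_eq]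
  have hacc : ∀ C ∈ FPFSymmetryOnTrees, ∃ c : Fin C.n → List Bool, certSize c ≤ 2 * C.n ∧
      LocalVerifier.AcceptsCert q (LocalAlgorithm.oneRound _ hP.to_comp) C c := by
    rintro C ⟨hT, ⟨φ, hφ⟩, hw⟩
    obtain ⟨c, hlen, h1, h2, h3⟩ := hT.exists_labels φ hφ
    refine ⟨c, Finset.sup_le fun v _ => by simpa using hlen v, fun ident _ => ?_⟩
    rw [hiff]
    exact fun v => ⟨hw v, (h1 v).exists, fun u u' hu hu' h h' => (h1 v).unique ⟨hu, h⟩ ⟨hu', h'⟩, h2 v,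
      h3 v _ ((C.nodup_neighbors ident v).filter _) (hlist C c ident v)⟩
  refine ⟨isDecidableLanguage_FPFSymmetryOnTrees, LocalAlgorithm.oneRound _ hP.to_comp,
    ⟨fun C hC => ?_, ?_⟩, fun x => 2 * x.1, ⟨fun x y hxy => Nat.mul_le_mul_left 2 hxy.1, ?_⟩, hacc⟩
  · obtain ⟨c, -, hc⟩ := hacc C hC
    exact ⟨c, hc⟩
  · intro C hC c ident _ hall
    rw [hiff] at hall
    have hs : C.graph.IsSymmetryLabeling c := by
      refine ⟨fun v => ?_, fun v => (hall v).2.2.2.1, fun v v' h => ?_⟩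
      · obtain ⟨u, hu⟩ := (hall v).2.1
        exact ⟨u, hu, fun u' hu' => (hall v).2.2.1 u' u hu'.1 hu.1 hu'.2 hu.2⟩
      · have hp := (hall v).2.2.2.2.symm.trans
          ((List.Perm.of_eq (congrArg parse h)).trans (hall v').2.2.2.2)
        obtain ⟨σ, hσ, hsσ⟩ := exists_bijOn_of_map_perm ((C.nodup_neighbors ident v).filter _)
          ((C.nodup_neighbors ident v').filter _) hp
        refine ⟨σ, ?_, fun u hu hl => paren_injective (hsσ u ((hlist C c ident v u).2 ⟨hu, hl⟩))⟩
        convert hσ using 1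
        · exact Set.ext fun u => (hlist C c ident v u).symm
        · exact Set.ext fun u => (hlist C c ident v' u).symm
    exact hC ⟨⟨C.connected, hs.isAcyclic⟩, hs.exists_iso, fun v => (hall v).1⟩
  · refine IsBigO.of_bound 2 (Eventually.of_forall fun x => ?_)
    rw [Real.norm_of_nonneg (by positivity), Real.norm_of_nonneg (by positivity)]
    push_cast
    exact le_rfl

/-! ### Caterpillars -/

/-- The parents in a caterpillar. The nodes `3 * k` form the spine. The block of `3 * k` contains in
addition the node `3 * k + 1`, which is adjacent to `3 * k`, and the node `3 * k + 2`, which is adjacent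
to `3 * k` or `3 * k + 1`, depending on the bit `z k`. -/
def caterpillarParent (z : ℕ → Bool) (i : ℕ) : ℕ :=
  if i % 3 = 0 then i - 3 else if i % 3 = 1 then i - 1 else if z (i / 3) = true then i - 2 else i - 1

theorem caterpillarParent_lt (z : ℕ → Bool) (i : ℕ) (hi : 0 < i) : caterpillarParent z i < i := by
  unfold caterpillarParent
  split_ifs <;> omega

/-- The caterpillar with `M` blocks. -/
def caterpillar (z : ℕ → Bool) (M : ℕ) (hM : 0 < M) : Config where
  n := 3 * M
  graph := parentGraph (3 * M) (caterpillarParent z)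
  connected := (isTree_parentGraph (by omega) (caterpillarParent_lt z)).connected
  input _ := []

theorem caterpillar_isTree (z : ℕ → Bool) (M : ℕ) (hM : 0 < M) : (caterpillar z M hM).graph.IsTree :=
  isTree_parentGraph (by omega) (caterpillarParent_lt z)

theorem parentGraph_caterpillar_adj {z : ℕ → Bool} {n : ℕ} {i j : Fin n} :
    (parentGraph n (caterpillarParent z)).Adj i j ↔
      (i.1 % 3 = 0 ∧ j.1 % 3 = 0 ∧ (i.1 + 3 = j.1 ∨ j.1 + 3 = i.1)) ∨
      (i.1 / 3 = j.1 / 3 ∧ ((i.1 % 3 = 0 ∧ j.1 % 3 = 1) ∨ (i.1 % 3 = 1 ∧ j.1 % 3 = 0) ∨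
        (z (i.1 / 3) = true ∧ ((i.1 % 3 = 0 ∧ j.1 % 3 = 2) ∨ (i.1 % 3 = 2 ∧ j.1 % 3 = 0))) ∨
        (z (i.1 / 3) = false ∧ ((i.1 % 3 = 1 ∧ j.1 % 3 = 2) ∨ (i.1 % 3 = 2 ∧ j.1 % 3 = 1))))) := by
  change (caterpillarParent z i = j ∧ j.1 < i.1) ∨ (caterpillarParent z j = i ∧ i.1 < j.1) ↔ _
  have key : ∀ i j : ℕ, (caterpillarParent z i = j ∧ j < i) ↔
      (i % 3 = 0 ∧ j + 3 = i) ∨ (i / 3 = j / 3 ∧ ((i % 3 = 1 ∧ j % 3 = 0) ∨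
        (z (i / 3) = true ∧ i % 3 = 2 ∧ j % 3 = 0) ∨ (z (i / 3) = false ∧ i % 3 = 2 ∧ j % 3 = 1))) := by
    intro i j
    unfold caterpillarParent
    cases z (i / 3) <;> simp only [reduceCtorEq, if_true, if_false, true_and, false_and, false_or, or_false] <;>
      split_ifs <;> omega
  rw [key, key]
  by_cases hb : i.1 / 3 = j.1 / 3
  · rw [hb]
    cases z (j.1 / 3) <;> simp only [reduceCtorEq, true_and, false_and, false_or, or_false] <;> omega
  · have hb' : ¬ j.1 / 3 = i.1 / 3 := fun h => hb h.symm
    simp only [hb, hb', false_and, or_false]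
    omega

/-- A palindromic caterpillar is symmetric. -/
theorem caterpillar_mem {z : ℕ → Bool} {M : ℕ} (hM : 0 < M) (heven : M % 2 = 0)
    (hz : ∀ k < M, z (M - 1 - k) = z k) : caterpillar z M hM ∈ FPFSymmetryOnTrees := by
  refine ⟨caterpillar_isTree z M hM, ?_, fun _ => rfl⟩
  let φ : Fin (3 * M) → Fin (3 * M) := fun i => ⟨3 * (M - 1 - i.1 / 3) + i.1 % 3, by omega⟩
  have hφ : ∀ i, (φ i).1 / 3 = M - 1 - i.1 / 3 ∧ (φ i).1 % 3 = i.1 % 3 := by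
    intro i
    simp only [φ]
    omega
  have hinv : Function.Involutive φ := by
    intro i
    apply Fin.ext
    have h1 := hφ i
    have h2 := hφ (φ i)
    have := i.2
    omega
  have hadj : ∀ i j, (parentGraph (3 * M) (caterpillarParent z)).Adj i j →
      (parentGraph (3 * M) (caterpillarParent z)).Adj (φ i) (φ j) := by
    intro i j h
    rw [parentGraph_caterpillar_adj] at h ⊢
    have hi := hφ i
    have hj := hφ j
    rw [hi.1, hi.2, hj.1, hj.2, hz _ (by omega)]
    rcases h with h | h
    · left
      simp only [φ]
      omega
    · exact Or.inr ⟨by rw [h.1], h.2⟩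
  refine ⟨⟨hinv.toPerm, fun {i j} => ⟨fun h => ?_, hadj i j⟩⟩, fun i h => ?_⟩
  · have := hadj _ _ (show (parentGraph (3 * M) (caterpillarParent z)).Adj (φ i) (φ j) from h)
    rwa [hinv i, hinv j] at this
  · have h1 : φ i = i := h
    have h2 := (hφ i).1
    rw [h1] at h2
    have := i.2
    omega

/-- A self-map of a path that is injective and preserves adjacency is the identity or the reversal. -/
theorem eq_self_or_eq_reverse {M : ℕ} {τ : ℕ → ℕ} (hlt : ∀ k < M, τ k < M)
    (hinj : ∀ k < M, ∀ l < M, τ k = τ l → k = l)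
    (hadj : ∀ k, k + 1 < M → τ (k + 1) = τ k + 1 ∨ τ k = τ (k + 1) + 1) :
    (∀ k < M, τ k = k) ∨ ∀ k < M, τ k = M - 1 - k := by
  rcases Nat.lt_or_ge M 2 with hM | hM
  · refine Or.inl fun k hk => ?_
    have := hlt k hk
    omega
  rcases hadj 0 (by omega) with h0 | h0
  · left
    have key : ∀ k, k + 1 < M → τ (k + 1) = τ k + 1 := by
      intro k
      induction k with
      | zero => exact fun _ => h0
      | succ k ih =>
        intro hk
        rcases hadj (k + 1) hk with h | h
        · exact h
        · have h1 := ih (by omega)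
          have := hinj (k + 1 + 1) hk k (by omega) (by omega)
          omega
    have key' : ∀ k < M, τ k = τ 0 + k := by
      intro k
      induction k with
      | zero => simp
      | succ k ih =>
        intro hk
        rw [key k hk, ih (by omega)]
        omega
    intro k hk
    have h1 := key' k hk
    have h2 := key' (M - 1) (by omega)
    have h3 := hlt (M - 1) (by omega)
    omega
  · right
    have key : ∀ k, k + 1 < M → τ k = τ (k + 1) + 1 := by
      intro k
      induction k with
      | zero => exact fun _ => h0
      | succ k ih =>
        intro hk
        rcases hadj (k + 1) hk with h | h
        · have h1 := ih (by omega)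
          have := hinj (k + 1 + 1) hk k (by omega) (by omega)
          omega
        · exact h
    have key' : ∀ k < M, τ 0 = τ k + k := by
      intro k
      induction k with
      | zero => simp
      | succ k ih =>
        intro hk
        rw [ih (by omega), key k hk]
        omega
    intro k hk
    have h1 := key' k hk
    have h2 := key' (M - 1) (by omega)
    have h3 := hlt 0 (by omega)
    omega

/-- Graph isomorphisms preserve the property of having three neighbours. -/
theorem SimpleGraph.Iso.exists_three_adj {V : Type*} {G : SimpleGraph V} (φ : G ≃g G) {v : V}
    (h : ∃ a b c, a ≠ b ∧ a ≠ c ∧ b ≠ c ∧ G.Adj v a ∧ G.Adj v b ∧ G.Adj v c) :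
    ∃ a b c, a ≠ b ∧ a ≠ c ∧ b ≠ c ∧ G.Adj (φ v) a ∧ G.Adj (φ v) b ∧ G.Adj (φ v) c := by
  obtain ⟨a, b, c, h1, h2, h3, h4, h5, h6⟩ := h
  exact ⟨φ a, φ b, φ c, φ.injective.ne h1, φ.injective.ne h2, φ.injective.ne h3,
    φ.map_adj_iff.2 h4, φ.map_adj_iff.2 h5, φ.map_adj_iff.2 h6⟩

/-- The spine of a caterpillar consists of the nodes of degree at least three, provided that the first
and the last bit are `true`. -/
theorem caterpillar_spine_iff {z : ℕ → Bool} {M : ℕ} (hM : 2 ≤ M) (h0 : z 0 = true)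
    (h1 : z (M - 1) = true) (v : Fin (3 * M)) : v.1 % 3 = 0 ↔ ∃ a b c, a ≠ b ∧ a ≠ c ∧ b ≠ c ∧
      (parentGraph (3 * M) (caterpillarParent z)).Adj v a ∧
      (parentGraph (3 * M) (caterpillarParent z)).Adj v b ∧
      (parentGraph (3 * M) (caterpillarParent z)).Adj v c := by
  obtain ⟨v, hvM⟩ := v
  constructor
  · intro hv
    change v % 3 = 0 at hv
    have hp : (parentGraph (3 * M) (caterpillarParent z)).Adj ⟨v, hvM⟩ ⟨v + 1, by omega⟩ :=
      parentGraph_caterpillar_adj.2 (by dsimp only; omega)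
    have hr (hz : z (v / 3) = true) :
        (parentGraph (3 * M) (caterpillarParent z)).Adj ⟨v, hvM⟩ ⟨v + 2, by omega⟩ :=
      parentGraph_caterpillar_adj.2 (Or.inr ⟨by dsimp only; omega, Or.inr (Or.inr (Or.inl ⟨hz,
        by dsimp only; omega⟩))⟩)
    by_cases hfirst : v = 0
    · exact ⟨⟨v + 1, by omega⟩, ⟨v + 2, by omega⟩, ⟨v + 3, by omega⟩, by simp, by simp, by simp,
        hp, hr (by rw [hfirst]; exact h0), parentGraph_caterpillar_adj.2 (by dsimp only; omega)⟩
    have hl : (parentGraph (3 * M) (caterpillarParent z)).Adj ⟨v, hvM⟩ ⟨v - 3, by omega⟩ :=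
      parentGraph_caterpillar_adj.2 (by dsimp only; omega)
    by_cases hlast : v / 3 = M - 1
    · exact ⟨⟨v + 1, by omega⟩, ⟨v + 2, by omega⟩, ⟨v - 3, by omega⟩, by simp,
        fun h => by have := congrArg Fin.val h; dsimp only at this; omega,
        fun h => by have := congrArg Fin.val h; dsimp only at this; omega,
        hp, hr (by rw [hlast]; exact h1), hl⟩
    · exact ⟨⟨v + 1, by omega⟩, ⟨v + 3, by omega⟩, ⟨v - 3, by omega⟩, by simp,
        fun h => by have := congrArg Fin.val h; dsimp only at this; omega,
        fun h => by have := congrArg Fin.val h; dsimp only at this; omega,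
        hp, parentGraph_caterpillar_adj.2 (by dsimp only; omega), hl⟩
  · rintro ⟨⟨a, ha'⟩, ⟨b, hb'⟩, ⟨c, hc'⟩, hab, hac, hbc, ha, hb, hc⟩
    by_contra hv
    -- Nodes outside of the spine are adjacent to nodes of their own block only.
    have hblock (u : Fin (3 * M)) (hu : (parentGraph (3 * M) (caterpillarParent z)).Adj ⟨v, hvM⟩ u) :
        v / 3 = u.1 / 3 := by
      rcases parentGraph_caterpillar_adj.1 hu with h | h
      · exact absurd h.1 hv
      · exact h.1
    have h1 := hblock _ ha
    have h2 := hblock _ hb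
    have h3 := hblock _ hc
    have h4 : ¬ v = a := fun h => ha.ne (Fin.ext h)
    have h5 : ¬ v = b := fun h => hb.ne (Fin.ext h)
    have h6 : ¬ v = c := fun h => hc.ne (Fin.ext h)
    have h7 : ¬ a = b := fun h => hab (Fin.ext h)
    have h8 : ¬ a = c := fun h => hac (Fin.ext h)
    have h9 : ¬ b = c := fun h => hbc (Fin.ext h)
    dsimp only at h1 h2 h3 hv
    omega

/-- A symmetry of a caterpillar maps the node `3 * k` of the spine to the node `3 * (M - 1 - k)`. -/
theorem caterpillar_iso_spine {z : ℕ → Bool} {M : ℕ} (hM : 2 ≤ M) (h0 : z 0 = true)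
    (h1 : z (M - 1) = true) (φ : parentGraph (3 * M) (caterpillarParent z) ≃g
      parentGraph (3 * M) (caterpillarParent z)) (hφ : ∀ v, φ v ≠ v) (k : ℕ) (hk : k < M) :
    (φ ⟨3 * k, by omega⟩).1 = 3 * (M - 1 - k) := by
  have hφspine (v : Fin (3 * M)) (hv : v.1 % 3 = 0) : (φ v).1 % 3 = 0 :=
    (caterpillar_spine_iff hM h0 h1 _).2
      (φ.exists_three_adj ((caterpillar_spine_iff hM h0 h1 v).1 hv))
  let τ : ℕ → ℕ := fun k => if hk : k < M then (φ ⟨3 * k, by omega⟩).1 / 3 else 0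
  have hτ : ∀ k (hk : k < M), (φ ⟨3 * k, by omega⟩).1 = 3 * τ k := by
    intro k hk
    have := hφspine ⟨3 * k, by omega⟩ (by dsimp only; omega)
    simp only [τ, hk, dite_true]
    omega
  clear_value τ
  have hτrev : ∀ k < M, τ k = M - 1 - k := by
    refine (eq_self_or_eq_reverse (M := M) (τ := τ) (fun k hk => ?_) (fun k hk l hl hkl => ?_)
      fun k hk => ?_).resolve_left fun hid => ?_
    · have h2 := hτ k hk
      have := (φ ⟨3 * k, by omega⟩).2
      omega
    · have h2 := hτ k hk
      rw [hkl, ← hτ l hl] at h2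
      have := congrArg Fin.val (φ.injective (Fin.ext h2))
      dsimp only at this
      omega
    · have h2 : (parentGraph (3 * M) (caterpillarParent z)).Adj
          ⟨3 * k, by omega⟩ ⟨3 * (k + 1), by omega⟩ :=
        parentGraph_caterpillar_adj.2 (Or.inl ⟨by dsimp only; omega, by dsimp only; omega,
          by dsimp only; omega⟩)
      have h3 := parentGraph_caterpillar_adj.1 (φ.map_adj_iff.2 h2)
      rw [hτ k (by omega), hτ (k + 1) hk] at h3
      omega
    · refine hφ ⟨3 * 0, by omega⟩ (Fin.ext ?_)
      rw [hτ 0 (by omega), hid 0 (by omega)]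
  rw [hτ k hk, hτrev k hk]

/-- A symmetric caterpillar is palindromic: a symmetry reverses the spine, and the bit `z k` is `false`
if and only if `3 * k` has a neighbour outside of the spine that has another neighbour. -/
theorem palindrome_of_caterpillar_mem {z : ℕ → Bool} {M : ℕ} (hM : 2 ≤ M) (h0 : z 0 = true)
    (h1 : z (M - 1) = true) (h : caterpillar z M (by omega) ∈ FPFSymmetryOnTrees) :
    ∀ k < M, z k = false → z (M - 1 - k) = false := by
  obtain ⟨-, ⟨φ', hφ'⟩, -⟩ := h
  obtain ⟨φ, hφ⟩ : ∃ φ : parentGraph (3 * M) (caterpillarParent z) ≃g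
    parentGraph (3 * M) (caterpillarParent z), ∀ v, φ v ≠ v := ⟨φ', hφ'⟩
  have hspine (v : Fin (3 * M)) (hv : (φ v).1 % 3 = 0) : v.1 % 3 = 0 := by
    have := (caterpillar_spine_iff hM h0 h1 _).2
      (φ.symm.exists_three_adj ((caterpillar_spine_iff hM h0 h1 _).1 hv))
    rwa [φ.symm_apply_apply] at this
  intro k hk hzk
  -- The node `p` witnesses that the bit is `false`.
  obtain ⟨s, hs⟩ : ∃ s : Fin (3 * M), s.1 = 3 * k := ⟨⟨3 * k, by omega⟩, rfl⟩
  obtain ⟨p, hp⟩ : ∃ p : Fin (3 * M), p.1 = 3 * k + 1 := ⟨⟨3 * k + 1, by omega⟩, rfl⟩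
  obtain ⟨r, hr⟩ : ∃ r : Fin (3 * M), r.1 = 3 * k + 2 := ⟨⟨3 * k + 2, by omega⟩, rfl⟩
  have hsp : (parentGraph (3 * M) (caterpillarParent z)).Adj s p :=
    parentGraph_caterpillar_adj.2 (by omega)
  have hpr : (parentGraph (3 * M) (caterpillarParent z)).Adj p r :=
    parentGraph_caterpillar_adj.2 (Or.inr ⟨by omega, Or.inr (Or.inr (Or.inr
      ⟨by rw [show p.1 / 3 = k by omega, hzk], by omega⟩))⟩)
  have h2 := parentGraph_caterpillar_adj.1 (φ.map_adj_iff.2 hsp)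
  have h3 := parentGraph_caterpillar_adj.1 (φ.map_adj_iff.2 hpr)
  have h4 : (φ p).1 % 3 ≠ 0 := fun h => by
    have := hspine p h
    omega
  have h5 : (φ r).1 % 3 ≠ 0 := fun h => by
    have := hspine r h
    omega
  have h6 : (φ s).1 = 3 * (M - 1 - k) := by
    have := caterpillar_iso_spine hM h0 h1 φ hφ k hk
    rwa [show (⟨3 * k, by omega⟩ : Fin (3 * M)) = s from Fin.ext hs.symm] at this
  clear hsp hpr hspine hφ
  generalize (φ p).1 = p' at *
  generalize (φ r).1 = r' at *
  generalize (φ s).1 = s' at *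
  rcases h3 with h3 | ⟨-, h3 | h3 | h3 | h3⟩
  · exact absurd h3.1 h4
  · exact absurd h3.1 h4
  · exact absurd h3.2 h5
  · rcases h3.2 with h | h
    · exact absurd h.1 h4
    · exact absurd h.2 h5
  · rcases h2 with h2 | h2
    · exact absurd h2.2.1 h4
    · rw [← h3.1, ← h2.1, h6]
      congr 1
      omega

/-- The bits of a caterpillar that reads `x` from the left end and `y` from the right end. -/
def twoSidedBits {h : ℕ} (M : ℕ) (x y : Fin h → Bool) (k : ℕ) : Bool :=
  if hx : 1 ≤ k ∧ k ≤ h then x ⟨k - 1, by omega⟩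
  else if hy : 1 ≤ M - 1 - k ∧ M - 1 - k ≤ h then y ⟨M - 1 - k - 1, by omega⟩ else true

/-- The certificates of a verifier for symmetric trees are large: two caterpillars with different ends,
but with the same certificates in the middle, can be combined. -/
theorem le_of_verifies_FPFSymmetryOnTrees {q : Polynomial ℕ} (hq : ∀ n : ℕ, n ≤ q.eval n)
    {A : LocalVerifier} (hA : Verifies q A FPFSymmetryOnTrees) {f : ℕ × ℕ → ℕ}
    (hf : IsCertBounded q A FPFSymmetryOnTrees f) (h : ℕ) :
    h ≤ (f (3 * (2 * h + 2 * A.rounds + 4), 0) + 1) * (6 * A.rounds + 6) := by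
  by_contra hlt
  push Not at hlt
  set t := A.rounds with ht
  -- There are `h` blocks for the word at each end, between two blocks that delimit the spine, and the
  -- `2 * t + 2` blocks in the middle have `6 * t + 6` nodes.
  obtain ⟨M, hM⟩ : ∃ M, M = 2 * h + 2 * t + 4 := ⟨_, rfl⟩
  rw [← hM] at hlt
  have hM0 : 0 < M := by omega
  have hmem : ∀ x : Fin h → Bool, caterpillar (twoSidedBits M x x) M hM0 ∈ FPFSymmetryOnTrees := by
    refine fun x => caterpillar_mem hM0 (by omega) fun k hk => ?_
    unfold twoSidedBits
    split_ifs <;> first | omega | rfl | skip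
    · exact congrArg x (Fin.ext (by simp only; omega))
  have hcert : ∀ x : Fin h → Bool, ∃ c : Fin (3 * M) → List Bool, certSize c ≤ f (3 * M, 0) ∧
      LocalVerifier.AcceptsCert q A (caterpillar (twoSidedBits M x x) M hM0) c := by
    intro x
    have := hf _ (hmem x)
    have h0 : (caterpillar (twoSidedBits M x x) M hM0).inputLength = 0 := by
      simp [Config.inputLength, caterpillar]
    rw [h0] at this
    exact this
  choose c hc hacc using hcert
  obtain ⟨x, y, hxy, heq⟩ := exists_ne_forall_eq_of_length_le (f (3 * M, 0))
    (fun (x : Fin h → Bool) (k : Fin (6 * t + 6)) => c x ⟨3 * (h + 1) + k, by omega⟩)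
    (fun x k => length_le_of_certSize_le (hc x) _)
    (by simpa using Nat.pow_lt_pow_right (by norm_num) hlt)
  have hnot : caterpillar (twoSidedBits M x y) M hM0 ∉ FPFSymmetryOnTrees := by
    intro hmem
    have hpal := palindrome_of_caterpillar_mem (by omega)
      (by unfold twoSidedBits; split_ifs <;> first | omega | rfl)
      (by unfold twoSidedBits; split_ifs <;> first | omega | rfl) hmem
    apply hxy
    funext j
    have hleft : twoSidedBits M x y (j + 1) = x j := by
      unfold twoSidedBits
      rw [dif_pos (by omega)]
      exact congrArg x (Fin.ext (by simp))
    have hright : twoSidedBits M x y (M - 1 - (j + 1)) = y j := by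
      unfold twoSidedBits
      rw [dif_neg (by omega), dif_pos (by omega)]
      exact congrArg y (Fin.ext (by simp only; omega))
    have h1 := hpal (j + 1) (by omega)
    have h2 := hpal (M - 1 - (j + 1)) (by omega)
    rw [show M - 1 - (M - 1 - (j.1 + 1)) = j.1 + 1 by omega] at h2
    rw [hleft, hright] at h1 h2
    cases hx : x j <;> cases hy : y j <;> simp_all
  refine hA.2 _ hnot (fun u => if u.1 / 3 ≤ h + 1 + 2 * t then c x u else c y u) _
    (Config.isIdAssignment_succ hq _) (LocalAlgorithm.allAccept_of_hybrid A
      (x := fun u => (([] : List Bool), if u.1 / 3 ≤ h + 1 + 2 * t then c x u else c y u))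
      (fun a b h => Fin.ext (by simpa using h)) (fun u => u.1 / 3) ?_ (h + 1) ?_ ?_
      (hacc x _ (Config.isIdAssignment_succ hq _)) (hacc y _ (Config.isIdAssignment_succ hq _)))
  · intro u v huv
    have := parentGraph_caterpillar_adj.1 huv
    omega
  · intro u hu
    have hu' : u.1 / 3 ≤ h + 1 + 2 * t := hu
    refine ⟨Prod.ext rfl (by simp only [hu', if_true]), fun v => ?_⟩
    have hz : twoSidedBits M x y (u.1 / 3) = twoSidedBits M x x (u.1 / 3) := by
      unfold twoSidedBits
      split_ifs <;> first | omega | rfl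
    rw [parentGraph_caterpillar_adj, parentGraph_caterpillar_adj, hz]
  · intro u hu
    refine ⟨Prod.ext rfl ?_, fun v => ?_⟩
    · dsimp only
      split_ifs with hu'
      · have := heq ⟨u.1 - 3 * (h + 1), by omega⟩
        have hcu : (⟨3 * (h + 1) + (u.1 - 3 * (h + 1)), by omega⟩ : Fin (3 * M)) = u :=
          Fin.ext (by simp only; omega)
        simp only [hcu] at this
        exact this
      · rfl
    · have hz : twoSidedBits M x y (u.1 / 3) = twoSidedBits M y y (u.1 / 3) := by
        unfold twoSidedBits
        split_ifs <;> first | omega | rfl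
      rw [parentGraph_caterpillar_adj, parentGraph_caterpillar_adj, hz]

/-! ### The hierarchy -/

/-- A bound with an additive constant is a bound up to a factor if the left-hand side exceeds twice the
constant. -/
theorem isBigO_of_eventually_le_add {g f : ℕ × ℕ → ℝ} {a b : ℝ} (ha : 0 ≤ a)
    (hle : ∀ᶠ x in atTop, g x ≤ a + b * f x) (hg : ∀ᶠ x in atTop, 2 * a ≤ g x) : g =O[atTop] f := by
  refine IsBigO.of_bound (2 * |b|) ?_
  filter_upwards [hle, hg] with x h1 h2
  rw [Real.norm_of_nonneg (by linarith), Real.norm_eq_abs, mul_assoc, ← abs_mul]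
  linarith [le_abs_self (b * f x)]

theorem tendsto_fst_atTop : Tendsto (fun x : ℕ × ℕ => (x.1 : ℝ)) atTop atTop :=
  tendsto_natCast_atTop_atTop.comp (by rw [← prod_atTop_atTop_eq]; exact tendsto_fst)

theorem tendsto_log_fst_atTop : Tendsto (fun x : ℕ × ℕ => Real.log x.1) atTop atTop :=
  Real.tendsto_log_atTop.comp tendsto_fst_atTop

/-- Paths whose number of nodes is a multiple of a constant suffice, since the bound on the size of the
certificates is monotone. -/
theorem needsCertSize_treeLanguage {q : Polynomial ℕ} (hq : ∀ n : ℕ, n ≤ q.eval n) :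
    NeedsCertSize q TreeLanguage fun x => Real.log x.1 := by
  intro A hA f hf hfA
  set l := 2 * A.rounds + 3 with hl
  set t := 2 * A.rounds + 1 with ht
  refine isBigO_of_eventually_le_add (a := Real.log (2 * l) + t * Real.log 2) (b := t * Real.log 2)
    (add_nonneg (Real.log_nonneg ?_) (by positivity)) ?_ (tendsto_log_fst_atTop.eventually_ge_atTop _)
  · have : (1 : ℝ) ≤ l := by exact_mod_cast (by omega : 1 ≤ l)
    linarith
  filter_upwards [eventually_le_fst l] with ⟨n, m⟩ hn
  dsimp only at hn ⊢
  have hk : 0 < n / l := Nat.div_pos hn (by omega)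
  have h1 := le_of_verifies_treeLanguage hq hA hfA hk
  rw [← hl, ← ht] at h1
  have h2 : f (n / l * l, 0) ≤ f (n, m) := hf ⟨Nat.div_mul_le_self n l, Nat.zero_le m⟩
  have h3 : n / l ≤ 2 ^ ((f (n, m) + 1) * t) :=
    h1.trans (Nat.pow_le_pow_right (by norm_num) (Nat.mul_le_mul_right _ (by omega)))
  have h4 : n ≤ 2 * l * 2 ^ ((f (n, m) + 1) * t) := by
    have h5 : n < l * (n / l + 1) := Nat.lt_mul_div_succ n (by omega)
    calc n ≤ l * (n / l + 1) := h5.le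
      _ ≤ l * (2 * (n / l)) := Nat.mul_le_mul_left _ (by omega)
      _ ≤ l * (2 * 2 ^ ((f (n, m) + 1) * t)) := by gcongr
      _ = _ := by ring
  have h5 : (n : ℝ) ≤ 2 * l * 2 ^ ((f (n, m) + 1) * t) := by exact_mod_cast h4
  have hn0 : (0 : ℝ) < n := by exact_mod_cast (by omega : 0 < n)
  have hl0 : (l : ℝ) ≠ 0 := by exact_mod_cast (by omega : l ≠ 0)
  have h6 := Real.log_le_log hn0 h5
  rw [Real.log_mul (by positivity) (by positivity), Real.log_pow] at h6
  push_cast at h6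
  linarith

/-- Caterpillars whose number of nodes is in a fixed residue class suffice, since the bound on the size of
the certificates is monotone. -/
theorem needsCertSize_FPFSymmetryOnTrees {q : Polynomial ℕ} (hq : ∀ n : ℕ, n ≤ q.eval n) :
    NeedsCertSize q FPFSymmetryOnTrees fun x => (x.1 : ℝ) := by
  intro A hA f hf hfA
  set t := A.rounds with ht
  refine isBigO_of_eventually_le_add (a := 6 * (6 * t + 6) + 6 * t + 18) (b := 6 * (6 * t + 6))
    (by positivity) ?_ (tendsto_fst_atTop.eventually_ge_atTop _)
  filter_upwards [eventually_le_fst (6 * t + 12)] with ⟨n, m⟩ hn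
  dsimp only at hn ⊢
  -- The largest word whose caterpillar has at most `n` nodes.
  obtain ⟨h, hh⟩ : ∃ h, h = (n - (6 * t + 12)) / 6 := ⟨_, rfl⟩
  have h1 := le_of_verifies_FPFSymmetryOnTrees hq hA hfA h
  rw [← ht] at h1
  have h2 : f (3 * (2 * h + 2 * t + 4), 0) ≤ f (n, m) :=
    hf ⟨by change 3 * (2 * h + 2 * t + 4) ≤ n; omega, Nat.zero_le m⟩
  have h3 : h ≤ (f (n, m) + 1) * (6 * t + 6) :=
    h1.trans (Nat.mul_le_mul_right _ (by omega))
  have h4 : n ≤ 6 * h + 6 * t + 18 := by omega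
  have h3' : (h : ℝ) ≤ (f (n, m) + 1) * (6 * t + 6) := by exact_mod_cast h3
  have h4' : (n : ℝ) ≤ 6 * h + 6 * t + 18 := by exact_mod_cast h4
  linarith

/-- A local algorithm, as a verifier that ignores the certificates. -/
def LocalAlgorithm.ignoreCert (A : LocalAlgorithm (List Bool)) : LocalVerifier :=
  letI := A.primcodable
  { State := A.State
    rounds := A.rounds
    init := fun y => A.init (y.1, y.2.1)
    step := A.step
    out := A.out
    computable_init := A.computable_init.comp
      (Computable.pair .fst (Computable.fst.comp .snd))
    computable_step := A.computable_step
    computable_out := A.computable_out }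

theorem LocalAlgorithm.allAccept_ignoreCert {A : LocalAlgorithm (List Bool)} {C : Config}
    {ident : Fin C.n → ℕ} {c : Fin C.n → List Bool} :
    A.ignoreCert.AllAccept C ident (fun v => (C.input v, c v)) ↔ A.AllAccept C ident C.input := by
  have key : ∀ r v, A.ignoreCert.stateAfter C ident (fun v => (C.input v, c v)) r v =
      A.stateAfter C ident C.input r v := by
    intro r
    induction r with
    | zero => exact fun v => rfl
    | succ r ih =>
      intro v
      have : A.ignoreCert.stateAfter C ident (fun v => (C.input v, c v)) r =
        A.stateAfter C ident C.input r := funext ih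
      simp only [stateAfter, this]
      rfl
  exact forall_congr' fun v => by
    change A.out (A.ignoreCert.stateAfter C ident _ A.rounds v) = true ↔ _
    rw [key]

theorem LD_subset (q : Polynomial ℕ) :
    LD q ⊆ NLDOf q (bigO fun _ => 1) := by
  rintro L ⟨hL, A, hA⟩
  have hacc : ∀ C ∈ L, LocalVerifier.AcceptsCert q A.ignoreCert C fun _ => [] := fun C hC ident hid =>
    LocalAlgorithm.allAccept_ignoreCert.2 ((hA C ident hid).2 hC)
  refine ⟨hL, A.ignoreCert, ⟨fun C hC => ⟨_, hacc C hC⟩, fun C hC c ident hid h =>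
    hC ((hA C ident hid).1 (LocalAlgorithm.allAccept_ignoreCert.1 h))⟩, fun _ => 0,
    ⟨monotone_const, ?_⟩, fun C hC => ⟨fun _ => [], by simp [certSize], hacc C hC⟩⟩
  simpa only [Nat.cast_zero] using isBigO_zero (E' := ℝ) (fun _ : ℕ × ℕ => (1 : ℝ)) atTop

theorem isBigO_one_log_fst :
    (fun _ : ℕ × ℕ => (1 : ℝ)) =O[atTop] fun x : ℕ × ℕ => Real.log x.1 :=
  (isLittleO_const_left.2 (Or.inr (tendsto_norm_atTop_atTop.comp tendsto_log_fst_atTop))).isBigO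

theorem isLittleO_log_fst :
    (fun x : ℕ × ℕ => Real.log x.1) =o[atTop] fun x : ℕ × ℕ => (x.1 : ℝ) :=
  Real.isLittleO_log_id_atTop.comp_tendsto tendsto_fst_atTop

theorem isBigO_fst_sq :
    (fun x : ℕ × ℕ => (x.1 : ℝ)) =O[atTop] fun x : ℕ × ℕ => (x.1 : ℝ) ^ 2 := by
  refine IsBigO.of_bound 1 (Eventually.of_forall fun x => ?_)
  rw [Real.norm_of_nonneg (by positivity), Real.norm_of_nonneg (by positivity), one_mul]
  exact_mod_cast Nat.le_self_pow two_ne_zero x.1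

theorem isBigO_fst_sq_add : (fun x : ℕ × ℕ => (x.1 : ℝ) ^ 2) =O[atTop]
    fun x : ℕ × ℕ => (x.1 : ℝ) ^ 2 + x.2 := by
  refine IsBigO.of_bound 1 (Eventually.of_forall fun x => ?_)
  rw [Real.norm_of_nonneg (by positivity), Real.norm_of_nonneg (by positivity), one_mul]
  exact le_add_of_nonneg_right (Nat.cast_nonneg _)

/-- If every verifier for `L` needs certificates of size `Ω(g')` and `g'` is not in `O(g)`, then
certificates of size `O(g)` do not suffice. -/
theorem NeedsCertSize.notMem {q : Polynomial ℕ} {L : Set Config} {g g' : ℕ × ℕ → ℝ}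
    (h : NeedsCertSize q L g') (hg : ¬ g' =O[atTop] g) : L ∉ NLDOf q (bigO g) :=
  fun ⟨_, A, hA, f, hf, hfA⟩ => hg ((h A hA f hf.1 hfA).trans hf.2)

theorem agreement_sq_mem (q : Polynomial ℕ) :
    AgreementLanguage (fun d => d ^ 2) ∈ NLDOf q (bigO fun x => (x.1 : ℝ) ^ 2) := by
  have hh : Primrec fun d : ℕ => d ^ 2 := by
    simpa only [sq, id] using Primrec.nat_mul.comp (Primrec.id (α := ℕ)) (Primrec.id (α := ℕ))
  have hmono : Monotone fun d : ℕ => d ^ 2 := fun a b hab => Nat.pow_le_pow_left hab 2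
  obtain ⟨A, hA, hf⟩ := exists_agreementVerifier q hh hmono
  refine ⟨isDecidableLanguage_agreement hh, A, hA, _, ⟨fun x y hxy => hmono hxy.1, ?_⟩, hf⟩
  simpa using isBigO_refl (fun x : ℕ × ℕ => (x.1 : ℝ) ^ 2) atTop

/-- In a dumbbell with two ends of size `m`, linear certificates have a length of order `m`, which is
too small to compare inputs of length `m ^ 2`. -/
theorem agreement_sq_notMem {q : Polynomial ℕ} (hq : ∀ n : ℕ, n ≤ q.eval n) :
    AgreementLanguage (fun d => d ^ 2) ∉ NLDOf q (bigO fun x => (x.1 : ℝ)) := by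
  rintro ⟨-, A, hA, f, ⟨-, hO⟩, hfA⟩
  obtain ⟨c', hc'⟩ := hO.bound
  obtain ⟨⟨N, W⟩, hNW⟩ := eventually_atTop.1 hc'
  obtain ⟨c, hc⟩ := exists_nat_ge c'
  obtain ⟨l, hl⟩ : ∃ l, l = 2 * A.rounds + 1 := ⟨_, rfl⟩
  -- The linear bound `c * n` holds for `n ≥ N` and `|w| ≥ W`, and dividing the inequality
  -- `m ^ 2 ≤ (c * (2 * m + l) + 1) * l` by `m` gives a contradiction for this `m`.
  obtain ⟨m, hm⟩ : ∃ m, m = N + W + (c * (2 + l) + 1) * l + 1 := ⟨_, rfl⟩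
  have hmm : m ≤ m ^ 2 := Nat.le_self_pow two_ne_zero m
  have h1 := le_of_verifies_agreement hq (fun a b hab => Nat.pow_le_pow_left hab 2) hA hfA
    (m := m) (by omega) (by omega)
  rw [← hl] at h1
  have h2 : f (2 * m + l, 2 * m ^ 2) ≤ c * (2 * m + l) := by
    have h3 := hNW (2 * m + l, 2 * m ^ 2)
      ⟨by change N ≤ 2 * m + l; omega, by change W ≤ 2 * m ^ 2; omega⟩
    rw [Real.norm_of_nonneg (by positivity), Real.norm_of_nonneg (by positivity)] at h3
    have h4 : (f (2 * m + l, 2 * m ^ 2) : ℝ) ≤ c * ((2 * m + l : ℕ) : ℝ) :=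
      h3.trans (mul_le_mul_of_nonneg_right hc (by positivity))
    exact_mod_cast h4
  have h3 : m * m ≤ m * ((c * (2 + l) + 1) * l) := calc
    m * m = m ^ 2 := (sq m).symm
    _ ≤ (f (2 * m + l, 2 * m ^ 2) + 1) * l := h1
    _ ≤ (c * (2 * m + m * l) + m) * l := by
      refine Nat.mul_le_mul_right _ (Nat.add_le_add (h2.trans ?_) (by omega))
      exact Nat.mul_le_mul_left _ (Nat.add_le_add_left (Nat.le_mul_of_pos_left _ (by omega)) _)
    _ = m * ((c * (2 + l) + 1) * l) := by ring
  have := Nat.le_of_mul_le_mul_left h3 (by omega)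
  omega

theorem mainTheorem1 (q : Polynomial ℕ) (hq : ∀ n : ℕ, n ≤ q.eval n) :
    LD q ⊂ NLDOf q (bigO fun _ => 1) ∧
    NLDOf q (bigO fun _ => 1) ⊂ NLDOf q (bigO fun x => Real.log x.1) ∧
    NLDOf q (bigO fun x => Real.log x.1) ⊂ NLDOf q (bigO fun x => (x.1 : ℝ)) ∧
    NLDOf q (bigO fun x => (x.1 : ℝ)) ⊂ NLDOf q (bigO fun x => (x.1 : ℝ) ^ 2) ∧
    NLDOf q (bigO fun x => (x.1 : ℝ) ^ 2) ⊆ NLDOf q (bigO fun x => (x.1 : ℝ) ^ 2 + x.2) ∧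
    NLDOf q (bigO fun x => (x.1 : ℝ) ^ 2 + x.2) = NLD q ∧
    (TreeLanguage ∈ NLDOf q (bigO fun x => Real.log x.1) ∧
      NeedsCertSize q TreeLanguage fun x => Real.log x.1) ∧
    (FPFSymmetryOnTrees ∈ NLDOf q (bigO fun x => (x.1 : ℝ)) ∧
      NeedsCertSize q FPFSymmetryOnTrees fun x => (x.1 : ℝ)) ∧
    EqSizePartition ∈ NLDOf q (bigO fun x => (x.1 : ℝ) ^ 2) := by
  have hone : AgreementLanguage (fun _ => 1) ∈ NLDOf q (bigO fun _ => 1) := by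
    have hh : Primrec fun _ : ℕ => 1 := Primrec.const 1
    obtain ⟨A, hA, hf⟩ := exists_agreementVerifier q hh monotone_const
    refine ⟨isDecidableLanguage_agreement hh, A, hA, _, ⟨monotone_const, ?_⟩, hf⟩
    simpa using isBigO_refl (fun _ : ℕ × ℕ => (1 : ℝ)) atTop
  have hlog : ¬ (fun x : ℕ × ℕ => Real.log x.1) =O[atTop] fun _ => (1 : ℝ) := by
    rw [isBigO_one_iff]
    exact not_isBoundedUnder_of_tendsto_atTop (tendsto_norm_atTop_atTop.comp tendsto_log_fst_atTop)
  have hlin : ¬ (fun x : ℕ × ℕ => (x.1 : ℝ)) =O[atTop] fun x => Real.log x.1 := fun h =>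
    isLittleO_log_fst.not_isBigO
      (tendsto_log_fst_atTop.eventually_ne_atTop 0).frequently h
  refine ⟨(LD_subset q).ssubset_of_mem_notMem hone (agreement_notMem_LD q hq),
    (NLDOf_mono q (bigO_mono isBigO_one_log_fst)).ssubset_of_mem_notMem (treeLanguage_mem q)
      ((needsCertSize_treeLanguage hq).notMem hlog),
    (NLDOf_mono q (bigO_mono isLittleO_log_fst.isBigO)).ssubset_of_mem_notMem
      (FPFSymmetryOnTrees_mem q) ((needsCertSize_FPFSymmetryOnTrees hq).notMem hlin),
    (NLDOf_mono q (bigO_mono isBigO_fst_sq)).ssubset_of_mem_notMem (agreement_sq_mem q)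
      (agreement_sq_notMem hq),
    NLDOf_mono q (bigO_mono isBigO_fst_sq_add),
    (NLDOf_subset_NLD q _).antisymm (NLD_subset q hq),
    ⟨treeLanguage_mem q, needsCertSize_treeLanguage hq⟩,
    ⟨FPFSymmetryOnTrees_mem q, needsCertSize_FPFSymmetryOnTrees hq⟩, eqSizePartition_mem q⟩
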